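/- Let $V$ be a complex vector space of finite dimension $N$, and let $\mathrm{P}_{i,j}$ be the operator exchanging the $i$-th and $j$-th copies of $V$ in a tensor power of $V$. Let $R(u)=\mathrm{Id}-\mathrm{P}/u$ be the Yang solution, and let $R_{i,j}(u)=\mathrm{Id}-\mathrm{P}_{i,j}/u$. For $\mathbf c\in\mathbb C^n$ and $\mathbf c'\in\mathbb C^{n'}$, label the copies of $V$ in $V^{\otimes n}\otimes V^{\otimes n'}$ by $1,\dots,n,\underline 1,\dots,\underline{n'}$ and define the fused operator $$R_{\mathbf c,\mathbf c'}(u)=\prod_{j=1,\dots,n'}^{\rightarrow}R_{n,\underline j}(u+c_n-c'_j)\cdots R_{2,\underline j}(u+c_2-c'_j)\,R_{1,\underline j}(u+c_1-c'_j),$$ and let $F(c_1,\dots,c_n)=\prod_{1\le i<j\le n}R_{i,j}(c_i-c_j)\in\mathrm{End}(V^{\otimes n})$, with the factors in lexicographic order from left to right. For a standard Young tableau $\mathcal T$ of size $n\ge 1$ and shape $\lambda$ with at most $N$ rows, let $c^{\mathcal T}_k$ be the content (column minus row) of the box containing $k$, and $\mathbf c^{\mathcal T}=(c^{\mathcal T}_1,\dots,c^{\mathcal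 T}_n)$. Let $F(\mathcal T)$ be the result of the consecutive evaluations $c_1=c^{\mathcal T}_1$, then $c_2=c^{\mathcal T}_2$, …, then $c_n=c^{\mathcal T}_n$ of the rational function $F$, and let $W_{\mathcal T}\subset V^{\otimes n}$ be the image of $F(\mathcal T)$. For two such tableaux $\mathcal T,\mathcal T'$ let $R^{\mathrm{res}}_{\mathcal T,\mathcal T'}(u)$ be the restriction of $R_{\mathbf c^{\mathcal T},\mathbf c^{\mathcal T'}}(u)$ to $W_{\mathcal T}\otimes W_{\mathcal T'}$, for all $u\in\mathbb C$ such that $u+c^{\mathcal T}_i-c^{\mathcal T'}_j\ne0$ for all $i,j$. Let $M_\lambda$ be the irreducible highest-weight $U(\mathfrak{gl}_N)$-module of highest weight $\lambda$, where $\mathfrak{gl}_N=\mathrm{End}(V)$ acts on $V^{\otimes n}$ by $g\mapsto\sum_i g_i$ ($g_i$ being $g$ acting on the $i$-th copy). Then the following hold. (i) The consecutive evaluations defining $F(\mathcal T)$ are non-singular; $W_{\mathcal T}$ is a $U(\mathfrak{gl}_N)$-submodule of $V^{\otimes n}$ isomorphic to $M_{\lambda}$; and $R_{\mathbf c^{\mathcal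 T},\mathbf c^{\mathcal T'}}(u)$ preserves $W_{\mathcal T}\otimes W_{\mathcal T'}$. So $R^{\mathrm{res}}_{\mathcal T,\mathcal T'}(u)$ is an endomorphism of the space $W_{\mathcal T}\otimes W_{\mathcal T'}\cong M_{\mathrm{sh}(\mathcal T)}\otimes M_{\mathrm{sh}(\mathcal T')}$. These functions form a family of solutions of the Yang–Baxter equation: for all such $\mathcal T,\mathcal T',\mathcal T''$, $$R^{\mathrm{res}}_{\mathcal T,\mathcal T'}(u)R^{\mathrm{res}}_{\mathcal T,\mathcal T''}(u+v)R^{\mathrm{res}}_{\mathcal T',\mathcal T''}(v)=R^{\mathrm{res}}_{\mathcal T',\mathcal T''}(v)R^{\mathrm{res}}_{\mathcal T,\mathcal T''}(u+v)R^{\mathrm{res}}_{\mathcal T,\mathcal T'}(u)$$ on $W_{\mathcal T}\otimes W_{\mathcal T'}\otimes W_{\mathcal T''}$, whenever the operators involved are defined. (ii) If $\mathcal T,\widetilde{\mathcal T}$ have the same shape and $\mathcal T',\widetilde{\mathcal T}'$ have the same shape, then $R^{\mathrm{res}}_{\mathcal T,\mathcal T'}$ and $R^{\mathrm{res}}_{\widetilde{\mathcal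 T},\widetilde{\mathcal T}'}$ are defined for the same $u$ and coincide up to a change of basis: there are linear isomorphisms $\alpha:W_{\mathcal T}\to W_{\widetilde{\mathcal T}}$ and $\beta:W_{\mathcal T'}\to W_{\widetilde{\mathcal T}'}$, independent of $u$, such that $R^{\mathrm{res}}_{\widetilde{\mathcal T},\widetilde{\mathcal T}'}(u)=(\alpha\otimes\beta)\,R^{\mathrm{res}}_{\mathcal T,\mathcal T'}(u)\,(\alpha\otimes\beta)^{-1}$ for all these $u$. -/

import Mathlib

open scoped TensorProduct Topology

attribute [local instance 100] LieRing.ofAssociativeRing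

noncomputable section

namespace YangFusion

/-! ### Standard Young tableaux -/

/-- A standard Young tableau: a Young diagram with `size > 0` cells, together with a bijective
filling of its cells by the entries `0, …, size - 1` (the entry `k` here is the entry `k + 1` in the
usual numbering) which increases along every row and down every column.  Cells are pairs
`(row, column)`, both counted from `0`. -/
structure StandardTableau where
  size : ℕ
  size_pos : 0 < size
  shape : YoungDiagram
  entry : shape.cells ≃ Fin size
  increasing : ∀ p q : shape.cells,
    p.1.1 ≤ q.1.1 → p.1.2 ≤ q.1.2 → p ≠ q → entry p < entry q

/-- The classical content (column minus row) of the cell that contains the entry `k`. -/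
def StandardTableau.content (T : StandardTableau) (k : Fin T.size) : ℂ :=
  ((T.entry.symm k).1.2 : ℂ) - ((T.entry.symm k).1.1 : ℂ)

/-- The standard Young tableaux whose shape has at most `N` rows. -/
abbrev Tableaux (N : ℕ) : Type := {T : StandardTableau // T.shape.colLen 0 ≤ N}

/-! ### The Yang solution and its fusion -/

section Operators

variable (V : Type*) [AddCommGroup V] [Module ℂ V]

/-- `V^{⊗ n}`. -/
abbrev TPow (n : ℕ) : Type _ := ⨂[ℂ] _ : Fin n, V

/-- The operator `P_{i,j}` exchanging the copies of `V` labelled by `i` and `j` in a tensor power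
of `V` whose copies are labelled by `ι`. -/
def permOp {ι : Type} [DecidableEq ι] (i j : ι) : Module.End ℂ (⨂[ℂ] _ : ι, V) :=
  (PiTensorProduct.reindex ℂ (fun _ : ι => V) (Equiv.swap i j)).toLinearMap

/-- The Yang solution `R(u) = Id - P / u` placed in the copies `i` and `j`; meaningful for
`u ≠ 0`. -/
def yang {ι : Type} [DecidableEq ι] (i j : ι) (u : ℂ) : Module.End ℂ (⨂[ℂ] _ : ι, V) :=
  1 - u⁻¹ • permOp V i j

/-- The fused operator `R_{c,c'}(u)` on `V^{⊗ n} ⊗ V^{⊗ n'}`: the product over `j = 1, …, n'`, from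
left to right, of `R_{n,j'}(u + c_n - c'_j) ⋯ R_{1,j'}(u + c_1 - c'_j)`, where the copies of `V`
are labelled by `1, …, n, 1', …, n'`. -/
def fused {n n' : ℕ} (c : Fin n → ℂ) (c' : Fin n' → ℂ) (u : ℂ) :
    Module.End ℂ (TPow V n ⊗[ℂ] TPow V n') :=
  (PiTensorProduct.tmulEquiv (ι := Fin n) (ι₂ := Fin n') ℂ V).symm.conj
    ((List.finRange n').map fun j =>
      ((List.finRange n).reverse.map fun i =>
        yang V (Sum.inl i : Fin n ⊕ Fin n') (Sum.inr j) (u + c i - c' j)).prod).prod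

/-- The function `F(c) = ∏_{i < j} R_{i,j}(c_i - c_j)` with values in `End (V^{⊗ n})`, the factors
being ordered lexicographically from left to right; meaningful when the `c_i` are distinct. -/
def fusionFun {n : ℕ} (c : Fin n → ℂ) : Module.End ℂ (TPow V n) :=
  ((List.finRange n).map fun i =>
    (((List.finRange n).filter fun j => i < j).map fun j => yang V i j (c i - c j)).prod).prod

end Operators

/-! ### Consecutive evaluations of a rational function -/

/-- `IsConsecutiveValue G c X`: the rational function `G` of `n` complex variables with values in
the finite-dimensional space `E` is non-singular for the consecutive evaluations
`u_1 = c_1`, then `u_2 = c_2`, …, then `u_n = c_n`, with final value `X`.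

The evaluation at `u_1 = c_1` is the rational function `G'` of the remaining variables such that
`G(u_1, u_2, …, u_n)` tends to `G'(u_2, …, u_n)` as `u_1` tends to `c_1`, for all generic values of
`u_2, …, u_n`, that is, outside the zero set of some nonzero polynomial.  Convergence in `E` is
tested on linear functionals. -/
def IsConsecutiveValue {E : Type*} [AddCommGroup E] [Module ℂ E] :
    {n : ℕ} → ((Fin n → ℂ) → E) → (Fin n → ℂ) → E → Prop
  | 0, G, c, X => G c = X
  | n + 1, G, c, X => ∃ G' : (Fin n → ℂ) → E,
      (∃ p : MvPolynomial (Fin n) ℂ, p ≠ 0 ∧ ∀ w : Fin n → ℂ, MvPolynomial.eval w p ≠ 0 →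
        ∀ l : Module.Dual ℂ E,
          Filter.Tendsto (fun z : ℂ => l (G (Fin.cons z w))) (𝓝[≠] (c 0)) (𝓝 (l (G' w)))) ∧
      IsConsecutiveValue G' (Fin.tail c) X

section Tableau

variable (V : Type*) [AddCommGroup V] [Module ℂ V]

open Classical in
/-- The operator `F(T)`: the value of `F` for the consecutive evaluations of its variables at the
contents of `T` (and `0` if `F` were singular there). -/
def tableauOp (T : StandardTableau) : Module.End ℂ (TPow V T.size) :=
  if h : ∃ X, IsConsecutiveValue (fun c => fusionFun V c) T.content X then h.choose else 0

/-- The subspace `W_T` of `V^{⊗ n}`: the image of `F(T)`. -/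
def tableauSpace (T : StandardTableau) : Submodule ℂ (TPow V T.size) :=
  LinearMap.range (tableauOp V T)

/-- The inclusion of `W_T ⊗ W_T'` in `V^{⊗ n} ⊗ V^{⊗ n'}`. -/
def incl (T T' : StandardTableau) :
    tableauSpace V T ⊗[ℂ] tableauSpace V T' →ₗ[ℂ] TPow V T.size ⊗[ℂ] TPow V T'.size :=
  TensorProduct.map (tableauSpace V T).subtype (tableauSpace V T').subtype

open Classical in
/-- The restriction to `W_T ⊗ W_T'` of the fused operator `R_{c,c'}(u)`, where `c` and `c'` are the
contents of `T` and `T'` (and `0` if that operator did not preserve `W_T ⊗ W_T'`). -/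
def fusedRes (T T' : StandardTableau) (u : ℂ) :
    Module.End ℂ (tableauSpace V T ⊗[ℂ] tableauSpace V T') :=
  if h : ∃ A : Module.End ℂ (tableauSpace V T ⊗[ℂ] tableauSpace V T'),
      incl V T T' ∘ₗ A = fused V T.content T'.content u ∘ₗ incl V T T'
  then h.choose else 0

end Tableau

/-- The values of the spectral parameter at which every factor of the fused operator attached to
`T` and `T'` is defined. -/
def regular (T T' : StandardTableau) : Set ℂ :=
  {u | ∀ (i : Fin T.size) (j : Fin T'.size), u + T.content i - T'.content j ≠ 0}

/-! ### Families of solutions of the Yang--Baxter equation -/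

section YangBaxter

variable {A B C : Type*} [AddCommGroup A] [AddCommGroup B] [AddCommGroup C]
  [Module ℂ A] [Module ℂ B] [Module ℂ C]

/-- An endomorphism of `A ⊗ B` acting on `A ⊗ B ⊗ C`. -/
def leg12 (C : Type*) [AddCommGroup C] [Module ℂ C] (f : Module.End ℂ (A ⊗[ℂ] B)) :
    Module.End ℂ ((A ⊗[ℂ] B) ⊗[ℂ] C) :=
  LinearMap.rTensor C f

/-- An endomorphism of `A ⊗ C` acting on `A ⊗ B ⊗ C`. -/
def leg13 (B : Type*) [AddCommGroup B] [Module ℂ B] (f : Module.End ℂ (A ⊗[ℂ] C)) :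
    Module.End ℂ ((A ⊗[ℂ] B) ⊗[ℂ] C) :=
  (TensorProduct.rightComm ℂ A C B).conj (LinearMap.rTensor B f)

/-- An endomorphism of `B ⊗ C` acting on `A ⊗ B ⊗ C`. -/
def leg23 (A : Type*) [AddCommGroup A] [Module ℂ A] (f : Module.End ℂ (B ⊗[ℂ] C)) :
    Module.End ℂ ((A ⊗[ℂ] B) ⊗[ℂ] C) :=
  (TensorProduct.assoc ℂ A B C).symm.conj (LinearMap.lTensor A f)

end YangBaxter

/-- The functions `R μ ν` of the spectral parameter, with values in `End (M μ ⊗ M ν)` and defined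
on `dom μ ν`, form a family of solutions of the Yang--Baxter equation
`R_{μ,ν}(u) R_{μ,τ}(u+v) R_{ν,τ}(v) = R_{ν,τ}(v) R_{μ,τ}(u+v) R_{μ,ν}(u)`. -/
def IsYangBaxterFamily {I : Type*} (M : I → Type*) [∀ μ, AddCommGroup (M μ)]
    [∀ μ, Module ℂ (M μ)] (dom : I → I → Set ℂ)
    (R : ∀ μ ν : I, ℂ → Module.End ℂ (M μ ⊗[ℂ] M ν)) : Prop :=
  ∀ (μ ν τ : I) (u v : ℂ), u ∈ dom μ ν → u + v ∈ dom μ τ → v ∈ dom ν τ →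
    leg12 (M τ) (R μ ν u) * leg13 (M ν) (R μ τ (u + v)) * leg23 (M μ) (R ν τ v) =
      leg23 (M μ) (R ν τ v) * leg13 (M ν) (R μ τ (u + v)) * leg12 (M τ) (R μ ν u)

/-! ### Representations of the general linear Lie algebra -/

section GeneralLinear

variable {V : Type*} [AddCommGroup V] [Module ℂ V]

/-- The action of an element `g` of `gl(V) = End V` on `V^{⊗ n}`: the sum over `i` of the operators
acting as `g` on the `i`-th copy of `V` and trivially on the others. -/
def glAction (n : ℕ) (g : Module.End ℂ V) : Module.End ℂ (TPow V n) :=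
  ∑ i : Fin n, PiTensorProduct.map (Function.update (fun _ : Fin n => LinearMap.id) i g)

variable (V) in
/-- The enveloping algebra `U(gl(V))`. -/
abbrev UGl : Type _ := UniversalEnvelopingAlgebra ℂ (Module.End ℂ V)

variable {N : ℕ} (b : Module.Basis (Fin N) ℂ V)

/-- The element `E_{ij}` of `gl(V)`, with `E_{ij} b_j = b_i` and `E_{ij} b_k = 0` for `k ≠ j`. -/
def elemGl (i j : Fin N) : Module.End ℂ V := Matrix.toLin b b (Matrix.single i j 1)

/-- The left ideal of `U(gl(V))` generated by the `E_{ij}`, `i < j`, and the `E_{ii} - wt i`.  The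
quotient by it is the Verma module of highest weight `wt`. -/
def vermaIdeal (wt : Fin N → ℂ) : Submodule (UGl V) (UGl V) :=
  Submodule.span (UGl V)
    ({x | ∃ i j : Fin N, i < j ∧ x = UniversalEnvelopingAlgebra.ι ℂ (elemGl b i j)} ∪
     {x | ∃ i : Fin N, x = UniversalEnvelopingAlgebra.ι ℂ (elemGl b i i) -
        algebraMap ℂ (UGl V) (wt i)})

/-- The sum of all the proper left ideals that contain `vermaIdeal b wt`. -/
def maxIdeal (wt : Fin N → ℂ) : Submodule (UGl V) (UGl V) :=
  sSup {J | vermaIdeal b wt ≤ J ∧ J ≠ ⊤}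

/-- The irreducible highest-weight `U(gl(V))`-module of highest weight `wt`: the quotient of the
Verma module of highest weight `wt` by the sum of its proper submodules. -/
abbrev IrrModule (wt : Fin N → ℂ) : Type _ := UGl V ⧸ maxIdeal b wt

/-- The weight given by the row lengths of a Young diagram. -/
def shapeWeight (N : ℕ) (μ : YoungDiagram) (i : Fin N) : ℂ := μ.rowLen i

end GeneralLinear

end YangFusion

end

open scoped TensorProduct Topology

attribute [local instance 100] LieRing.ofAssociativeRing

noncomputable section

namespace YangFusion

/-! ### Uniqueness of consecutive values -/

/-! The proof runs through the Jucys--Murphy elements `J_k = ∑_{i<k} P_{i,k}` on `V^{⊗n}`: the space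
`W_T` turns out to be their joint eigenspace with the contents of `T` as eigenvalues.

Representation theory of these eigenspaces. A tableau is encoded by the word of the rows of its
entries. Splitting off the last copy of `V` turns the last Jucys--Murphy element into `∑ E_{ab} ⊗
E_{ba}` on `M_μ ⊗ V`. A singular vector that is an eigenvector of this operator must have eigenvalue
`μ_i - i` for some row `i`. These numbers are distinct, so each eigenspace has at most one singular
vector up to scale, and the eigenspace is non-zero when the box can be added. For the inner product
in which words are orthonormal, uniqueness of the singular vector gives irreducibility. This yields
`exists_isHighestWeight_jmSpace` and the characteristic identity `aeval_jm_eq_zero`. A grading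
argument in `U(gl(V))` identifies the eigenspace with the quotient of the Verma module
(`exists_irrModule_equiv`).

Fusion. The factors of `F` are regrouped by their larger index. Once the first variables are
evaluated, the product of the factors of larger index `m` is inverse, up to an explicit scalar, to a
product that collapses to `1 - J_m / z`. It is therefore a multiple of the resolvent of `J_m`. In
its spectral decomposition (`fusionStage_mul_fusionFactor`) every coefficient is regular at the
content, and only that of the correct row is non-zero there. So each evaluation multiplies by a
non-zero multiple of a spectral projection (`tendsto_fusionStage`), and the image is the joint
eigenspace (`range_fusionStage`).

Restriction. On `V^{⊗n} ⊗ W_{T'}` each row of the fused operator collapses to `1 - (u + c_i)⁻¹`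
times a mixed Casimir operator, which preserves this subspace and sees `W_{T'}` only as a
representation of `gl(V)` (`lTensor_comp_rowOp_eq_fused`). On `W_T ⊗ V^{⊗n'}` the same happens to
the inverse of the fused operator (`rTensor_comp_colOp_eq_fusedInv`). Finite dimension and
continuity in `u` transfer this to the operator itself. Invariance and independence of the tableaux
follow (`IsJMSubrep.map_comp_resOp`, `map_comp_tableauRes`). The Yang--Baxter equation is a purely
combinatorial consequence of that of `R`, proved for blocks of indices in `blockProd_yangBaxter`,
and it descends to the invariant subspaces. -/

theorem eventually_eval_cons_ne_zero {n : ℕ} {p : MvPolynomial (Fin (n + 1)) ℂ} {w : Fin n → ℂ}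
    (hw : MvPolynomial.eval w (MvPolynomial.finSuccEquiv ℂ n p).leadingCoeff ≠ 0) (a : ℂ) :
    ∀ᶠ z in 𝓝[≠] a, MvPolynomial.eval (Fin.cons z w) p ≠ 0 := by
  set q := Polynomial.map (MvPolynomial.eval w) (MvPolynomial.finSuccEquiv ℂ n p) with hq
  have hq0 : q ≠ 0 := by
    intro h
    apply hw
    have := congrArg (fun r => r.coeff (MvPolynomial.finSuccEquiv ℂ n p).natDegree) h
    simpa [hq, Polynomial.coeff_map] using this
  have hfin : Set.Finite {z : ℂ | q.IsRoot z} := Polynomial.finite_setOfPred_isRoot hq0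
  -- The point `a` may itself be a root; only the finitely many other roots have to be kept at a
  -- distance.
  have hcl : IsClosed ({z : ℂ | q.IsRoot z} \ {a}) := (hfin.subset Set.sdiff_subset).isClosed
  have h1 : ∀ᶠ z in 𝓝 a, z ∉ ({z : ℂ | q.IsRoot z} \ {a}) :=
    hcl.isOpen_compl.mem_nhds (by simp)
  filter_upwards [nhdsWithin_le_nhds h1, self_mem_nhdsWithin] with z hz hza h0
  refine hz ⟨?_, hza⟩
  rw [Set.mem_ofPred_eq, Polynomial.IsRoot, hq, ← MvPolynomial.eval_eq_eval_mv_eval']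
  exact h0

/-- Agreement outside a hypersurface is what an evaluation preserves, so the induction compares two
functions that agree only generically. After one evaluation, agreement holds where the leading
coefficient of `p` in the first variable and both genericity polynomials are non-zero. -/
theorem IsConsecutiveValue.unique {E : Type*} [AddCommGroup E] [Module ℂ E] :
    ∀ {n : ℕ} {G₁ G₂ : (Fin n → ℂ) → E} {c : Fin n → ℂ} {X₁ X₂ : E},
      (∃ p : MvPolynomial (Fin n) ℂ, p ≠ 0 ∧
        ∀ w, MvPolynomial.eval w p ≠ 0 → G₁ w = G₂ w) →
      IsConsecutiveValue G₁ c X₁ → IsConsecutiveValue G₂ c X₂ → X₁ = X₂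
  | 0, G₁, G₂, c, X₁, X₂, ⟨p, hp, h⟩, h₁, h₂ => by
    have h₁ : G₁ c = X₁ := h₁
    have h₂ : G₂ c = X₂ := h₂
    rw [← h₁, ← h₂]
    apply h
    obtain ⟨a, rfl⟩ := MvPolynomial.C_surjective (Fin 0) p
    simpa using hp
  | n + 1, G₁, G₂, c, X₁, X₂, ⟨p, hp, h⟩, ⟨G₁', ⟨p₁, hp₁, h₁⟩, hv₁⟩, ⟨G₂', ⟨p₂, hp₂, h₂⟩, hv₂⟩ => by
    refine IsConsecutiveValue.unique (G₁ := G₁') (G₂ := G₂')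
      ⟨(MvPolynomial.finSuccEquiv ℂ n p).leadingCoeff * p₁ * p₂, ?_, ?_⟩ hv₁ hv₂
    · refine mul_ne_zero (mul_ne_zero ?_ hp₁) hp₂
      simpa using hp
    · intro w hw
      rw [map_mul, map_mul] at hw
      have hq := left_ne_zero_of_mul (left_ne_zero_of_mul hw)
      have hw₁ := right_ne_zero_of_mul (left_ne_zero_of_mul hw)
      have hw₂ := right_ne_zero_of_mul hw
      rw [← sub_eq_zero, ← Module.forall_dual_apply_eq_zero_iff ℂ]
      intro l
      rw [map_sub, sub_eq_zero]
      refine tendsto_nhds_unique_of_eventuallyEq (h₁ w hw₁ l) (h₂ w hw₂ l) ?_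
      filter_upwards [eventually_eval_cons_ne_zero hq (c 0)] with z hz
      rw [h _ hz]

/-! ### Products over blocks of indices -/

section Blocks

variable {M K : Type*} [Monoid M]

theorem commute_list_prod {x : M} {L : List K} {f : K → M} (h : ∀ a ∈ L, Commute x (f a)) :
    Commute x (L.map f).prod := by
  apply Commute.list_prod_right
  intro y hy
  obtain ⟨a, ha, rfl⟩ := List.mem_map.1 hy
  exact h a ha

theorem list_prod_mul_list_prod {L : List K} (hL : L.Nodup) {f g : K → M}
    (h : ∀ a ∈ L, ∀ a' ∈ L, a ≠ a' → Commute (f a) (g a')) :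
    (L.map f).prod * (L.map g).prod = (L.map fun a => f a * g a).prod := by
  induction L with
  | nil => simp
  | cons x l ih =>
    rw [List.nodup_cons] at hL
    have hc : Commute (g x) (l.map f).prod := commute_list_prod fun a ha =>
      (h a (by simp [ha]) x (by simp) (by rintro rfl; exact hL.1 ha)).symm
    simp only [List.map_cons, List.prod_cons]
    rw [← ih hL.2 fun a ha a' ha' => h a (by simp [ha]) a' (by simp [ha'])]
    calc _ = f x * ((l.map f).prod * g x) * (l.map g).prod := by simp only [mul_assoc]
      _ = _ := by rw [← hc.eq]; simp only [mul_assoc]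

variable (R : K → K → M)

/-- `R_{a_n,b} ⋯ R_{a_1,b}`. -/
def colProd (la : List K) (b : K) : M := (la.reverse.map fun a => R a b).prod

/-- The product of the `colProd R la b` over the list `lb`. -/
def blockProd (la lb : List K) : M := (lb.map fun b => colProd R la b).prod

/-- Elements placed at disjoint pairs of indices commute. -/
def Local : Prop := ∀ a b c d : K, a ≠ c → a ≠ d → b ≠ c → b ≠ d → Commute (R a b) (R c d)

/-- The Yang--Baxter equation at three indices. -/
def YBAt (a b c : K) : Prop := R a b * R a c * R b c = R b c * R a c * R a b

@[simp] theorem colProd_nil (b : K) : colProd R [] b = 1 := rfl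

theorem colProd_cons (a : K) (l : List K) (b : K) :
    colProd R (a :: l) b = colProd R l b * R a b := by simp [colProd]

@[simp] theorem blockProd_nil (la : List K) : blockProd R la [] = 1 := rfl

theorem blockProd_cons (la l : List K) (b : K) :
    blockProd R la (b :: l) = colProd R la b * blockProd R la l := rfl

variable {R}

theorem Local.commute_colProd (hR : Local R) {x y b : K} {l : List K} (hx : x ∉ l) (hy : y ∉ l)
    (hxb : x ≠ b) (hyb : y ≠ b) : Commute (R x y) (colProd R l b) :=
  commute_list_prod fun a ha => hR _ _ _ _ (by rintro rfl; simp_all) hxb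
    (by rintro rfl; simp_all) hyb

theorem Local.commute_blockProd (hR : Local R) {x y : K} {la lb : List K} (hx : x ∉ la)
    (hy : y ∉ la) (hx' : x ∉ lb) (hy' : y ∉ lb) : Commute (R x y) (blockProd R la lb) :=
  commute_list_prod fun b hb => hR.commute_colProd hx hy (by rintro rfl; exact hx' hb)
    (by rintro rfl; exact hy' hb)

theorem Local.colProd_commute_colProd (hR : Local R) {la lb : List K} {b d : K}
    (h : ∀ a ∈ la, a ∉ lb) (hb : b ∉ lb) (hd : d ∉ la) (hbd : b ≠ d) :
    Commute (colProd R la b) (colProd R lb d) := by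
  refine (commute_list_prod fun a ha => (hR.commute_colProd ?_ hb ?_ hbd).symm).symm
  · exact h a (by simpa using ha)
  · rintro rfl
    exact hd (by simpa using ha)

theorem Local.colProd_commute_blockProd (hR : Local R) {la lb lc : List K} {b : K}
    (h : ∀ a ∈ la, a ∉ lb) (hb : b ∉ lb) (h' : ∀ a ∈ la, a ∉ lc) (hb' : b ∉ lc) :
    Commute (colProd R la b) (blockProd R lb lc) :=
  commute_list_prod fun d hd => hR.colProd_commute_colProd h hb (fun h0 => h' d h0 hd)
    (by rintro rfl; exact hb' hd)

/-- The equation for blocks grows one side at a time: here the first index becomes a list, then the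
second in `blockProd_colProd_yangBaxter`, then the third in `blockProd_yangBaxter`. In each
induction, locality brings the factors with the new index next to each other, the smaller equation
is applied to them, and locality restores the order. -/
theorem colProd_yangBaxter (hR : Local R) {la : List K} (hla : la.Nodup) {b c : K}
    (hb : b ∉ la) (hc : c ∉ la) (hbc : b ≠ c) (hY : ∀ a ∈ la, YBAt R a b c) :
    colProd R la b * colProd R la c * R b c = R b c * colProd R la c * colProd R la b := by
  induction la with
  | nil => simp
  | cons a l ih =>
    simp only [List.nodup_cons, List.mem_cons, not_or] at hla hb hc
    have ih := ih hla.2 hb.2 hc.2 fun a ha => hY a (by simp [ha])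
    have hY := hY a (by simp)
    rw [YBAt] at hY
    have h1 : Commute (R a b) (colProd R l c) :=
      hR.commute_colProd hla.1 hb.2 (Ne.symm hc.1) hbc
    have h2 : Commute (R a c) (colProd R l b) :=
      hR.commute_colProd hla.1 hc.2 (Ne.symm hb.1) (Ne.symm hbc)
    simp only [colProd_cons]
    calc _ = colProd R l b * (R a b * colProd R l c) * R a c * R b c := by simp only [mul_assoc]
      _ = colProd R l b * colProd R l c * (R a b * R a c * R b c) := by
          rw [h1.eq]; simp only [mul_assoc]
      _ = (colProd R l b * colProd R l c * R b c) * R a c * R a b := by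
          rw [hY]; simp only [mul_assoc]
      _ = R b c * colProd R l c * (colProd R l b * R a c) * R a b := by
          rw [ih]; simp only [mul_assoc]
      _ = _ := by rw [← h2.eq]; simp only [mul_assoc]

theorem blockProd_colProd_yangBaxter (hR : Local R) {la lb : List K} (hla : la.Nodup)
    (hlb : lb.Nodup) {c : K} (hab : ∀ a ∈ la, a ∉ lb) (hca : c ∉ la) (hcb : c ∉ lb)
    (hY : ∀ a ∈ la, ∀ b ∈ lb, YBAt R a b c) :
    blockProd R la lb * colProd R la c * colProd R lb c =
      colProd R lb c * colProd R la c * blockProd R la lb := by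
  induction lb with
  | nil => simp
  | cons b l ih =>
    simp only [List.nodup_cons, List.mem_cons, not_or] at hlb hab hcb
    have hba : b ∉ la := fun h => (hab b h).1 rfl
    have ih := ih hlb.2 (fun a ha => (hab a ha).2) hcb.2
      fun a ha b hb => hY a ha b (by simp [hb])
    have h1 := colProd_yangBaxter hR hla hba hca (Ne.symm hcb.1) fun a ha => hY a ha b (by simp)
    have h2 : Commute (R b c) (blockProd R la l) :=
      hR.commute_blockProd hba hca hlb.1 hcb.2
    have h3 : Commute (colProd R la b) (colProd R l c) :=
      hR.colProd_commute_colProd (fun a ha => (hab a ha).2) hlb.1 hca (Ne.symm hcb.1)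
    simp only [colProd_cons, blockProd_cons]
    calc _ = colProd R la b * (blockProd R la l * colProd R la c * colProd R l c) * R b c := by
          simp only [mul_assoc]
      _ = (colProd R la b * colProd R l c) * colProd R la c * (blockProd R la l * R b c) := by
          rw [ih]; simp only [mul_assoc]
      _ = colProd R l c * (colProd R la b * colProd R la c * R b c) * blockProd R la l := by
          rw [← h2.eq, h3.eq]; simp only [mul_assoc]
      _ = _ := by rw [h1]; simp only [mul_assoc]

theorem blockProd_yangBaxter (hR : Local R) {la lb lc : List K} (hla : la.Nodup)
    (hlb : lb.Nodup) (hlc : lc.Nodup) (hab : ∀ a ∈ la, a ∉ lb) (hac : ∀ a ∈ la, a ∉ lc)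
    (hbc : ∀ b ∈ lb, b ∉ lc) (hY : ∀ a ∈ la, ∀ b ∈ lb, ∀ c ∈ lc, YBAt R a b c) :
    blockProd R la lb * blockProd R la lc * blockProd R lb lc =
      blockProd R lb lc * blockProd R la lc * blockProd R la lb := by
  induction lc with
  | nil => simp
  | cons c l ih =>
    simp only [List.nodup_cons, List.mem_cons, not_or] at hlc hac hbc
    have hca : c ∉ la := fun h => (hac c h).1 rfl
    have hcb : c ∉ lb := fun h => (hbc c h).1 rfl
    have ih := ih hlc.2 (fun a ha => (hac a ha).2) (fun b hb => (hbc b hb).2)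
      fun a ha b hb c hc => hY a ha b hb c (by simp [hc])
    have h1 := blockProd_colProd_yangBaxter hR hla hlb hab hca hcb
      fun a ha b hb => hY a ha b hb c (by simp)
    have h2 : Commute (colProd R lb c) (blockProd R la l) :=
      hR.colProd_commute_blockProd (fun b hb h => hab b h hb) hca (fun b hb => (hbc b hb).2) hlc.1
    have h3 : Commute (colProd R la c) (blockProd R lb l) :=
      hR.colProd_commute_blockProd hab hcb (fun a ha => (hac a ha).2) hlc.1
    simp only [blockProd_cons]
    calc _ = blockProd R la lb * colProd R la c * (blockProd R la l * colProd R lb c)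
          * blockProd R lb l := by simp only [mul_assoc]
      _ = (blockProd R la lb * colProd R la c * colProd R lb c) * blockProd R la l
          * blockProd R lb l := by rw [← h2.eq]; simp only [mul_assoc]
      _ = colProd R lb c * colProd R la c * (blockProd R la lb * blockProd R la l
          * blockProd R lb l) := by rw [h1]; simp only [mul_assoc]
      _ = colProd R lb c * (colProd R la c * blockProd R lb l) * blockProd R la l
          * blockProd R la lb := by rw [ih]; simp only [mul_assoc]
      _ = _ := by rw [h3.eq]; simp only [mul_assoc]

/-- Factors with no common index commute, so the product by columns can be read by rows. Rows are
what collapses when the second tensor factor lies in a Jucys--Murphy eigenspace, columns when the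
first one does. -/
theorem blockProd_eq_rows (hR : Local R) {la lb : List K} (hla : la.Nodup) (hlb : lb.Nodup)
    (hab : ∀ a ∈ la, a ∉ lb) :
    blockProd R la lb = (la.reverse.map fun a => (lb.map fun b => R a b).prod).prod := by
  induction lb with
  | nil => simp
  | cons b l ih =>
    simp only [List.nodup_cons, List.mem_cons, not_or] at hlb hab
    rw [blockProd_cons, ih hlb.2 fun a ha => (hab a ha).2, colProd, list_prod_mul_list_prod]
    · simp
    · simpa using hla
    · intro a ha a' ha' h
      simp only [List.mem_reverse] at ha ha'
      exact commute_list_prod fun d hd => hR _ _ _ _ h (by rintro rfl; exact (hab _ ha).2 hd)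
        (by rintro rfl; exact (hab _ ha').1 rfl) (by rintro rfl; exact hlb.1 hd)

end Blocks

/-! ### Triangular products over pairs of indices. -/

section Triangle

variable {M K : Type*} [Monoid M] {R : K → K → M}

/-- The lexicographic product of the `R a b` over the pairs `a` before `b` of a list. -/
def lexProd (R : K → K → M) : List K → M
  | [] => 1
  | a :: l => (l.map fun b => R a b).prod * lexProd R l

theorem Local.commute_lexProd (hR : Local R) {x y : K} {L : List K} (hx : x ∉ L) (hy : y ∉ L) :
    Commute (R x y) (lexProd R L) := by
  induction L with
  | nil => exact Commute.one_right _
  | cons a l ih =>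
    simp only [List.mem_cons, not_or] at hx hy
    refine Commute.mul_right (commute_list_prod fun b hb => hR _ _ _ _ hx.1 ?_ hy.1 ?_)
      (ih hx.2 hy.2)
    · rintro rfl; exact hx.2 hb
    · rintro rfl; exact hy.2 hb

/-- The factor `R a x` at the end of the row of `a` involves no index of the later pairs inside `l`,
so it slides to the right past all of them. -/
theorem lexProd_append_singleton (hR : Local R) {L : List K} {x : K} (hL : L.Nodup)
    (hx : x ∉ L) : lexProd R (L ++ [x]) = lexProd R L * (L.map fun a => R a x).prod := by
  induction L with
  | nil => simp [lexProd]
  | cons a l ih =>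
    simp only [List.nodup_cons, List.mem_cons, not_or] at hL hx
    simp only [List.cons_append, lexProd, List.map_append, List.prod_append, List.map_cons,
      List.map_nil, List.prod_cons, List.prod_nil, mul_one, ih hL.2 hx.2]
    have := hR.commute_lexProd (x := a) (y := x) (L := l) hL.1 hx.2
    calc _ = (l.map fun b => R a b).prod * (R a x * lexProd R l) * (l.map fun a => R a x).prod := by
          simp only [mul_assoc]
      _ = _ := by rw [this.eq]; simp only [mul_assoc]

theorem prod_filter_lt_eq_lexProd [LinearOrder K] {L : List K} (hL : L.Pairwise (· < ·)) :
    (L.map fun a => ((L.filter fun b => a < b).map fun b => R a b).prod).prod = lexProd R L := by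
  induction L with
  | nil => simp [lexProd]
  | cons a l ih =>
    rw [List.pairwise_cons] at hL
    have h1 : (a :: l).filter (fun b => a < b) = l := by
      rw [List.filter_cons_of_neg (by simp), List.filter_eq_self]
      simpa using hL.1
    rw [List.map_cons, List.prod_cons, h1, lexProd, ← ih hL.2]
    congr 2
    refine List.map_congr_left fun b hb => ?_
    rw [List.filter_cons_of_neg (by simpa using (hL.1 b hb).le)]

/-- Combined with `prod_filter_lt_eq_lexProd`, this regroups the fusion product by larger index. The
group of the larger index `m` involves only the variables up to the `m`-th, which is what
consecutive evaluation requires. -/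
theorem prod_filter_gt_eq_lexProd [LinearOrder K] (hR : Local R) {L : List K}
    (hL : L.Pairwise (· < ·)) :
    (L.map fun b => ((L.filter fun a => a < b).map fun a => R a b).prod).prod = lexProd R L := by
  induction L using List.reverseRecOn with
  | nil => simp [lexProd]
  | append_singleton l x ih =>
    rw [List.pairwise_append] at hL
    have hx : ∀ a ∈ l, a < x := fun a ha => hL.2.2 a ha x (by simp)
    rw [lexProd_append_singleton hR hL.1.nodup fun h => lt_irrefl _ (hx x h), ← ih hL.1]
    simp only [List.map_append, List.prod_append, List.map_cons, List.map_nil, List.prod_cons,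
      List.prod_nil, mul_one]
    congr 2
    · refine List.map_congr_left fun b hb => ?_
      rw [List.filter_append, List.filter_cons_of_neg (by simpa using (hx b hb).le)]
      simp
    · rw [List.filter_append, List.filter_cons_of_neg (by simp), List.filter_nil, List.append_nil,
        List.filter_eq_self.2 (by simpa using hx)]

end Triangle

/-! ### Operators on tensor powers -/

section TensorOperators

variable (V : Type*) [AddCommGroup V] [Module ℂ V] {ι : Type}

/-- The permutation `σ` of the copies of `V`. -/
def permMap (σ : Equiv.Perm ι) : Module.End ℂ (⨂[ℂ] _ : ι, V) :=
  (PiTensorProduct.reindex ℂ (fun _ : ι => V) σ).toLinearMap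

@[simp] theorem permMap_tprod (σ : Equiv.Perm ι) (x : ι → V) :
    permMap V σ (PiTensorProduct.tprod ℂ x) = PiTensorProduct.tprod ℂ fun i => x (σ.symm i) :=
  PiTensorProduct.reindex_tprod _ _

theorem permMap_mul (σ τ : Equiv.Perm ι) : permMap V (σ * τ) = permMap V σ * permMap V τ := by
  apply PiTensorProduct.ext
  ext x
  simp [Module.End.mul_apply, Equiv.Perm.mul_def]

theorem permMap_one : permMap V (1 : Equiv.Perm ι) = 1 := by
  apply PiTensorProduct.ext
  ext x
  simp [Equiv.Perm.one_def]

variable [DecidableEq ι]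

theorem permOp_eq (i j : ι) : permOp V i j = permMap V (Equiv.swap i j) := rfl

@[simp] theorem permOp_tprod (i j : ι) (x : ι → V) :
    permOp V i j (PiTensorProduct.tprod ℂ x) =
      PiTensorProduct.tprod ℂ fun k => x (Equiv.swap i j k) := by
  rw [permOp_eq, permMap_tprod, Equiv.symm_swap]

theorem permOp_comm (i j : ι) : permOp V i j = permOp V j i := by
  rw [permOp_eq, Equiv.swap_comm, permOp_eq]

@[simp] theorem permOp_mul_self (i j : ι) : permOp V i j * permOp V i j = 1 := by
  rw [permOp_eq, ← permMap_mul, Equiv.swap_mul_self, permMap_one]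

theorem permMap_mul_permOp (σ : Equiv.Perm ι) (i j : ι) :
    permMap V σ * permOp V i j = permOp V (σ i) (σ j) * permMap V σ := by
  rw [permOp_eq, permOp_eq, ← permMap_mul, ← permMap_mul, Equiv.swap_apply_apply]
  simp

theorem permOp_mul_permOp {i j k : ι} (hi : i ≠ k) (hj : i ≠ j) :
    permOp V j k * permOp V i j = permOp V i k * permOp V j k := by
  have := permMap_mul_permOp V (Equiv.swap j k) i j
  rwa [← permOp_eq, Equiv.swap_apply_left, Equiv.swap_apply_of_ne_of_ne hj hi] at this

theorem commute_permOp {a b c d : ι} (h₁ : a ≠ c) (h₂ : a ≠ d) (h₃ : b ≠ c) (h₄ : b ≠ d) :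
    Commute (permOp V a b) (permOp V c d) := by
  have := permMap_mul_permOp V (Equiv.swap a b) c d
  rwa [Equiv.swap_apply_of_ne_of_ne h₁.symm h₃.symm, Equiv.swap_apply_of_ne_of_ne h₂.symm h₄.symm]
    at this

theorem commute_yang {a b c d : ι} (h₁ : a ≠ c) (h₂ : a ≠ d) (h₃ : b ≠ c) (h₄ : b ≠ d)
    (u v : ℂ) : Commute (yang V a b u) (yang V c d v) :=
  ((Commute.one_left _).sub_left ((Commute.one_right _).sub_right
    ((commute_permOp V h₁ h₂ h₃ h₄).smul_right _ |>.smul_left _)))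

theorem local_yang (f : ι → ι → ℂ) : Local fun a b => yang V a b (f a b) :=
  fun _ _ _ _ h₁ h₂ h₃ h₄ => commute_yang V h₁ h₂ h₃ h₄ _ _

theorem yang_comm (i j : ι) (u : ℂ) : yang V i j u = yang V j i u := by
  rw [yang, permOp_comm, yang]

/-- Unitarity, from `P² = 1`. With the convention `0⁻¹ = 0` it also holds at `u = 0`, where both
sides are the identity. -/
theorem yang_mul_yang_neg (i j : ι) (u : ℂ) :
    yang V i j u * yang V i j (-u) = (1 - (u ^ 2)⁻¹) • (1 : Module.End ℂ (⨂[ℂ] _ : ι, V)) := by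
  have h := permOp_mul_self V i j
  simp only [yang, mul_sub, sub_mul, one_mul, mul_one, smul_mul_smul_comm, h, inv_neg]
  rw [show (u ^ 2)⁻¹ = u⁻¹ * u⁻¹ by rw [← inv_pow, sq]]
  module

/-- All products of two transpositions among `a, b, c` are one of two 3-cycles, and both triple
products are `P_{a,c}`. The two sides then differ by a multiple of the difference of the 3-cycles,
with coefficient zero by the partial fraction identity `hc`. -/
theorem yang_yangBaxter {a b c : ι} (hab : a ≠ b) (hac : a ≠ c) (hbc : b ≠ c) {u v : ℂ}
    (hu : u ≠ 0) (hv : v ≠ 0) (huv : u + v ≠ 0) :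
    yang V a b u * yang V a c (u + v) * yang V b c v =
      yang V b c v * yang V a c (u + v) * yang V a b u := by
  have e1 : permOp V a b * permOp V a c = permOp V b c * permOp V a b := by
    rw [permOp_comm V a c, permOp_mul_permOp V hbc.symm hac.symm, permOp_comm V c b]
  have e2 : permOp V a c * permOp V b c = permOp V b c * permOp V a b :=
    (permOp_mul_permOp V hac hab).symm
  have e3 : permOp V a b * permOp V b c = permOp V b c * permOp V a c := by
    rw [permOp_comm V b c, permOp_mul_permOp V hab hac]
  have e4 : permOp V a c * permOp V a b = permOp V b c * permOp V a c := by
    rw [permOp_comm V a b, permOp_mul_permOp V hbc hab.symm]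
  have e5 : permOp V b c * permOp V a b * permOp V b c = permOp V a c := by
    rw [mul_assoc, e3, ← mul_assoc, permOp_mul_self, one_mul]
  have e6 : permOp V b c * permOp V a c * permOp V a b = permOp V a c := by
    rw [mul_assoc, e4, ← mul_assoc, permOp_mul_self, one_mul]
  have hc : u⁻¹ * (u + v)⁻¹ + (u + v)⁻¹ * v⁻¹ = u⁻¹ * v⁻¹ := by field_simp; ring
  simp only [yang, mul_sub, sub_mul, one_mul, mul_one, smul_mul_smul_comm, e1, e2, e3, e4, e5, e6]
  rw [← sub_eq_zero]
  calc _ = (u⁻¹ * (u + v)⁻¹ + (u + v)⁻¹ * v⁻¹ - u⁻¹ * v⁻¹) •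
        (permOp V b c * permOp V a b - permOp V b c * permOp V a c) := by module
    _ = 0 := by rw [hc, sub_self, zero_smul]

/-- The endomorphism `g` of `V` acting on the `i`-th copy of `V`. -/
def opAt (i : ι) (g : Module.End ℂ V) : Module.End ℂ (⨂[ℂ] _ : ι, V) :=
  PiTensorProduct.map (Function.update (fun _ : ι => LinearMap.id) i g)

variable {V}

theorem opAt_tprod (i : ι) (g : Module.End ℂ V) (x : ι → V) :
    opAt V i g (PiTensorProduct.tprod ℂ x) =
      PiTensorProduct.tprod ℂ (Function.update x i (g (x i))) := by
  rw [opAt, PiTensorProduct.map_tprod]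
  congr 1
  ext k
  rcases eq_or_ne k i with rfl | hk
  · simp
  · simp [hk]

theorem opAt_add (i : ι) (g h : Module.End ℂ V) : opAt V i (g + h) = opAt V i g + opAt V i h :=
  PiTensorProduct.map_update_add _ _ _ _

theorem opAt_smul (i : ι) (c : ℂ) (g : Module.End ℂ V) : opAt V i (c • g) = c • opAt V i g :=
  PiTensorProduct.map_update_smul _ _ _ _

theorem opAt_mul (i : ι) (g h : Module.End ℂ V) : opAt V i (g * h) = opAt V i g * opAt V i h := by
  apply PiTensorProduct.ext
  ext x
  simp [opAt_tprod, Module.End.mul_apply]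

theorem opAt_commute {i j : ι} (hij : i ≠ j) (g h : Module.End ℂ V) :
    Commute (opAt V i g) (opAt V j h) := by
  apply PiTensorProduct.ext
  ext x
  simp [opAt_tprod, Module.End.mul_apply, hij, hij.symm, Function.update_comm hij]

theorem permMap_mul_opAt (σ : Equiv.Perm ι) (i : ι) (g : Module.End ℂ V) :
    permMap V σ * opAt V i g = opAt V (σ i) g * permMap V σ := by
  apply PiTensorProduct.ext
  ext x
  simp only [LinearMap.compMultilinearMap_apply, Module.End.mul_apply, opAt_tprod, permMap_tprod]
  congr 1
  ext k
  rcases eq_or_ne k (σ i) with rfl | hk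
  · simp only [Equiv.symm_apply_apply, Function.update_self]
    exact congrArg (fun y => g (x y)) (σ.symm_apply_apply i).symm
  · rw [Function.update_of_ne hk, Function.update_of_ne]
    rintro rfl
    simp at hk

/-- The bridge from transpositions to `gl(V)`: as a mixed Casimir element, a sum of transpositions
also makes sense when one tensor power is replaced by any representation. -/
theorem permOp_eq_sum_opAt {N : ℕ} (b : Module.Basis (Fin N) ℂ V) {i j : ι} (hij : i ≠ j) :
    permOp V i j = ∑ p, ∑ q, opAt V i (elemGl b p q) * opAt V j (elemGl b q p) := by
  have hE : ∀ (p q : Fin N) (x : V), elemGl b p q x = b.repr x q • b p := by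
    intro p q x
    conv_lhs => rw [← b.sum_repr x, map_sum]
    simp [elemGl, Matrix.toLin_self, Matrix.single_apply, ite_and]
  apply PiTensorProduct.ext
  ext x
  simp only [LinearMap.compMultilinearMap_apply, LinearMap.sum_apply, Module.End.mul_apply,
    opAt_tprod, permOp_tprod, hE, Function.update_of_ne hij]
  have h1 : (fun k => x (Equiv.swap i j k)) =
      Function.update (Function.update x j (x i)) i (x j) := by
    ext k
    rcases eq_or_ne k i with rfl | hk
    · simpa using congrArg x (Equiv.swap_apply_left k j)
    rcases eq_or_ne k j with rfl | hk'
    · simpa [hk] using congrArg x (Equiv.swap_apply_right i k)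
    · simpa [hk, hk'] using congrArg x (Equiv.swap_apply_of_ne_of_ne hk hk')
  rw [h1]
  conv_lhs => rw [← b.sum_repr (x j)]
  rw [MultilinearMap.map_update_sum]
  refine Finset.sum_congr rfl fun p _ => ?_
  simp only [MultilinearMap.map_update_smul]
  rw [Function.update_comm hij.symm]
  conv_lhs => rw [← b.sum_repr (x i)]
  rw [MultilinearMap.map_update_sum, Finset.smul_sum]
  refine Finset.sum_congr rfl fun q _ => ?_
  rw [Function.update_comm hij.symm]
  simp only [MultilinearMap.map_update_smul]
  rw [smul_comm]

theorem glAction_eq (n : ℕ) (g : Module.End ℂ V) : glAction n g = ∑ i, opAt V i g := rfl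

theorem glAction_add (n : ℕ) (g h : Module.End ℂ V) :
    glAction n (g + h) = glAction n g + glAction n h := by
  simp [glAction_eq, opAt_add, Finset.sum_add_distrib]

theorem glAction_smul (n : ℕ) (c : ℂ) (g : Module.End ℂ V) :
    glAction n (c • g) = c • glAction n g := by
  simp [glAction_eq, opAt_smul, Finset.smul_sum]

theorem glAction_lie (n : ℕ) (g h : Module.End ℂ V) :
    glAction n ⁅g, h⁆ = ⁅glAction n g, glAction n h⁆ := by
  have key : ∀ i j : Fin n, opAt V i g * opAt V j h - opAt V j h * opAt V i g =
      if i = j then opAt V i ⁅g, h⁆ else 0 := by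
    intro i j
    split_ifs with hij
    · subst hij
      rw [← opAt_mul, ← opAt_mul, Ring.lie_def, sub_eq_iff_eq_add, ← opAt_add, sub_add_cancel]
    · rw [(opAt_commute hij g h).eq, sub_self]
  rw [Ring.lie_def (glAction n g)]
  simp only [glAction_eq]
  rw [Finset.sum_mul_sum, Finset.sum_mul_sum]
  conv_rhs => rw [Finset.sum_comm (f := fun i j => opAt V i h * opAt V j g)]
  rw [← Finset.sum_sub_distrib]
  simp only [← Finset.sum_sub_distrib, key]
  simp

variable (V) in
/-- The action of `gl(V)` on `V^{⊗ n}` as a homomorphism of Lie algebras. -/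
def glHom (n : ℕ) : Module.End ℂ V →ₗ⁅ℂ⁆ Module.End ℂ (TPow V n) where
  toFun := glAction n
  map_add' := glAction_add n
  map_smul' := glAction_smul n
  map_lie' := glAction_lie n _ _

theorem glAction_commute_permOp (n : ℕ) (g : Module.End ℂ V) (i j : Fin n) :
    Commute (permOp V i j) (glAction n g) := by
  rw [glAction_eq, Commute, SemiconjBy, Finset.mul_sum, Finset.sum_mul]
  simp only [permOp_eq, permMap_mul_opAt]
  exact Equiv.sum_comp (Equiv.swap i j) fun k => opAt V k g * permMap V (Equiv.swap i j)

end TensorOperators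

/-! ### Jucys--Murphy elements -/

section JucysMurphy

variable (V : Type*) [AddCommGroup V] [Module ℂ V] {ι : Type} [DecidableEq ι]

/-- The Jucys--Murphy element attached to the `k`-th of the copies of `V` labelled by `e`. -/
def jm {n : ℕ} (e : Fin n → ι) (k : Fin n) : Module.End ℂ (⨂[ℂ] _ : ι, V) :=
  ∑ i ∈ Finset.Iio k, permOp V (e i) (e k)

/-- The joint eigenspace of the Jucys--Murphy elements for the eigenvalues `c`. -/
def jmSpace {n : ℕ} (e : Fin n → ι) (c : Fin n → ℂ) : Submodule ℂ (⨂[ℂ] _ : ι, V) :=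
  ⨅ k, LinearMap.ker (jm V e k - c k • 1)

variable {V}

theorem mem_jmSpace {n : ℕ} {e : Fin n → ι} {c : Fin n → ℂ} {f : ⨂[ℂ] _ : ι, V} :
    f ∈ jmSpace V e c ↔ ∀ k, jm V e k f = c k • f := by
  simp [jmSpace, sub_eq_zero]

theorem jm_castSucc {n : ℕ} (e : Fin (n + 1) → ι) (k : Fin n) :
    jm V e k.castSucc = jm V (fun i => e i.castSucc) k := by
  rw [jm, jm]
  have : Finset.Iio k.castSucc = (Finset.Iio k).map Fin.castSuccEmb := by
    ext i
    simp only [Finset.mem_Iio, Finset.mem_map, Fin.castSuccEmb_apply]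
    constructor
    · intro h
      exact ⟨⟨i, by have := Fin.lt_def.1 h; simp at this; omega⟩, h, rfl⟩
    · rintro ⟨a, h, rfl⟩
      exact h
  rw [this, Finset.sum_map]
  rfl

theorem jm_last {n : ℕ} (e : Fin (n + 1) → ι) :
    jm V e (Fin.last n) = ∑ i : Fin n, permOp V (e i.castSucc) (e (Fin.last n)) := by
  have : Finset.Iio (Fin.last n) = Finset.univ.map Fin.castSuccEmb := by
    ext i
    simp only [Finset.mem_Iio, Finset.mem_map, Fin.castSuccEmb_apply, Finset.mem_univ, true_and]
    constructor
    · intro h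
      exact ⟨⟨i, h⟩, rfl⟩
    · rintro ⟨a, rfl⟩
      exact a.2
  rw [jm, this, Finset.sum_map]
  rfl

theorem commute_jm {n : ℕ} {e : Fin n → ι} {x y : ι} (hx : ∀ i, e i ≠ x) (hy : ∀ i, e i ≠ y)
    (k : Fin n) : Commute (permOp V x y) (jm V e k) :=
  Commute.sum_right _ _ _ fun i _ =>
    commute_permOp V (hx i).symm (hx k).symm (hy i).symm (hy k).symm

/-- On a joint eigenvector of the Jucys--Murphy elements the ascending product of Yang operators
collapses. -/
theorem prod_yang_apply {n : ℕ} {e : Fin n → ι} (he : Function.Injective e) {x : ι}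
    (hx : ∀ i, e i ≠ x) {c : Fin n → ℂ} {f : ⨂[ℂ] _ : ι, V} (hf : f ∈ jmSpace V e c) {v : ℂ}
    (hv : v ≠ 0) (hc : ∀ i, v - c i ≠ 0) :
    ((List.finRange n).map fun i => yang V (e i) x (v - c i)).prod f =
      f - v⁻¹ • ∑ i, permOp V (e i) x f := by
  induction n generalizing f with
  | zero => simp
  | succ n ih =>
    rw [mem_jmSpace] at hf
    have hx' : ∀ i : Fin n, e i.castSucc ≠ x := fun i => hx _
    have he' : Function.Injective fun i : Fin n => e i.castSucc :=
      he.comp (Fin.castSucc_injective n)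
    have hne : ∀ i : Fin n, e i.castSucc ≠ e (Fin.last n) := fun i h =>
      absurd (he h) (Fin.castSucc_lt_last i).ne
    have hf' : f ∈ jmSpace V (fun i : Fin n => e i.castSucc) fun i => c i.castSucc := by
      rw [mem_jmSpace]
      intro k
      rw [← jm_castSucc, hf]
    -- The transposition of the copies `last` and `x` commutes with the earlier Jucys--Murphy
    -- elements, so the induction hypothesis also applies to this vector.
    have hg : permOp V (e (Fin.last n)) x f ∈
        jmSpace V (fun i : Fin n => e i.castSucc) fun i => c i.castSucc := by
      rw [mem_jmSpace] at hf' ⊢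
      intro k
      have := commute_jm (V := V) (e := fun i : Fin n => e i.castSucc) hne hx' k
      rw [← Module.End.mul_apply, ← this.eq, Module.End.mul_apply, hf', map_smul]
    -- Moving `P_{last,x}` to the left turns the `P_{i,x}` into the `P_{i,last}`, whose sum is the
    -- last Jucys--Murphy element and acts on `f` by its eigenvalue.
    have hlast : ∑ i : Fin n, permOp V (e i.castSucc) x (permOp V (e (Fin.last n)) x f) =
        c (Fin.last n) • permOp V (e (Fin.last n)) x f := by
      rw [← map_smul, ← hf, jm_last, LinearMap.sum_apply, map_sum]
      refine Finset.sum_congr rfl fun i _ => ?_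
      rw [← Module.End.mul_apply, ← Module.End.mul_apply,
        permOp_mul_permOp V (hx' i) (hne i)]
    rw [List.finRange_succ_last, List.map_append, List.prod_append, Module.End.mul_apply]
    simp only [List.map_cons, List.map_nil, List.prod_singleton, List.map_map]
    have : yang V (e (Fin.last n)) x (v - c (Fin.last n)) f =
        f - (v - c (Fin.last n))⁻¹ • permOp V (e (Fin.last n)) x f := rfl
    rw [this, map_sub, map_smul]
    have h1 := ih he' hx' hf' fun i => hc _
    have h2 := ih he' hx' hg fun i => hc _
    rw [hlast] at h2
    simp only [Function.comp_def]
    rw [h1, h2, Fin.sum_univ_castSucc]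
    -- The term produced by `hlast` corrects the coefficient `1 / (v - c)` of the last transposition
    -- to the uniform `1 / v`.
    have h3 : v⁻¹ = (v - c (Fin.last n))⁻¹ - (v - c (Fin.last n))⁻¹ * v⁻¹ * c (Fin.last n) := by
      have := hc (Fin.last n)
      field_simp
    rw [smul_add]
    nth_rewrite 4 [h3]
    module

/-- The mirror image of `prod_yang_apply`, for an operator with prescribed eigenvalues under right
multiplication; the order of the factors is reversed. It is applied to the partially evaluated
fusion operator. -/
theorem mul_prod_yang {n : ℕ} {e : Fin n → ι} (he : Function.Injective e) {x : ι}
    (hx : ∀ i, e i ≠ x) {c : Fin n → ℂ} {f : Module.End ℂ (⨂[ℂ] _ : ι, V)}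
    (hf : ∀ k, f * jm V e k = c k • f) {v : ℂ} (hv : v ≠ 0) (hc : ∀ i, v - c i ≠ 0) :
    f * ((List.finRange n).reverse.map fun i => yang V (e i) x (v - c i)).prod =
      f - v⁻¹ • (f * ∑ i, permOp V (e i) x) := by
  induction n generalizing f with
  | zero => simp
  | succ n ih =>
    have hx' : ∀ i : Fin n, e i.castSucc ≠ x := fun i => hx _
    have he' : Function.Injective fun i : Fin n => e i.castSucc :=
      he.comp (Fin.castSucc_injective n)
    have hne : ∀ i : Fin n, e i.castSucc ≠ e (Fin.last n) := fun i h =>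
      absurd (he h) (Fin.castSucc_lt_last i).ne
    have hf' : ∀ k : Fin n, f * jm V (fun i : Fin n => e i.castSucc) k = c k.castSucc • f := by
      intro k
      rw [← jm_castSucc, hf]
    have hg : ∀ k : Fin n, f * permOp V (e (Fin.last n)) x *
        jm V (fun i : Fin n => e i.castSucc) k =
        c k.castSucc • (f * permOp V (e (Fin.last n)) x) := by
      intro k
      have := commute_jm (V := V) (e := fun i : Fin n => e i.castSucc) hne hx' k
      rw [mul_assoc, this.eq, ← mul_assoc, hf', smul_mul_assoc]
    have hlast : f * permOp V (e (Fin.last n)) x * ∑ i : Fin n, permOp V (e i.castSucc) x =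
        c (Fin.last n) • (f * permOp V (e (Fin.last n)) x) := by
      rw [← smul_mul_assoc, ← hf, jm_last, mul_assoc, mul_assoc, Finset.mul_sum, Finset.sum_mul]
      congr 1
      refine Finset.sum_congr rfl fun i _ => ?_
      rw [permOp_comm V (e (Fin.last n)) x, permOp_mul_permOp V (hne i) (hx' i)]
    rw [List.finRange_succ_last, List.reverse_append, List.map_append, List.prod_append]
    simp only [List.reverse_singleton, List.map_cons, List.map_nil, List.prod_singleton,
      ← List.map_reverse, List.map_map, Function.comp_def]
    have : f * yang V (e (Fin.last n)) x (v - c (Fin.last n)) =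
        f - (v - c (Fin.last n))⁻¹ • (f * permOp V (e (Fin.last n)) x) := by
      rw [yang, mul_sub, mul_one, mul_smul_comm]
    rw [← mul_assoc, this, sub_mul, smul_mul_assoc]
    have h1 := ih he' hx' hf' fun i => hc _
    have h2 := ih he' hx' hg fun i => hc _
    rw [hlast] at h2
    rw [h1, h2, Fin.sum_univ_castSucc, mul_add]
    have h3 : v⁻¹ = (v - c (Fin.last n))⁻¹ - (v - c (Fin.last n))⁻¹ * v⁻¹ * c (Fin.last n) := by
      have := hc (Fin.last n)
      field_simp
    rw [smul_add]
    nth_rewrite 4 [h3]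
    module

end JucysMurphy

/-! ### Operators on tensor products of tensor powers -/

section Transport

variable {V : Type*} [AddCommGroup V] [Module ℂ V] {ι ι₂ : Type}

theorem hom_ext_tprod₂ {E : Type*} [AddCommGroup E] [Module ℂ E]
    {f g : (⨂[ℂ] _ : ι, V) ⊗[ℂ] (⨂[ℂ] _ : ι₂, V) →ₗ[ℂ] E}
    (h : ∀ (x : ι → V) (y : ι₂ → V),
      f (PiTensorProduct.tprod ℂ x ⊗ₜ PiTensorProduct.tprod ℂ y) =
        g (PiTensorProduct.tprod ℂ x ⊗ₜ PiTensorProduct.tprod ℂ y)) : f = g := by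
  apply TensorProduct.ext
  apply PiTensorProduct.ext
  ext x : 1
  apply PiTensorProduct.ext
  ext y
  exact h x y

variable [DecidableEq ι] [DecidableEq ι₂]

theorem tmulEquiv_rTensor_permOp (i j : ι) (x : (⨂[ℂ] _ : ι, V) ⊗[ℂ] (⨂[ℂ] _ : ι₂, V)) :
    PiTensorProduct.tmulEquiv ℂ V ((permOp V i j).rTensor _ x) =
      permOp V (Sum.inl i) (Sum.inl j) (PiTensorProduct.tmulEquiv ℂ V x) := by
  suffices h : (PiTensorProduct.tmulEquiv ℂ V).toLinearMap ∘ₗ (permOp V i j).rTensor _ =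
      permOp V (Sum.inl i : ι ⊕ ι₂) (Sum.inl j) ∘ₗ (PiTensorProduct.tmulEquiv ℂ V).toLinearMap from
    LinearMap.congr_fun h x
  refine hom_ext_tprod₂ fun x y => ?_
  simp only [LinearMap.comp_apply, LinearMap.rTensor_tmul, permOp_tprod, LinearEquiv.coe_coe,
    PiTensorProduct.tmulEquiv_apply]
  congr 1
  ext (k | k)
  · simp only [Sum.elim_inl, Equiv.swap_apply_def, Sum.inl.injEq]
    split_ifs <;> rfl
  · simp [Equiv.swap_apply_def]

theorem tmulEquiv_lTensor_permOp (i j : ι₂) (x : (⨂[ℂ] _ : ι, V) ⊗[ℂ] (⨂[ℂ] _ : ι₂, V)) :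
    PiTensorProduct.tmulEquiv ℂ V ((permOp V i j).lTensor _ x) =
      permOp V (Sum.inr i) (Sum.inr j) (PiTensorProduct.tmulEquiv ℂ V x) := by
  suffices h : (PiTensorProduct.tmulEquiv ℂ V).toLinearMap ∘ₗ (permOp V i j).lTensor _ =
      permOp V (Sum.inr i : ι ⊕ ι₂) (Sum.inr j) ∘ₗ (PiTensorProduct.tmulEquiv ℂ V).toLinearMap from
    LinearMap.congr_fun h x
  refine hom_ext_tprod₂ fun x y => ?_
  simp only [LinearMap.comp_apply, LinearMap.lTensor_tmul, permOp_tprod, LinearEquiv.coe_coe,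
    PiTensorProduct.tmulEquiv_apply]
  congr 1
  ext (k | k)
  · simp [Equiv.swap_apply_def]
  · simp only [Sum.elim_inr, Equiv.swap_apply_def, Sum.inr.injEq]
    split_ifs <;> rfl

theorem tmulEquiv_rTensor_opAt (i : ι) (g : Module.End ℂ V)
    (x : (⨂[ℂ] _ : ι, V) ⊗[ℂ] (⨂[ℂ] _ : ι₂, V)) :
    PiTensorProduct.tmulEquiv ℂ V ((opAt V i g).rTensor _ x) =
      opAt V (Sum.inl i) g (PiTensorProduct.tmulEquiv ℂ V x) := by
  suffices h : (PiTensorProduct.tmulEquiv ℂ V).toLinearMap ∘ₗ (opAt V i g).rTensor _ =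
      opAt V (Sum.inl i : ι ⊕ ι₂) g ∘ₗ (PiTensorProduct.tmulEquiv ℂ V).toLinearMap from
    LinearMap.congr_fun h x
  refine hom_ext_tprod₂ fun x y => ?_
  simp only [LinearMap.comp_apply, LinearMap.rTensor_tmul, opAt_tprod, LinearEquiv.coe_coe,
    PiTensorProduct.tmulEquiv_apply, Sum.elim_inl, Sum.elim_update_left]

theorem tmulEquiv_lTensor_opAt (i : ι₂) (g : Module.End ℂ V)
    (x : (⨂[ℂ] _ : ι, V) ⊗[ℂ] (⨂[ℂ] _ : ι₂, V)) :
    PiTensorProduct.tmulEquiv ℂ V ((opAt V i g).lTensor _ x) =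
      opAt V (Sum.inr i) g (PiTensorProduct.tmulEquiv ℂ V x) := by
  suffices h : (PiTensorProduct.tmulEquiv ℂ V).toLinearMap ∘ₗ (opAt V i g).lTensor _ =
      opAt V (Sum.inr i : ι ⊕ ι₂) g ∘ₗ (PiTensorProduct.tmulEquiv ℂ V).toLinearMap from
    LinearMap.congr_fun h x
  refine hom_ext_tprod₂ fun x y => ?_
  simp only [LinearMap.comp_apply, LinearMap.lTensor_tmul, opAt_tprod, LinearEquiv.coe_coe,
    PiTensorProduct.tmulEquiv_apply, Sum.elim_inr, Sum.elim_update_right]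

end Transport

/-! ### The Yang--Baxter equation for the fused operators -/

theorem map_blockProd {M M' K K' : Type*} [Monoid M] [Monoid M'] (φ : M →* M') (f : K → K')
    {R : K → K → M} {R' : K' → K' → M'} {la lb : List K}
    (h : ∀ a ∈ la, ∀ b ∈ lb, φ (R a b) = R' (f a) (f b)) :
    φ (blockProd R la lb) = blockProd R' (la.map f) (lb.map f) := by
  simp only [blockProd, colProd, map_list_prod, List.map_map]
  congr 1
  refine List.map_congr_left fun b hb => ?_
  simp only [Function.comp_def, map_list_prod, ← List.map_reverse, List.map_map]
  congr 1
  exact List.map_congr_left fun a ha => h a (by simpa using ha) b hb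

section FusedYangBaxter

variable {A B C : Type*} [AddCommGroup A] [AddCommGroup B] [AddCommGroup C]
  [Module ℂ A] [Module ℂ B] [Module ℂ C]

/-- `leg12` as a homomorphism of algebras. -/
def leg12Hom (C : Type*) [AddCommGroup C] [Module ℂ C] :
    Module.End ℂ (A ⊗[ℂ] B) →ₐ[ℂ] Module.End ℂ ((A ⊗[ℂ] B) ⊗[ℂ] C) :=
  Module.End.rTensorAlgHom ℂ _ _

/-- `leg13` as a homomorphism of algebras. -/
def leg13Hom (B : Type*) [AddCommGroup B] [Module ℂ B] :
    Module.End ℂ (A ⊗[ℂ] C) →ₐ[ℂ] Module.End ℂ ((A ⊗[ℂ] B) ⊗[ℂ] C) :=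
  ((TensorProduct.rightComm ℂ A C B).conjAlgEquiv ℂ).toAlgHom.comp
    (Module.End.rTensorAlgHom ℂ _ _)

/-- `leg23` as a homomorphism of algebras. -/
def leg23Hom (A : Type*) [AddCommGroup A] [Module ℂ A] :
    Module.End ℂ (B ⊗[ℂ] C) →ₐ[ℂ] Module.End ℂ ((A ⊗[ℂ] B) ⊗[ℂ] C) :=
  ((TensorProduct.assoc ℂ A B C).symm.conjAlgEquiv ℂ).toAlgHom.comp
    (Module.End.lTensorAlgHom ℂ _ _)

section Naturality

variable {A' B' C' : Type*} [AddCommGroup A'] [AddCommGroup B'] [AddCommGroup C']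
  [Module ℂ A'] [Module ℂ B'] [Module ℂ C'] (a : A →ₗ[ℂ] A') (b : B →ₗ[ℂ] B') (c : C →ₗ[ℂ] C')

/-- Naturality of the three legs is what makes the Yang--Baxter equation on tensor powers descend
along the inclusions of invariant subspaces. -/
theorem map_leg12 {f : Module.End ℂ (A ⊗[ℂ] B)} {g : Module.End ℂ (A' ⊗[ℂ] B')}
    (h : TensorProduct.map a b ∘ₗ f = g ∘ₗ TensorProduct.map a b) :
    TensorProduct.map (TensorProduct.map a b) c ∘ₗ leg12 C f =
      leg12 C' g ∘ₗ TensorProduct.map (TensorProduct.map a b) c := by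
  rw [leg12, leg12, LinearMap.map_comp_rTensor, LinearMap.rTensor_comp_map, h]

theorem map_leg13 {f : Module.End ℂ (A ⊗[ℂ] C)} {g : Module.End ℂ (A' ⊗[ℂ] C')}
    (h : TensorProduct.map a c ∘ₗ f = g ∘ₗ TensorProduct.map a c) :
    TensorProduct.map (TensorProduct.map a b) c ∘ₗ leg13 B f =
      leg13 B' g ∘ₗ TensorProduct.map (TensorProduct.map a b) c := by
  have h1 := map_leg12 a c b h
  have h2 : TensorProduct.map (TensorProduct.map a b) c ∘ₗ
      (TensorProduct.rightComm ℂ A C B).toLinearMap =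
      (TensorProduct.rightComm ℂ A' C' B').toLinearMap ∘ₗ
        TensorProduct.map (TensorProduct.map a c) b := by
    ext; simp
  have h3 : TensorProduct.map (TensorProduct.map a c) b ∘ₗ
      (TensorProduct.rightComm ℂ A B C).toLinearMap =
      (TensorProduct.rightComm ℂ A' B' C').toLinearMap ∘ₗ
        TensorProduct.map (TensorProduct.map a b) c := by
    ext; simp
  rw [leg12, leg12] at h1
  rw [leg13, leg13, LinearEquiv.conj_apply, LinearEquiv.conj_apply,
    TensorProduct.rightComm_symm, TensorProduct.rightComm_symm]
  calc _ = (TensorProduct.map (TensorProduct.map a b) c ∘ₗ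
      (TensorProduct.rightComm ℂ A C B).toLinearMap) ∘ₗ LinearMap.rTensor B f ∘ₗ
        (TensorProduct.rightComm ℂ A B C).toLinearMap := rfl
    _ = (TensorProduct.rightComm ℂ A' C' B').toLinearMap ∘ₗ
        (TensorProduct.map (TensorProduct.map a c) b ∘ₗ LinearMap.rTensor B f) ∘ₗ
        (TensorProduct.rightComm ℂ A B C).toLinearMap := by rw [h2]; rfl
    _ = (TensorProduct.rightComm ℂ A' C' B').toLinearMap ∘ₗ
        LinearMap.rTensor B' g ∘ₗ (TensorProduct.map (TensorProduct.map a c) b ∘ₗ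
        (TensorProduct.rightComm ℂ A B C).toLinearMap) := by rw [h1]; rfl
    _ = _ := by rw [h3]; rfl

theorem map_leg23 {f : Module.End ℂ (B ⊗[ℂ] C)} {g : Module.End ℂ (B' ⊗[ℂ] C')}
    (h : TensorProduct.map b c ∘ₗ f = g ∘ₗ TensorProduct.map b c) :
    TensorProduct.map (TensorProduct.map a b) c ∘ₗ leg23 A f =
      leg23 A' g ∘ₗ TensorProduct.map (TensorProduct.map a b) c := by
  have h1 : TensorProduct.map a (TensorProduct.map b c) ∘ₗ LinearMap.lTensor A f =
      LinearMap.lTensor A' g ∘ₗ TensorProduct.map a (TensorProduct.map b c) := by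
    rw [LinearMap.map_comp_lTensor, LinearMap.lTensor_comp_map, h]
  have h2 : TensorProduct.map (TensorProduct.map a b) c ∘ₗ
      (TensorProduct.assoc ℂ A B C).symm.toLinearMap =
      (TensorProduct.assoc ℂ A' B' C').symm.toLinearMap ∘ₗ
        TensorProduct.map a (TensorProduct.map b c) := by
    ext; simp
  have h3 : TensorProduct.map a (TensorProduct.map b c) ∘ₗ
      (TensorProduct.assoc ℂ A B C).toLinearMap =
      (TensorProduct.assoc ℂ A' B' C').toLinearMap ∘ₗ
        TensorProduct.map (TensorProduct.map a b) c := by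
    ext; simp
  rw [leg23, leg23, LinearEquiv.conj_apply, LinearEquiv.conj_apply, LinearEquiv.symm_symm,
    LinearEquiv.symm_symm]
  calc _ = (TensorProduct.map (TensorProduct.map a b) c ∘ₗ
      (TensorProduct.assoc ℂ A B C).symm.toLinearMap) ∘ₗ LinearMap.lTensor A f ∘ₗ
        (TensorProduct.assoc ℂ A B C).toLinearMap := rfl
    _ = (TensorProduct.assoc ℂ A' B' C').symm.toLinearMap ∘ₗ
        (TensorProduct.map a (TensorProduct.map b c) ∘ₗ LinearMap.lTensor A f) ∘ₗ
        (TensorProduct.assoc ℂ A B C).toLinearMap := by rw [h2]; rfl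
    _ = (TensorProduct.assoc ℂ A' B' C').symm.toLinearMap ∘ₗ
        LinearMap.lTensor A' g ∘ₗ (TensorProduct.map a (TensorProduct.map b c) ∘ₗ
        (TensorProduct.assoc ℂ A B C).toLinearMap) := by rw [h1]; rfl
    _ = _ := by rw [h3]; rfl

end Naturality

variable (V : Type*) [AddCommGroup V] [Module ℂ V] {n n' n'' : ℕ}

/-- The fused operator on the tensor power whose copies of `V` are labelled by a sum type. -/
theorem fused_eq (c : Fin n → ℂ) (c' : Fin n' → ℂ) (u : ℂ) :
    fused V c c' u = ((PiTensorProduct.tmulEquiv ℂ V).symm.conjAlgEquiv ℂ)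
      (blockProd (fun a b => yang V a b
          (Sum.elim (fun i => u + c i) c' a - Sum.elim (fun i => u + c i) c' b))
        ((List.finRange n).map Sum.inl) ((List.finRange n').map Sum.inr)) := by
  rw [fused, blockProd]
  simp only [colProd, List.map_map, ← List.map_reverse, Function.comp_def, Sum.elim_inl,
    Sum.elim_inr]
  rfl

/-- The three-fold analogue of `PiTensorProduct.tmulEquiv`. -/
def tmulEquiv₃ : (TPow V n ⊗[ℂ] TPow V n') ⊗[ℂ] TPow V n'' ≃ₗ[ℂ]
    ⨂[ℂ] _ : (Fin n ⊕ Fin n') ⊕ Fin n'', V :=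
  TensorProduct.congr (PiTensorProduct.tmulEquiv ℂ V) (LinearEquiv.refl ℂ _) ≪≫ₗ
    PiTensorProduct.tmulEquiv ℂ V

theorem tmulEquiv₃_apply (x : Fin n → V) (y : Fin n' → V) (z : Fin n'' → V) :
    tmulEquiv₃ V ((PiTensorProduct.tprod ℂ x ⊗ₜ PiTensorProduct.tprod ℂ y) ⊗ₜ
      PiTensorProduct.tprod ℂ z) = PiTensorProduct.tprod ℂ (Sum.elim (Sum.elim x y) z) := by
  simp [tmulEquiv₃]

theorem tmulEquiv₃_symm_apply (x : (Fin n ⊕ Fin n') ⊕ Fin n'' → V) :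
    (tmulEquiv₃ V).symm (PiTensorProduct.tprod ℂ x) =
      (PiTensorProduct.tprod ℂ (fun i => x (Sum.inl (Sum.inl i))) ⊗ₜ
        PiTensorProduct.tprod ℂ (fun i => x (Sum.inl (Sum.inr i)))) ⊗ₜ
      PiTensorProduct.tprod ℂ fun i => x (Sum.inr i) := by
  rw [LinearEquiv.symm_apply_eq, tmulEquiv₃_apply]
  congr 1
  ext ((i | i) | i) <;> rfl

/-- An operator on the first two tensor powers, acting on the three-fold tensor power. -/
def sumLeg12 : Module.End ℂ (⨂[ℂ] _ : Fin n ⊕ Fin n', V) →ₐ[ℂ]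
    Module.End ℂ (⨂[ℂ] _ : (Fin n ⊕ Fin n') ⊕ Fin n'', V) :=
  ((tmulEquiv₃ V).conjAlgEquiv ℂ).toAlgHom.comp ((leg12Hom (TPow V n'')).comp
    ((PiTensorProduct.tmulEquiv ℂ V).symm.conjAlgEquiv ℂ).toAlgHom)

/-- An operator on the outer two tensor powers, acting on the three-fold tensor power. -/
def sumLeg13 : Module.End ℂ (⨂[ℂ] _ : Fin n ⊕ Fin n'', V) →ₐ[ℂ]
    Module.End ℂ (⨂[ℂ] _ : (Fin n ⊕ Fin n') ⊕ Fin n'', V) :=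
  ((tmulEquiv₃ V).conjAlgEquiv ℂ).toAlgHom.comp ((leg13Hom (TPow V n')).comp
    ((PiTensorProduct.tmulEquiv ℂ V).symm.conjAlgEquiv ℂ).toAlgHom)

/-- An operator on the last two tensor powers, acting on the three-fold tensor power. -/
def sumLeg23 : Module.End ℂ (⨂[ℂ] _ : Fin n' ⊕ Fin n'', V) →ₐ[ℂ]
    Module.End ℂ (⨂[ℂ] _ : (Fin n ⊕ Fin n') ⊕ Fin n'', V) :=
  ((tmulEquiv₃ V).conjAlgEquiv ℂ).toAlgHom.comp ((leg23Hom (TPow V n)).comp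
    ((PiTensorProduct.tmulEquiv ℂ V).symm.conjAlgEquiv ℂ).toAlgHom)

theorem conj_tmulEquiv_apply {ι ι₂ : Type} (f : Module.End ℂ (⨂[ℂ] _ : ι ⊕ ι₂, V))
    (x : (⨂[ℂ] _ : ι, V) ⊗[ℂ] (⨂[ℂ] _ : ι₂, V)) :
    (PiTensorProduct.tmulEquiv ℂ V).symm.conjAlgEquiv ℂ f x =
      (PiTensorProduct.tmulEquiv ℂ V).symm (f (PiTensorProduct.tmulEquiv ℂ V x)) := rfl

theorem sumLeg12_apply (f : Module.End ℂ (⨂[ℂ] _ : Fin n ⊕ Fin n', V)) (x) :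
    sumLeg12 (n'' := n'') V f x = tmulEquiv₃ V (LinearMap.rTensor (TPow V n'')
      ((PiTensorProduct.tmulEquiv ℂ V).symm.conjAlgEquiv ℂ f) ((tmulEquiv₃ V).symm x)) := rfl

theorem sumLeg13_apply (f : Module.End ℂ (⨂[ℂ] _ : Fin n ⊕ Fin n'', V)) (x) :
    sumLeg13 (n' := n') V f x = tmulEquiv₃ V (TensorProduct.rightComm ℂ _ _ _
      (LinearMap.rTensor (TPow V n') ((PiTensorProduct.tmulEquiv ℂ V).symm.conjAlgEquiv ℂ f)
        (TensorProduct.rightComm ℂ _ _ _ ((tmulEquiv₃ V).symm x)))) := rfl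

theorem sumLeg23_apply (f : Module.End ℂ (⨂[ℂ] _ : Fin n' ⊕ Fin n'', V)) (x) :
    sumLeg23 (n := n) V f x = tmulEquiv₃ V ((TensorProduct.assoc ℂ _ _ _).symm
      (LinearMap.lTensor (TPow V n) ((PiTensorProduct.tmulEquiv ℂ V).symm.conjAlgEquiv ℂ f)
        (TensorProduct.assoc ℂ _ _ _ ((tmulEquiv₃ V).symm x)))) := rfl

theorem sumLeg12_permOp (a b : Fin n ⊕ Fin n') :
    sumLeg12 (n'' := n'') V (permOp V a b) = permOp V (Sum.inl a) (Sum.inl b) := by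
  apply PiTensorProduct.ext
  ext x
  rw [LinearMap.compMultilinearMap_apply, LinearMap.compMultilinearMap_apply, permOp_tprod]
  rw [sumLeg12_apply, tmulEquiv₃_symm_apply, LinearMap.rTensor_tmul, conj_tmulEquiv_apply,
    PiTensorProduct.tmulEquiv_apply, permOp_tprod,
    PiTensorProduct.tmulEquiv_symm_apply,
    tmulEquiv₃_apply]
  congr 1
  have h : ∀ k : Fin n ⊕ Fin n', Sum.elim (fun i => x (Sum.inl (Sum.inl i)))
      (fun i => x (Sum.inl (Sum.inr i))) k = x (Sum.inl k) := by rintro (k | k) <;> rfl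
  ext ((k | k) | k)
  · simp only [Sum.elim_inl, h]
    exact congrArg x (by simp only [Equiv.swap_apply_def, Sum.inl.injEq]; split_ifs <;> rfl)
  · simp only [Sum.elim_inl, Sum.elim_inr, h]
    exact congrArg x (by simp only [Equiv.swap_apply_def, Sum.inl.injEq]; split_ifs <;> rfl)
  · exact congrArg x (by simp [Equiv.swap_apply_def])

theorem sumLeg13_permOp (a b : Fin n ⊕ Fin n'') :
    sumLeg13 (n' := n') V (permOp V a b) =
      permOp V (Sum.map Sum.inl id a) (Sum.map Sum.inl id b) := by
  apply PiTensorProduct.ext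
  ext x
  rw [LinearMap.compMultilinearMap_apply, LinearMap.compMultilinearMap_apply, permOp_tprod]
  rw [sumLeg13_apply, tmulEquiv₃_symm_apply, TensorProduct.rightComm_tmul, LinearMap.rTensor_tmul,
    conj_tmulEquiv_apply, PiTensorProduct.tmulEquiv_apply, permOp_tprod,
    PiTensorProduct.tmulEquiv_symm_apply,
    TensorProduct.rightComm_tmul, tmulEquiv₃_apply]
  congr 1
  have h : ∀ k : Fin n ⊕ Fin n'', Sum.elim (fun i => x (Sum.inl (Sum.inl i)))
      (fun i => x (Sum.inr i)) k = x (Sum.map Sum.inl id k) := by rintro (k | k) <;> rfl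
  have hinj : Function.Injective (Sum.map Sum.inl id : Fin n ⊕ Fin n'' → (Fin n ⊕ Fin n') ⊕ Fin n'')
    := Sum.map_injective.2 ⟨Sum.inl_injective, Function.injective_id⟩
  have h2 : ∀ k, Sum.map Sum.inl id (Equiv.swap a b k) =
      Equiv.swap (Sum.map Sum.inl id a : (Fin n ⊕ Fin n') ⊕ Fin n'') (Sum.map Sum.inl id b)
        (Sum.map Sum.inl id k) := by
    intro k
    simp only [Equiv.swap_apply_def, hinj.eq_iff]
    split_ifs <;> rfl
  ext ((k | k) | k)
  · simp only [Sum.elim_inl, h]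
    exact congrArg x (h2 _)
  · have h3 : ∀ c : Fin n ⊕ Fin n'', (Sum.inl (Sum.inr k) : (Fin n ⊕ Fin n') ⊕ Fin n'') ≠
      Sum.map Sum.inl id c := by rintro (c | c) <;> simp
    exact congrArg x (by rw [Equiv.swap_apply_of_ne_of_ne (h3 _) (h3 _)])
  · simp only [Sum.elim_inr, h]
    exact congrArg x (h2 _)

theorem sumLeg23_permOp (a b : Fin n' ⊕ Fin n'') :
    sumLeg23 (n := n) V (permOp V a b) =
      permOp V (Sum.map Sum.inr id a) (Sum.map Sum.inr id b) := by
  apply PiTensorProduct.ext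
  ext x
  rw [LinearMap.compMultilinearMap_apply, LinearMap.compMultilinearMap_apply, permOp_tprod]
  rw [sumLeg23_apply, tmulEquiv₃_symm_apply, TensorProduct.assoc_tmul, LinearMap.lTensor_tmul,
    conj_tmulEquiv_apply, PiTensorProduct.tmulEquiv_apply, permOp_tprod,
    PiTensorProduct.tmulEquiv_symm_apply,
    TensorProduct.assoc_symm_tmul, tmulEquiv₃_apply]
  congr 1
  have h : ∀ k : Fin n' ⊕ Fin n'', Sum.elim (fun i => x (Sum.inl (Sum.inr i)))
      (fun i => x (Sum.inr i)) k = x (Sum.map Sum.inr id k) := by rintro (k | k) <;> rfl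
  have hinj : Function.Injective
      (Sum.map Sum.inr id : Fin n' ⊕ Fin n'' → (Fin n ⊕ Fin n') ⊕ Fin n'') :=
    Sum.map_injective.2 ⟨Sum.inr_injective, Function.injective_id⟩
  have h2 : ∀ k, Sum.map Sum.inr id (Equiv.swap a b k) =
      Equiv.swap (Sum.map Sum.inr id a : (Fin n ⊕ Fin n') ⊕ Fin n'') (Sum.map Sum.inr id b)
        (Sum.map Sum.inr id k) := by
    intro k
    simp only [Equiv.swap_apply_def, hinj.eq_iff]
    split_ifs <;> rfl
  ext ((k | k) | k)
  · have h3 : ∀ c : Fin n' ⊕ Fin n'', (Sum.inl (Sum.inl k) : (Fin n ⊕ Fin n') ⊕ Fin n'') ≠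
      Sum.map Sum.inr id c := by rintro (c | c) <;> simp
    exact congrArg x (by rw [Equiv.swap_apply_of_ne_of_ne (h3 _) (h3 _)])
  · simp only [Sum.elim_inl, Sum.elim_inr, h]
    exact congrArg x (h2 _)
  · simp only [Sum.elim_inr, h]
    exact congrArg x (h2 _)

theorem map_yang {ι κ : Type} [DecidableEq ι] [DecidableEq κ]
    (φ : Module.End ℂ (⨂[ℂ] _ : ι, V) →ₐ[ℂ] Module.End ℂ (⨂[ℂ] _ : κ, V)) {a b : ι} {a' b' : κ}
    (h : φ (permOp V a b) = permOp V a' b') (u : ℂ) : φ (yang V a b u) = yang V a' b' u := by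
  rw [yang, map_sub, map_one, map_smul, h, yang]

theorem fused_yangBaxter {c : Fin n → ℂ} {c' : Fin n' → ℂ} {c'' : Fin n'' → ℂ} {u v : ℂ}
    (hu : ∀ i j, u + c i - c' j ≠ 0) (hv : ∀ i j, v + c' i - c'' j ≠ 0)
    (huv : ∀ i j, (u + v) + c i - c'' j ≠ 0) :
    leg12 (TPow V n'') (fused V c c' u) * leg13 (TPow V n') (fused V c c'' (u + v)) *
        leg23 (TPow V n) (fused V c' c'' v) =
      leg23 (TPow V n) (fused V c' c'' v) * leg13 (TPow V n') (fused V c c'' (u + v)) *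
        leg12 (TPow V n'') (fused V c c' u) := by
  apply ((tmulEquiv₃ V).conjAlgEquiv ℂ).injective
  -- Shifting the parameters of the three blocks by `u + v`, `v` and `0` makes every factor a Yang
  -- operator at a difference `w a - w b`, so a single two-index family `R` describes all three
  -- fused operators.
  set w : (Fin n ⊕ Fin n') ⊕ Fin n'' → ℂ :=
    Sum.elim (Sum.elim (fun i => u + v + c i) fun j => v + c' j) c'' with hw
  set R : (Fin n ⊕ Fin n') ⊕ Fin n'' → (Fin n ⊕ Fin n') ⊕ Fin n'' → _ :=
    fun a b => yang V a b (w a - w b) with hR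
  set la : List ((Fin n ⊕ Fin n') ⊕ Fin n'') :=
    (List.finRange n).map fun i => Sum.inl (Sum.inl i) with hla
  set lb : List ((Fin n ⊕ Fin n') ⊕ Fin n'') :=
    (List.finRange n').map fun i => Sum.inl (Sum.inr i) with hlb
  set lc : List ((Fin n ⊕ Fin n') ⊕ Fin n'') := (List.finRange n'').map fun i => Sum.inr i with hlc
  have h12 : (tmulEquiv₃ V).conjAlgEquiv ℂ (leg12 (TPow V n'') (fused V c c' u)) =
      blockProd R la lb := by
    rw [fused_eq]
    refine (map_blockProd (sumLeg12 (n'' := n'') V).toMonoidHom Sum.inl (R' := R) ?_).trans ?_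
    · simp only [List.mem_map, List.mem_finRange, true_and]
      rintro _ ⟨i, rfl⟩ _ ⟨j, rfl⟩
      refine (map_yang V (sumLeg12 V) (sumLeg12_permOp V _ _) _).trans ?_
      simp only [hR, hw, Sum.elim_inl, Sum.elim_inr]
      congr 1
      ring
    · simp only [List.map_map]; rfl
  have h13 : (tmulEquiv₃ V).conjAlgEquiv ℂ (leg13 (TPow V n') (fused V c c'' (u + v))) =
      blockProd R la lc := by
    rw [fused_eq]
    refine (map_blockProd (sumLeg13 (n' := n') V).toMonoidHom (Sum.map Sum.inl id)
      (R' := R) ?_).trans ?_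
    · simp only [List.mem_map, List.mem_finRange, true_and]
      rintro _ ⟨i, rfl⟩ _ ⟨j, rfl⟩
      exact map_yang V (sumLeg13 V) (sumLeg13_permOp V _ _) _
    · simp only [List.map_map]; rfl
  have h23 : (tmulEquiv₃ V).conjAlgEquiv ℂ (leg23 (TPow V n) (fused V c' c'' v)) =
      blockProd R lb lc := by
    rw [fused_eq]
    refine (map_blockProd (sumLeg23 (n := n) V).toMonoidHom (Sum.map Sum.inr id)
      (R' := R) ?_).trans ?_
    · simp only [List.mem_map, List.mem_finRange, true_and]
      rintro _ ⟨i, rfl⟩ _ ⟨j, rfl⟩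
      exact map_yang V (sumLeg23 V) (sumLeg23_permOp V _ _) _
    · simp only [List.map_map]; rfl
  simp only [map_mul, h12, h13, h23]
  refine blockProd_yangBaxter (local_yang V _) ?_ ?_ ?_ ?_ ?_ ?_ ?_
  · exact (List.nodup_finRange n).map (Sum.inl_injective.comp Sum.inl_injective)
  · exact (List.nodup_finRange n').map (Sum.inl_injective.comp Sum.inr_injective)
  · exact (List.nodup_finRange n'').map Sum.inr_injective
  · simp [hla, hlb]
  · simp [hla, hlc]
  · simp [hlb, hlc]
  · simp only [hla, hlb, hlc, List.mem_map, List.mem_finRange, true_and]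
    rintro _ ⟨i, rfl⟩ _ ⟨j, rfl⟩ _ ⟨k, rfl⟩
    have e1 : w (Sum.inl (Sum.inl i)) - w (Sum.inl (Sum.inr j)) = u + c i - c' j := by
      simp only [hw, Sum.elim_inl, Sum.elim_inr]; ring
    have e2 : w (Sum.inl (Sum.inr j)) - w (Sum.inr k) = v + c' j - c'' k := by
      simp only [hw, Sum.elim_inl, Sum.elim_inr]
    have e3 : w (Sum.inl (Sum.inl i)) - w (Sum.inr k) =
        (u + c i - c' j) + (v + c' j - c'' k) := by
      simp only [hw, Sum.elim_inl, Sum.elim_inr]; ring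
    have := yang_yangBaxter V (a := (Sum.inl (Sum.inl i) : (Fin n ⊕ Fin n') ⊕ Fin n''))
      (b := Sum.inl (Sum.inr j)) (c := Sum.inr k) (by simp) (by simp) (by simp)
      (hu i j) (hv j k) (by rw [← e3]; exact huv i k)
    simpa only [YBAt, hR, e1, e2, e3] using this

end FusedYangBaxter

/-! ### Highest weight vectors in unitary representations -/

section HighestWeight

variable {N : ℕ} {M : Type*} [NormedAddCommGroup M] [InnerProductSpace ℂ M]

/-- Operators satisfying the relations of the matrix units of `gl_N`, the adjoint of `E i j` being
`E j i`. -/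
structure IsUnitaryGl (E : Fin N → Fin N → Module.End ℂ M) : Prop where
  comm : ∀ i j k l x, E i j (E k l x) - E k l (E i j x) =
    (if j = k then E i l x else 0) - (if l = i then E k j x else 0)
  adj : ∀ i j x y, inner ℂ (E i j x) y = inner ℂ x (E j i y)

/-- A vector killed by the raising operators. -/
def IsSingular (E : Fin N → Fin N → Module.End ℂ M) (f : M) : Prop :=
  ∀ i j, i < j → E i j f = 0

/-- A subspace stable under all the operators. -/
def IsStable (E : Fin N → Fin N → Module.End ℂ M) (U : Submodule ℂ M) : Prop :=
  ∀ i j, ∀ f ∈ U, E i j f ∈ U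

variable {E : Fin N → Fin N → Module.End ℂ M}

theorem IsSingular.sub {f g : M} (hf : IsSingular E f) (hg : IsSingular E g) :
    IsSingular E (f - g) := fun i j h => by rw [map_sub, hf i j h, hg i j h, sub_zero]

theorem IsSingular.smul {f : M} (hf : IsSingular E f) (c : ℂ) : IsSingular E (c • f) :=
  fun i j h => by rw [map_smul, hf i j h, smul_zero]

theorem IsUnitaryGl.isSingular_diag (hE : IsUnitaryGl E) {f : M} (hf : IsSingular E f)
    (k : Fin N) : IsSingular E (E k k f) := by
  intro i j hij
  have := hE.comm i j k k f
  rw [hf i j hij, map_zero, sub_zero] at this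
  rw [this]
  split_ifs with h1 h2 h2
  · exact absurd (h1.trans h2) hij.ne'
  · rw [← h1, hf i j hij, sub_zero]
  · rw [h2, hf i j hij, sub_zero]
  · simp

theorem IsUnitaryGl.exists_singular [FiniteDimensional ℂ M] (hE : IsUnitaryGl E)
    {U : Submodule ℂ M} (hU : IsStable E U) (hne : U ≠ ⊥) : ∃ f ∈ U, f ≠ 0 ∧ IsSingular E f := by
  -- Since `[D, E_{ij}] = (j - i) E_{ij}`, raising operators strictly increase the eigenvalue of
  -- `D`. An eigenvector in `U` whose eigenvalue has maximal real part is therefore singular.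
  set D : Module.End ℂ M := ∑ k : Fin N, (-(k : ℂ)) • E k k with hD
  have hDU : ∀ f ∈ U, D f ∈ U := by
    intro f hf
    rw [hD, LinearMap.sum_apply]
    exact U.sum_mem fun k _ => U.smul_mem _ (hU k k f hf)
  have hcomm : ∀ i j f, D (E i j f) = E i j (D f) + ((j : ℂ) - i) • E i j f := by
    intro i j f
    rw [← sub_eq_iff_eq_add', hD]
    simp only [LinearMap.sum_apply, LinearMap.smul_apply, map_sum, map_smul]
    rw [← Finset.sum_sub_distrib]
    have : ∀ k : Fin N, (-(k : ℂ)) • E k k (E i j f) - (-(k : ℂ)) • E i j (E k k f) =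
        (if k = i then (-(k : ℂ)) • E i j f else 0) +
          (if j = k then (k : ℂ) • E i j f else 0) := by
      intro k
      rw [← smul_sub, hE.comm]
      by_cases h1 : k = i <;> by_cases h2 : j = k
      · subst h1; subst h2; simp
      · subst h1; simp [h2]
      · subst h2; simp [h1]
      · simp [h1, h2]
    simp only [this, Finset.sum_add_distrib, Finset.sum_ite_eq, Finset.sum_ite_eq',
      Finset.mem_univ, if_true]
    module
  set D' : Module.End ℂ U := D.restrict hDU with hD'
  have : Nontrivial U := Submodule.nontrivial_iff_ne_bot.2 hne
  have hfin : Set.Finite {μ : ℂ | D'.HasEigenvalue μ} := Module.End.finite_hasEigenvalue D'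
  obtain ⟨μ₀, hμ₀⟩ := Module.End.exists_eigenvalue D'
  obtain ⟨μ, hμ, hmax⟩ := hfin.exists_maximalFor Complex.re _ ⟨μ₀, hμ₀⟩
  obtain ⟨f, hf⟩ := Module.End.HasEigenvalue.exists_hasEigenvector hμ
  have hfD : D f = μ • (f : M) := congrArg Subtype.val hf.apply_eq_smul
  refine ⟨f, f.2, fun h => hf.2 (Subtype.ext h), fun i j hij => ?_⟩
  by_contra hne0
  have hev : D'.HasEigenvalue (μ + ((j : ℂ) - i)) := by
    refine Module.End.hasEigenvalue_of_hasEigenvector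
      (x := ⟨E i j f, hU i j f f.2⟩) ⟨?_, fun h => hne0 (congrArg Subtype.val h)⟩
    rw [Module.End.mem_eigenspace_iff]
    apply Subtype.ext
    change D (E i j f) = (μ + ((j : ℂ) - i)) • E i j f
    rw [hcomm, hfD, map_smul, add_smul]
  have hle := hmax (j := μ + ((j : ℂ) - i)) hev
  simp only [Complex.add_re, Complex.sub_re, Complex.natCast_re] at hle
  have hij' : (i : ℝ) < (j : ℝ) := by exact_mod_cast hij
  have := hle (by linarith)
  linarith

/-- `W` is stable, and `v` spans its space of singular vectors and has weight `wt`. -/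
structure IsHighestWeight (E : Fin N → Fin N → Module.End ℂ M) (W : Submodule ℂ M)
    (wt : Fin N → ℂ) (v : M) : Prop where
  stable : IsStable E W
  mem : v ∈ W
  ne_zero : v ≠ 0
  singular : IsSingular E v
  weight : ∀ i, E i i v = wt i • v
  unique : ∀ f ∈ W, IsSingular E f → ∃ c : ℂ, f = c • v

/-- The orthogonal complement of `U` in `W` is stable because the adjoint of `E i j` is `E j i`. If
it were non-zero, both it and `U` would contain a singular vector, hence `v`, and `v` would be
orthogonal to itself. -/
theorem IsHighestWeight.eq_of_le [FiniteDimensional ℂ M] (hE : IsUnitaryGl E)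
    {W : Submodule ℂ M} {wt : Fin N → ℂ} {v : M} (hW : IsHighestWeight E W wt v)
    {U : Submodule ℂ M} (hUW : U ≤ W) (hU : IsStable E U) (hne : U ≠ ⊥) : U = W := by
  have key : ∀ U : Submodule ℂ M, U ≤ W → IsStable E U → U ≠ ⊥ → v ∈ U := by
    intro U hUW hU hne
    obtain ⟨f, hf, hf0, hfs⟩ := hE.exists_singular hU hne
    obtain ⟨c, rfl⟩ := hW.unique f (hUW hf) hfs
    have hc : c ≠ 0 := by rintro rfl; simp at hf0
    simpa [hc] using U.smul_mem c⁻¹ hf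
  have hperp : Uᗮ ⊓ W = ⊥ := by
    by_contra h
    have h1 := key _ inf_le_right (fun i j f hf => ⟨?_, hW.stable i j f hf.2⟩) h
    · have h2 := key U hUW hU hne
      exact hW.ne_zero (inner_self_eq_zero.1 ((Submodule.mem_orthogonal U v).1 h1.1 v h2))
    · refine (Submodule.mem_orthogonal U _).2 fun u hu => ?_
      rw [← hE.adj]
      exact (Submodule.mem_orthogonal U _).1 hf.1 _ (hU j i u hu)
  have := Submodule.sup_orthogonal_inf_of_hasOrthogonalProjection hUW
  rwa [hperp, sup_bot_eq] at this

theorem IsHighestWeight.conj_weight (hE : IsUnitaryGl E)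
    {W : Submodule ℂ M} {wt : Fin N → ℂ} {v : M} (hW : IsHighestWeight E W wt v)
    (i : Fin N) : (starRingEnd ℂ) (wt i) = wt i := by
  have := hE.adj i i v v
  rw [hW.weight, inner_smul_left, inner_smul_right] at this
  exact mul_right_cancel₀ (fun h => hW.ne_zero (inner_self_eq_zero.1 h)) this

variable {M' : Type*} [NormedAddCommGroup M'] [InnerProductSpace ℂ M']

/-- `M'` is the tensor product of `M` with the vector representation: `s a` is the coefficient of
the `a`-th basis vector, and `J` is the operator `∑ E_{ab} ⊗ E_{ba}`. -/
structure IsVectorTensor (E : Fin N → Fin N → Module.End ℂ M)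
    (E' : Fin N → Fin N → Module.End ℂ M') (s : Fin N → M' →ₗ[ℂ] M) (J : Module.End ℂ M') :
    Prop where
  inj : ∀ f, (∀ a, s a f = 0) → f = 0
  surj : ∀ g : Fin N → M, ∃ f, ∀ a, s a f = g a
  act : ∀ a i j f, s a (E' i j f) = E i j (s a f) + if a = i then s j f else 0
  slice : ∀ a f, s a (J f) = ∑ c, E c a (s c f)
  symm : ∀ f g, inner ℂ (J f) g = inner ℂ f (J g)
  comm : ∀ i j f, J (E' i j f) = E' i j (J f)

variable {E' : Fin N → Fin N → Module.End ℂ M'} {s : Fin N → M' →ₗ[ℂ] M} {J : Module.End ℂ M'}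

/-- The tensor product of `W` with the vector representation. -/
def vecTensor (s : Fin N → M' →ₗ[ℂ] M) (W : Submodule ℂ M) : Submodule ℂ M' :=
  ⨅ a, W.comap (s a)

theorem mem_vecTensor {W : Submodule ℂ M} {f : M'} : f ∈ vecTensor s W ↔ ∀ a, s a f ∈ W := by
  simp [vecTensor]

/-- The subspace of the tensor product of `W` with the vector representation where `J` acts as
`a`. -/
def vecEigen (s : Fin N → M' →ₗ[ℂ] M) (J : Module.End ℂ M') (W : Submodule ℂ M) (a : ℂ) :
    Submodule ℂ M' :=
  vecTensor s W ⊓ Module.End.eigenspace J a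

theorem mem_vecEigen {W : Submodule ℂ M} {a : ℂ} {f : M'} :
    f ∈ vecEigen s J W a ↔ (∀ a, s a f ∈ W) ∧ J f = a • f := by
  rw [vecEigen, Submodule.mem_inf, mem_vecTensor, Module.End.mem_eigenspace_iff]

variable (hT : IsVectorTensor E E' s J)
include hT

theorem IsVectorTensor.stable {W : Submodule ℂ M} (hW : IsStable E W) :
    IsStable E' (vecTensor s W) := by
  intro i j f hf
  rw [mem_vecTensor] at hf ⊢
  intro a
  rw [hT.act]
  refine W.add_mem (hW _ _ _ (hf a)) ?_
  split_ifs
  exacts [hf j, W.zero_mem]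

theorem IsVectorTensor.map_mem {W : Submodule ℂ M} (hW : IsStable E W) {f : M'}
    (hf : f ∈ vecTensor s W) : J f ∈ vecTensor s W := by
  rw [mem_vecTensor] at hf ⊢
  intro a
  rw [hT.slice]
  exact W.sum_mem fun c _ => hW _ _ _ (hf c)

theorem IsVectorTensor.stable_vecEigen {W : Submodule ℂ M} (hW : IsStable E W) (a : ℂ) :
    IsStable E' (vecEigen s J W a) := by
  intro i j f hf
  rw [vecEigen, Submodule.mem_inf, Module.End.mem_eigenspace_iff] at hf ⊢
  exact ⟨hT.stable hW i j f hf.1, by rw [hT.comm, hf.2, map_smul]⟩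

theorem IsVectorTensor.exists_top {f : M'} (hf : f ≠ 0) :
    ∃ i, s i f ≠ 0 ∧ ∀ j, i < j → s j f = 0 := by
  classical
  have hne : (Finset.univ.filter fun i => s i f ≠ 0).Nonempty := by
    by_contra h
    rw [Finset.not_nonempty_iff_eq_empty, Finset.filter_eq_empty_iff] at h
    exact hf (hT.inj f fun a => by simpa using h (Finset.mem_univ a))
  refine ⟨_, (Finset.mem_filter.1 (Finset.max'_mem _ hne)).2, fun j hj => ?_⟩
  by_contra h
  exact absurd (Finset.le_max' _ j (Finset.mem_filter.2 ⟨Finset.mem_univ j, h⟩)) (not_le.2 hj)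

theorem IsVectorTensor.singular_top {f : M'} (hf : IsSingular E' f) {i : Fin N}
    (hi : ∀ j, i < j → s j f = 0) : IsSingular E (s i f) := by
  intro p q hpq
  have h := hT.act i p q f
  rw [hf p q hpq, map_zero] at h
  split_ifs at h with hip
  · rwa [hi q (hip ▸ hpq), add_zero, eq_comm] at h
  · rwa [add_zero, eq_comm] at h

variable {W : Submodule ℂ M} {wt : Fin N → ℂ} {v : M} (hW : IsHighestWeight E W wt v)
include hW

/-- The last non-zero coefficient `f_i` is singular, hence a multiple of `v`. For `p < i`,
singularity under `E'_{pi}` gives `E_{pi} f_p = -f_i`. The `i`-th coefficient of `J f` is then `wt i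
• f_i` minus one copy of `f_i` for each of the `i` rows above. -/
theorem IsVectorTensor.top_of_singular {f : M'} {a : ℂ} (hf : f ∈ vecEigen s J W a) (h0 : f ≠ 0)
    (hs : IsSingular E' f) :
    ∃ i, a = wt i - i ∧ s i f ≠ 0 ∧ (∃ c : ℂ, s i f = c • v) ∧ ∀ j, i < j → s j f = 0 := by
  rw [mem_vecEigen] at hf
  obtain ⟨i, hi, hj⟩ := hT.exists_top h0
  obtain ⟨c, hc⟩ := hW.unique _ (hf.1 i) (hT.singular_top hs hj)
  refine ⟨i, ?_, hi, ⟨c, hc⟩, hj⟩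
  have h1 := hT.slice i f
  rw [hf.2, map_smul] at h1
  have h2 : ∀ p : Fin N, E p i (s p f) =
      (if p = i then wt i • s i f else 0) - (if p < i then s i f else 0) := by
    intro p
    rcases lt_trichotomy p i with hp | rfl | hp
    · have h3 := hT.act p p i f
      rw [hs p i hp, map_zero, if_pos rfl] at h3
      simp only [hp, hp.ne, if_true, if_false, zero_sub]
      exact eq_neg_of_add_eq_zero_left h3.symm
    · simp [hc, hW.weight, smul_comm (wt p) c]
    · simp [hj p hp, hp.ne', hp.not_gt]
  simp only [h2, Finset.sum_sub_distrib, Finset.sum_ite_eq', Finset.mem_univ, if_true] at h1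
  rw [← Finset.sum_filter, Finset.sum_const, Finset.filter_gt_eq_Iio, Fin.card_Iio,
    ← Nat.cast_smul_eq_nsmul ℂ, ← sub_smul] at h1
  exact smul_left_injective ℂ hi h1

/-- `J` is self-adjoint, so the orthogonal complement of the kernel inside the tensor product is
stable. If non-zero it contains an eigenvector of `J`. The eigenspace of that eigenvalue contains a
singular vector, so by `top_of_singular` the eigenvalue is a root, which puts the eigenvector in the
kernel as well. -/
theorem IsVectorTensor.aeval_eq_zero [FiniteDimensional ℂ M'] (hE' : IsUnitaryGl E')
    {f : M'} (hf : f ∈ vecTensor s W) :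
    Polynomial.aeval J (∏ i : Fin N, (Polynomial.X - Polynomial.C (wt i - i))) f = 0 := by
  set p := ∏ i : Fin N, (Polynomial.X - Polynomial.C (wt i - i)) with hp
  set K : Submodule ℂ M' := LinearMap.ker (Polynomial.aeval J p) ⊓ vecTensor s W with hK
  have hKJ : ∀ f ∈ K, J f ∈ K := by
    intro f hf
    refine ⟨LinearMap.mem_ker.2 ?_, hT.map_mem hW.stable hf.2⟩
    rw [← Module.End.mul_apply]
    have : Polynomial.aeval J p * J = J * Polynomial.aeval J p := by
      have := congrArg (Polynomial.aeval J) (mul_comm p Polynomial.X)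
      simpa only [map_mul, Polynomial.aeval_X] using this
    rw [this, Module.End.mul_apply, LinearMap.mem_ker.1 hf.1, map_zero]
  have hle : K ≤ vecTensor s W := inf_le_right
  have hperp : Kᗮ ⊓ vecTensor s W = ⊥ := by
    by_contra h
    have hinv : ∀ f ∈ Kᗮ ⊓ vecTensor s W, J f ∈ Kᗮ ⊓ vecTensor s W := by
      intro f hf
      refine ⟨(Submodule.mem_orthogonal K _).2 fun u hu => ?_, hT.map_mem hW.stable hf.2⟩
      rw [← hT.symm]
      exact (Submodule.mem_orthogonal K _).1 hf.1 _ (hKJ u hu)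
    have : Nontrivial (Kᗮ ⊓ vecTensor s W : Submodule ℂ M') :=
      Submodule.nontrivial_iff_ne_bot.2 h
    obtain ⟨a, ha⟩ := Module.End.exists_eigenvalue (J.restrict hinv)
    obtain ⟨g, hg⟩ := ha.exists_hasEigenvector
    have hgJ : J g = a • (g : M') := congrArg Subtype.val hg.apply_eq_smul
    have hg0 : (g : M') ≠ 0 := fun h => hg.2 (Subtype.ext h)
    have hgU : (g : M') ∈ vecEigen s J W a :=
      ⟨g.2.2, Module.End.mem_eigenspace_iff.2 hgJ⟩
    obtain ⟨f', hf', hf'0, hf's⟩ := hE'.exists_singular (hT.stable_vecEigen hW.stable a)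
      fun hb => hg0 (by rw [hb] at hgU; simpa using hgU)
    obtain ⟨i, hi, -⟩ := hT.top_of_singular hW hf' hf'0 hf's
    have hgK : (g : M') ∈ K := by
      refine ⟨LinearMap.mem_ker.2 ?_, g.2.2⟩
      rw [Module.End.aeval_apply_of_hasEigenvector
        (μ := a) ⟨Module.End.mem_eigenspace_iff.2 hgJ, hg0⟩, hp, Polynomial.eval_prod,
        Finset.prod_eq_zero (Finset.mem_univ i) (by simp [hi]), zero_smul]
    exact hg0 (inner_self_eq_zero.1 ((Submodule.mem_orthogonal K _).1 g.2.1 _ hgK))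
  have hsup := Submodule.sup_orthogonal_inf_of_hasOrthogonalProjection hle
  rw [hperp, sup_bot_eq] at hsup
  rw [← hsup] at hf
  exact hf.1

/-- Distinctness of the `wt j - j` determines the position of the top coefficient. A singular vector
in this eigenspace is then fixed by its `i`-th coefficient, a multiple of `v`, and its weight can be
read off there. -/
theorem IsVectorTensor.isHighestWeight [FiniteDimensional ℂ M'] (hE' : IsUnitaryGl E')
    (hinj : Function.Injective fun i : Fin N => wt i - (i : ℂ)) {i : Fin N}
    (hne : vecEigen s J W (wt i - i) ≠ ⊥) :
    ∃ v', IsHighestWeight E' (vecEigen s J W (wt i - i))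
      (fun k => wt k + if k = i then 1 else 0) v' := by
  have hst := hT.stable_vecEigen hW.stable (wt i - i)
  obtain ⟨v', hv', hv'0, hv's⟩ := hE'.exists_singular hst hne
  have top : ∀ f ∈ vecEigen s J W (wt i - i), IsSingular E' f → f ≠ 0 →
      s i f ≠ 0 ∧ ∃ c : ℂ, s i f = c • v := by
    intro f hf hfs hf0
    obtain ⟨j, hj, h1, h2, -⟩ := hT.top_of_singular hW hf hf0 hfs
    obtain rfl := hinj hj
    exact ⟨h1, h2⟩
  obtain ⟨hd0, d, hd⟩ := top v' hv' hv's hv'0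
  have hd' : d ≠ 0 := by rintro rfl; simp [hd] at hd0
  have huniq : ∀ f ∈ vecEigen s J W (wt i - i), IsSingular E' f → ∃ c : ℂ, f = c • v' := by
    intro f hf hfs
    rcases eq_or_ne f 0 with rfl | hf0
    · exact ⟨0, by simp⟩
    obtain ⟨-, c, hc⟩ := top f hf hfs hf0
    refine ⟨c * d⁻¹, ?_⟩
    by_contra hcon
    have := (top (f - (c * d⁻¹) • v') (Submodule.sub_mem _ hf (Submodule.smul_mem _ _ hv'))
      (hfs.sub (hv's.smul _)) (sub_ne_zero.2 hcon)).1
    apply this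
    rw [map_sub, map_smul, hc, hd, smul_smul, inv_mul_cancel_right₀ hd', sub_self]
  refine ⟨v', hst, hv', hv'0, hv's, fun k => ?_, huniq⟩
  obtain ⟨c, hc⟩ := huniq _ (hst k k v' hv') (hE'.isSingular_diag hv's k)
  have h1 := hT.act i k k v'
  rw [hc, map_smul] at h1
  rw [hc]
  congr 1
  apply smul_left_injective ℂ hd0
  change c • s i v' = _ • s i v'
  rw [h1, hd, map_smul, hW.weight]
  rcases eq_or_ne k i with rfl | hki
  · simp only [if_true, hd]; module
  · simp only [hki, hki.symm, if_false]; module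

/-- If `z = wt i - i` were not an eigenvalue, `z - J` would be invertible on `W ⊗ V`. Let `g c` be
the preimage of `v ⊗ b_c` and `h c` the pairing of `v` with its `c`-th coefficient. The partial sums
`S_k = ⟨v, v⟩ + ∑_{c<k} h c` satisfy `(z - (wt k - k)) h k = S_k`. Hence `S_{k+1} = (z - (wt k - k)
+ 1) h k` stays non-zero up to `k = i`, whereas the recursion at `k = i` gives `S_i = 0`. -/
theorem IsVectorTensor.vecEigen_ne_bot [FiniteDimensional ℂ M'] (hE : IsUnitaryGl E)
    {i : Fin N} (hi' : ∀ j < i, (wt i - i : ℂ) - (wt j - j) + 1 ≠ 0) :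
    vecEigen s J W (wt i - i) ≠ ⊥ := by
  intro hbot
  set z : ℂ := wt i - i with hz
  have hsol : ∀ t ∈ vecTensor s W, ∃ g ∈ vecTensor s W, z • g - J g = t := by
    set L : Module.End ℂ (vecTensor s W) :=
      (z • 1 - J).restrict (p := vecTensor s W) fun f hf =>
        Submodule.sub_mem _ (Submodule.smul_mem _ _ hf) (hT.map_mem hW.stable hf) with hL
    have hLinj : Function.Injective L := by
      rw [← LinearMap.ker_eq_bot, LinearMap.ker_eq_bot']
      intro f hf
      have h1 : z • (f : M') - J f = 0 := congrArg Subtype.val hf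
      have h2 : (f : M') ∈ vecEigen s J W z :=
        ⟨f.2, Module.End.mem_eigenspace_iff.2 (sub_eq_zero.1 h1).symm⟩
      rw [hbot] at h2
      exact Subtype.ext (by simpa using h2)
    intro t ht
    obtain ⟨g, hg⟩ := LinearMap.injective_iff_surjective.1 hLinj ⟨t, ht⟩
    exact ⟨g, g.2, congrArg Subtype.val hg⟩
  have hinj : ∀ f ∈ vecTensor s W, z • f - J f = 0 → f = 0 := by
    intro f hf h
    have h2 : (f : M') ∈ vecEigen s J W z :=
      ⟨hf, Module.End.mem_eigenspace_iff.2 (sub_eq_zero.1 h).symm⟩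
    rw [hbot] at h2
    simpa using h2
  choose t ht using fun c : Fin N => hT.surj fun a => if a = c then v else 0
  have htW : ∀ c, t c ∈ vecTensor s W := by
    intro c
    rw [mem_vecTensor]
    intro a
    rw [ht]
    split_ifs
    exacts [hW.mem, W.zero_mem]
  choose g hgW hg using fun c => hsol (t c) (htW c)
  -- `z - J` is injective and commutes with `E'`, so this reduces to the same relation between the
  -- `v ⊗ b_k`, where singularity of `v` removes the other term.
  have hraise : ∀ c k, c < k → E' c k (g k) = g c := by
    intro c k hck
    rw [← sub_eq_zero]
    refine hinj _ (Submodule.sub_mem _ (hT.stable hW.stable _ _ _ (hgW k)) (hgW c)) ?_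
    have h1 : E' c k (t k) = t c := by
      rw [← sub_eq_zero]
      refine hT.inj _ fun a => ?_
      rw [map_sub, hT.act, ht, ht, ht]
      by_cases h1 : a = k <;> by_cases h2 : a = c <;> simp [h1, h2, hck.ne, hW.singular c k hck]
    rw [smul_sub, map_sub, hT.comm, sub_sub_sub_comm, ← map_smul, ← map_sub, hg, hg, h1, sub_self]
  set h : Fin N → ℂ := fun c => inner ℂ v (s c (g c)) with hh
  have hrec : ∀ k, (z - (wt k - k)) * h k =
      inner ℂ v v + ∑ c ∈ Finset.univ.filter (fun c : Fin N => c < k), h c := by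
    intro k
    have h1 := congrArg (s k) (hg k)
    rw [map_sub, map_smul, hT.slice, ht, if_pos rfl] at h1
    have h2 := congrArg (inner ℂ v) h1
    rw [inner_sub_right, inner_smul_right, inner_sum] at h2
    -- Below `k`, `hraise` exchanges `g k` for `g c`. At `k`, the adjoint gives the weight, which is
    -- real. Above `k`, the adjoint is a raising operator and kills `v`.
    have h3 : ∀ c, inner ℂ v (E c k (s c (g k))) =
        (if c = k then wt k * h k else 0) + (if c < k then h c - h k else 0) := by
      intro c
      rcases lt_trichotomy c k with hc | rfl | hc
      · have h4 := hT.act c c k (g k)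
        rw [hraise c k hc, if_pos rfl] at h4
        rw [if_neg hc.ne, if_pos hc, hh]
        simp only
        rw [h4, inner_add_right]
        ring
      · rw [← hE.adj, hW.weight, inner_smul_left, hW.conj_weight hE]
        simp [hh]
      · rw [← hE.adj, hW.singular k c hc]
        simp [hc.ne', hc.not_gt]
    simp only [h3, Finset.sum_add_distrib, Finset.sum_ite_eq', Finset.mem_univ, if_true] at h2
    rw [← Finset.sum_filter, Finset.sum_sub_distrib, Finset.sum_const, Finset.filter_gt_eq_Iio,
      Fin.card_Iio, nsmul_eq_mul, ← Finset.filter_gt_eq_Iio] at h2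
    rw [← h2]
    ring
  have hS : ∀ k : ℕ, k ≤ (i : ℕ) →
      (inner ℂ v v : ℂ) + ∑ c ∈ Finset.univ.filter (fun c : Fin N => (c : ℕ) < k), h c ≠ 0 := by
    intro k
    induction k with
    | zero => intro _; simpa using hW.ne_zero
    | succ k ih =>
      intro hk
      have ih := ih (by omega)
      have hkN : k < N := by omega
      have hlt : (⟨k, hkN⟩ : Fin N) < i := Fin.lt_def.2 (by simpa using hk)
      have e : (Finset.univ.filter fun c : Fin N => (c : ℕ) < k + 1) =
          insert ⟨k, hkN⟩ (Finset.univ.filter fun c : Fin N => (c : ℕ) < k) := by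
        ext c
        simp [Fin.ext_iff]
        omega
      have hr := hrec ⟨k, hkN⟩
      simp only [Fin.lt_def] at hr
      rw [e, Finset.sum_insert (by simp), add_left_comm, ← hr, ← one_add_mul]
      rw [← hr] at ih
      exact mul_ne_zero (by rw [add_comm]; exact hi' _ hlt) (right_ne_zero_of_mul ih)
  have := hrec i
  rw [hz, sub_self, zero_mul] at this
  exact hS i le_rfl this.symm

end HighestWeight

/-! ### Coordinates on tensor powers -/

section Coordinates

variable {N : ℕ} {V : Type*} [AddCommGroup V] [Module ℂ V] (b : Module.Basis (Fin N) ℂ V) {n : ℕ}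

/-- The coordinates of a tensor in the basis of words. -/
def coord (n : ℕ) : TPow V n ≃ₗ[ℂ] ((Fin n → Fin N) → ℂ) :=
  (Basis.piTensorProduct fun _ : Fin n => b).equivFun

theorem coord_tprod (x : Fin n → V) (w : Fin n → Fin N) :
    coord b n (PiTensorProduct.tprod ℂ x) w = ∏ k, b.repr (x k) (w k) := by
  rw [coord, Module.Basis.equivFun_apply, Basis.piTensorProduct_repr_tprod_apply]

theorem coord_permOp (i j : Fin n) (x : TPow V n) (w : Fin n → Fin N) :
    coord b n (permOp V i j x) w = coord b n x (w ∘ Equiv.swap i j) := by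
  suffices h : (LinearMap.proj w ∘ₗ (coord b n).toLinearMap) ∘ₗ permOp V i j =
      LinearMap.proj (w ∘ Equiv.swap i j) ∘ₗ (coord b n).toLinearMap from LinearMap.congr_fun h x
  apply PiTensorProduct.ext
  ext x
  simp only [LinearMap.compMultilinearMap_apply, LinearMap.comp_apply, permOp_tprod,
    LinearEquiv.coe_coe, LinearMap.proj_apply, coord_tprod]
  rw [← Equiv.prod_comp (Equiv.swap i j)]
  refine Finset.prod_congr rfl fun k _ => ?_
  exact congrArg (fun l => b.repr (x l) (w (Equiv.swap i j k))) (Equiv.swap_apply_self i j k)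

theorem elemGl_apply (p q : Fin N) (x : V) : elemGl b p q x = b.repr x q • b p := by
  conv_lhs => rw [← b.sum_repr x, map_sum]
  simp [elemGl, Matrix.toLin_self, Matrix.single_apply, ite_and]

theorem coord_opAt (i : Fin n) (p q : Fin N) (x : TPow V n) (w : Fin n → Fin N) :
    coord b n (opAt V i (elemGl b p q) x) w =
      if w i = p then coord b n x (Function.update w i q) else 0 := by
  suffices h : (LinearMap.proj w ∘ₗ (coord b n).toLinearMap) ∘ₗ opAt V i (elemGl b p q) =
      if w i = p then LinearMap.proj (Function.update w i q) ∘ₗ (coord b n).toLinearMap else 0 by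
    have := LinearMap.congr_fun h x
    split_ifs with h1 <;> simpa [h1] using this
  apply PiTensorProduct.ext
  ext x
  simp only [LinearMap.compMultilinearMap_apply, LinearMap.comp_apply, opAt_tprod,
    LinearEquiv.coe_coe, LinearMap.proj_apply, coord_tprod, elemGl_apply]
  rw [← Finset.mul_prod_erase _ _ (Finset.mem_univ i)]
  have h1 : ∏ k ∈ Finset.univ.erase i, b.repr (Function.update x i (b.repr (x i) q • b p) k) (w k) =
      ∏ k ∈ Finset.univ.erase i, b.repr (x k) (w k) :=
    Finset.prod_congr rfl fun k hk => by rw [Function.update_of_ne (Finset.ne_of_mem_erase hk)]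
  rw [h1]
  split_ifs with h
  · simp only [LinearMap.comp_apply, LinearEquiv.coe_coe, LinearMap.proj_apply, coord_tprod]
    rw [← Finset.mul_prod_erase _ _ (Finset.mem_univ i)]
    have h2 : ∏ k ∈ Finset.univ.erase i, b.repr (x k) (Function.update w i q k) =
        ∏ k ∈ Finset.univ.erase i, b.repr (x k) (w k) :=
      Finset.prod_congr rfl fun k hk => by rw [Function.update_of_ne (Finset.ne_of_mem_erase hk)]
    rw [h2]
    simp [h]
  · simp [Ne.symm h]

/-- The operators `E_{ij}` on the tensor power. -/
def tensorE (n : ℕ) (i j : Fin N) : Module.End ℂ (TPow V n) := glAction n (elemGl b i j)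

theorem coord_tensorE (p q : Fin N) (x : TPow V n) (w : Fin n → Fin N) :
    coord b n (tensorE b n p q x) w =
      ∑ i, if w i = p then coord b n x (Function.update w i q) else 0 := by
  rw [tensorE, glAction_eq, LinearMap.sum_apply, map_sum, Finset.sum_apply]
  simp only [coord_opAt]

/-- The inner product for which the words form an orthonormal basis. -/
@[reducible] def tensorCore (n : ℕ) : InnerProductSpace.Core ℂ (TPow V n) where
  inner x y := ∑ w, (starRingEnd ℂ) (coord b n x w) * coord b n y w
  conj_inner_symm x y := by simp [map_sum, mul_comm]
  re_inner_nonneg x := by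
    simp only [map_sum]
    refine Finset.sum_nonneg fun w _ => ?_
    rw [← Complex.normSq_eq_conj_mul_self]
    simpa using Complex.normSq_nonneg _
  add_left x y z := by simp [add_mul, Finset.sum_add_distrib]
  smul_left x y r := by simp [Finset.mul_sum, mul_assoc]
  definite x h := by
    simp only [← Complex.normSq_eq_conj_mul_self] at h
    rw [← Complex.ofReal_sum, Complex.ofReal_eq_zero, Finset.sum_eq_zero_iff_of_nonneg
      fun w _ => Complex.normSq_nonneg _] at h
    apply (coord b n).injective
    ext w
    simpa using h w (Finset.mem_univ w)

/-- The norm of `tensorCore`. -/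
@[reducible] def tensorNormed (n : ℕ) : NormedAddCommGroup (TPow V n) :=
  (tensorCore b n).toNormedAddCommGroup

/-- The inner product space of `tensorCore`. -/
@[reducible] def tensorInner (n : ℕ) :
    letI := tensorNormed b n
    InnerProductSpace ℂ (TPow V n) :=
  letI := tensorNormed b n
  InnerProductSpace.ofCore (tensorCore b n).toCore

theorem elemGl_mul (i j k l : Fin N) :
    elemGl b i j * elemGl b k l = if j = k then elemGl b i l else 0 := by
  apply b.ext
  intro m
  split_ifs with h
  · subst h
    rcases eq_or_ne m l with rfl | hm <;> simp [Module.End.mul_apply, elemGl_apply, *]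
  · rcases eq_or_ne m l with rfl | hm <;> simp [Module.End.mul_apply, elemGl_apply, *]

theorem tensorE_comm (i j k l : Fin N) (x : TPow V n) :
    tensorE b n i j (tensorE b n k l x) - tensorE b n k l (tensorE b n i j x) =
      (if j = k then tensorE b n i l x else 0) - (if l = i then tensorE b n k j x else 0) := by
  have h := LinearMap.congr_fun (glAction_lie n (elemGl b i j) (elemGl b k l)) x
  rw [Ring.lie_def, Ring.lie_def, elemGl_mul, elemGl_mul] at h
  rw [LinearMap.sub_apply, Module.End.mul_apply, Module.End.mul_apply] at h
  simp only [tensorE]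
  rw [← h, sub_eq_add_neg, glAction_add, ← neg_one_smul ℂ, glAction_smul]
  have h0 : glAction n (0 : Module.End ℂ V) = 0 := by
    simpa using glAction_smul n 0 (0 : Module.End ℂ V)
  split_ifs <;> simp [h0, sub_eq_add_neg]

theorem isUnitaryGl_tensorE (n : ℕ) :
    letI := tensorNormed b n
    letI := tensorInner b n
    IsUnitaryGl (tensorE b n) := by
  let _ := tensorNormed b n
  let _ := tensorInner b n
  refine ⟨fun i j k l x => tensorE_comm b i j k l x, fun p q x y => ?_⟩
  change ∑ w, (starRingEnd ℂ) (coord b n (tensorE b n p q x) w) * coord b n y w =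
    ∑ w, (starRingEnd ℂ) (coord b n x w) * coord b n (tensorE b n q p y) w
  simp only [coord_tensorE, map_sum, Finset.sum_mul, Finset.mul_sum]
  rw [Finset.sum_comm]
  conv_rhs => rw [Finset.sum_comm]
  refine Finset.sum_congr rfl fun i _ => ?_
  simp only [apply_ite (starRingEnd ℂ), map_zero, ite_mul, zero_mul, mul_ite, mul_zero]
  rw [← Finset.sum_filter, ← Finset.sum_filter]
  -- Replacing the `i`-th letter matches the words with `p` in that place to those with `q`.
  refine Finset.sum_nbij' (fun w => Function.update w i q) (fun w => Function.update w i p)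
    ?_ ?_ ?_ ?_ ?_
  · simp
  · simp
  · rintro w hw
    simp only [Finset.mem_filter] at hw
    simp [← hw.2]
  · rintro w hw
    simp only [Finset.mem_filter] at hw
    simp [← hw.2]
  · rintro w hw
    simp only [Finset.mem_filter] at hw
    simp [← hw.2]

/-- The coefficient of the `a`-th basis vector in the last copy of `V`. -/
def slice (n : ℕ) (a : Fin N) : TPow V (n + 1) →ₗ[ℂ] TPow V n :=
  (coord b n).symm.toLinearMap ∘ₗ (LinearMap.funLeft ℂ ℂ fun w => Fin.snoc w a) ∘ₗ
    (coord b (n + 1)).toLinearMap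

theorem coord_slice (a : Fin N) (x : TPow V (n + 1)) (w : Fin n → Fin N) :
    coord b n (slice b n a x) w = coord b (n + 1) x (Fin.snoc w a) := by
  simp [slice, LinearMap.funLeft_apply]

theorem coord_eq_slice (x : TPow V (n + 1)) (w : Fin (n + 1) → Fin N) :
    coord b (n + 1) x w = coord b n (slice b n (w (Fin.last n)) x) (Fin.init w) := by
  rw [coord_slice, Fin.snoc_init_self]

theorem slice_permOp (a : Fin N) (i j : Fin n) (x : TPow V (n + 1)) :
    slice b n a (permOp V i.castSucc j.castSucc x) = permOp V i j (slice b n a x) := by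
  apply (coord b n).injective
  ext w
  rw [coord_slice, coord_permOp, coord_permOp, coord_slice]
  refine congrArg (coord b (n + 1) x) (funext fun k => ?_)
  refine Fin.lastCases ?_ (fun k => ?_) k
  · rw [Function.comp_apply, Equiv.swap_apply_of_ne_of_ne (Fin.castSucc_lt_last _).ne'
      (Fin.castSucc_lt_last _).ne', Fin.snoc_last, Fin.snoc_last]
  · have : Equiv.swap i.castSucc j.castSucc k.castSucc = (Equiv.swap i j k).castSucc := by
      simp only [Equiv.swap_apply_def, Fin.castSucc_inj]
      split_ifs <;> rfl
    rw [Function.comp_apply, this, Fin.snoc_castSucc, Fin.snoc_castSucc, Function.comp_apply]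

theorem slice_jm (a : Fin N) (k : Fin n) (x : TPow V (n + 1)) :
    slice b n a (jm V id k.castSucc x) = jm V id k (slice b n a x) := by
  rw [jm_castSucc, jm, jm, LinearMap.sum_apply, map_sum, LinearMap.sum_apply]
  exact Finset.sum_congr rfl fun i _ => slice_permOp b a i k x

/-- Each transposition with the last copy is `∑ E_{ab} ⊗ E_{ba}`. Summed over the first `n` copies,
the first legs add up to the action of `gl(V)` on `V^{⊗n}`, so the last Jucys--Murphy element plays
the role of `J`. -/
theorem isVectorTensor_slice (n : ℕ) :
    letI := tensorNormed b n
    letI := tensorInner b n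
    letI := tensorNormed b (n + 1)
    letI := tensorInner b (n + 1)
    IsVectorTensor (tensorE b n) (tensorE b (n + 1)) (slice b n) (jm V id (Fin.last n)) := by
  let _ := tensorNormed b n
  let _ := tensorInner b n
  let _ := tensorNormed b (n + 1)
  let _ := tensorInner b (n + 1)
  constructor
  · intro f hf
    apply (coord b (n + 1)).injective
    ext w
    rw [coord_eq_slice, hf, map_zero, map_zero, Pi.zero_apply, Pi.zero_apply]
  · intro g
    refine ⟨(coord b (n + 1)).symm fun w => coord b n (g (w (Fin.last n))) (Fin.init w),
      fun a => ?_⟩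
    apply (coord b n).injective
    ext w
    rw [coord_slice, LinearEquiv.apply_symm_apply, Fin.snoc_last, Fin.init_snoc]
  · intro a i j f
    apply (coord b n).injective
    ext w
    rw [coord_slice, coord_tensorE, map_add, Pi.add_apply, coord_tensorE, Fin.sum_univ_castSucc]
    congr 1
    · refine Finset.sum_congr rfl fun k _ => ?_
      rw [Fin.snoc_castSucc, coord_slice, Fin.snoc_update]
    · rw [Fin.snoc_last]
      split_ifs
      · rw [coord_slice, Fin.update_snoc_last]
      · simp
  · intro a f
    apply (coord b n).injective
    ext w
    rw [coord_slice, jm_last, LinearMap.sum_apply, map_sum, Finset.sum_apply, map_sum,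
      Finset.sum_apply]
    simp only [coord_permOp, coord_tensorE, coord_slice, id]
    rw [Finset.sum_comm]
    refine Finset.sum_congr rfl fun k _ => ?_
    rw [Finset.sum_ite_eq Finset.univ (w k), if_pos (Finset.mem_univ _)]
    refine congrArg (coord b (n + 1) f) (funext fun l => ?_)
    refine Fin.lastCases ?_ (fun l => ?_) l
    · rw [Function.comp_apply, Equiv.swap_apply_right, Fin.snoc_castSucc, Fin.snoc_last]
    · rw [Function.comp_apply, Fin.snoc_castSucc]
      rcases eq_or_ne l k with rfl | hl
      · rw [Equiv.swap_apply_left, Fin.snoc_last, Function.update_self]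
      · rw [Equiv.swap_apply_of_ne_of_ne (by simpa using hl) (Fin.castSucc_lt_last _).ne,
          Fin.snoc_castSucc, Function.update_of_ne hl]
  · intro f g
    change ∑ w, (starRingEnd ℂ) (coord b _ _ w) * coord b _ g w =
      ∑ w, (starRingEnd ℂ) (coord b _ f w) * coord b _ _ w
    simp only [jm, LinearMap.sum_apply, map_sum, Finset.sum_apply, Finset.sum_mul, Finset.mul_sum,
      coord_permOp]
    rw [Finset.sum_comm]
    conv_rhs => rw [Finset.sum_comm]
    refine Finset.sum_congr rfl fun k _ => ?_
    rw [← Equiv.sum_comp (Equiv.arrowCongr (Equiv.swap (id k) (id (Fin.last n))) (Equiv.refl _))]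
    refine Finset.sum_congr rfl fun w _ => ?_
    have h1 : Equiv.arrowCongr (Equiv.swap (id k) (id (Fin.last n))) (Equiv.refl (Fin N)) w =
        w ∘ Equiv.swap (id k) (id (Fin.last n)) := by
      ext l; simp [Equiv.arrowCongr]
    rw [h1, Function.comp_assoc]
    simp [← Equiv.coe_trans, ← Equiv.Perm.mul_def]
  · intro i j f
    have : Commute (jm V id (Fin.last n)) (glAction (n + 1) (elemGl b i j)) :=
      Commute.sum_left _ _ _ fun k _ => glAction_commute_permOp _ _ _ _
    exact LinearMap.congr_fun this.eq f

/-! ### Joint eigenspaces attached to lattice words -/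

/-- The number of letters `i` among the first `k` letters of the word `r`. -/
def rowCount (r : ℕ → Fin N) (k : ℕ) (i : Fin N) : ℕ := ((Finset.range k).filter (r · = i)).card

/-- The content of the box that may be added at the end of the `i`-th row after `k` steps. -/
def shiftedCount (r : ℕ → Fin N) (k : ℕ) (i : Fin N) : ℂ := rowCount r k i - (i : ℂ)

/-- All prefixes of length at most `n` of the word `r` have partitions as row counts. -/
def IsLattice (r : ℕ → Fin N) (n : ℕ) : Prop :=
  ∀ k ≤ n, ∀ i j, i ≤ j → rowCount r k j ≤ rowCount r k i

theorem IsLattice.mono {r : ℕ → Fin N} {m n : ℕ} (h : IsLattice r n) (hmn : m ≤ n) :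
    IsLattice r m := fun k hk => h k (hk.trans hmn)

theorem rowCount_succ (r : ℕ → Fin N) (k : ℕ) (i : Fin N) :
    rowCount r (k + 1) i = rowCount r k i + if i = r k then 1 else 0 := by
  rw [rowCount, rowCount, Finset.range_add_one, Finset.filter_insert]
  by_cases h : i = r k
  · rw [if_pos h.symm, if_pos h, Finset.card_insert_of_notMem (by simp)]
  · rw [if_neg (Ne.symm h), if_neg h, add_zero]

/-- Row counts decrease weakly and row numbers increase strictly, so the shifted counts decrease
strictly. -/
theorem IsLattice.shiftedCount_injective {r : ℕ → Fin N} {n : ℕ} (h : IsLattice r n) :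
    Function.Injective (shiftedCount r n) := by
  have key : ∀ i j, i < j → shiftedCount r n i ≠ shiftedCount r n j := by
    intro i j hij heq
    have h1 := h n le_rfl i j hij.le
    have h2 : ((rowCount r n i : ℤ) : ℂ) - (i : ℕ) = (rowCount r n j : ℤ) - (j : ℕ) := by
      simpa [shiftedCount] using heq
    have h3 : (rowCount r n i : ℤ) - (i : ℕ) = (rowCount r n j : ℤ) - (j : ℕ) := by
      exact_mod_cast h2
    have := Fin.lt_def.1 hij
    omega
  intro i j hij
  rcases lt_trichotomy i j with h1 | h1 | h1
  · exact absurd hij (key i j h1)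
  · exact h1
  · exact absurd hij.symm (key j i h1)

/-- For `j ≠ r n` the two numbers compared are shifted counts of the prefix of length `n + 1`, which
are distinct. This is how the addability of the next box enters, both for the non-vanishing of the
eigenspace and for the denominators of `fusionCoeff`. -/
theorem IsLattice.shiftedCount_sub_add_one_ne_zero {r : ℕ → Fin N} {n : ℕ}
    (h : IsLattice r (n + 1)) (j : Fin N) :
    shiftedCount r n (r n) - shiftedCount r n j + 1 ≠ 0 := by
  intro heq
  have h2 : ((rowCount r n (r n) : ℤ) : ℂ) - (r n : ℕ) - ((rowCount r n j : ℤ) - (j : ℕ)) + 1 = 0 :=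
    by simpa [shiftedCount] using heq
  have h0 : (rowCount r n (r n) : ℤ) - (r n : ℕ) - ((rowCount r n j : ℤ) - (j : ℕ)) + 1 = 0 := by
    exact_mod_cast h2
  clear h2
  rcases lt_trichotomy j (r n) with h1 | h1 | h1
  · have h3 := h (n + 1) le_rfl j (r n) h1.le
    rw [rowCount_succ, rowCount_succ, if_pos rfl, if_neg h1.ne] at h3
    have := Fin.lt_def.1 h1
    omega
  · subst h1
    omega
  · have h3 := h n (Nat.le_succ n) _ _ h1.le
    have := Fin.lt_def.1 h1
    omega

theorem mem_jmSpace_succ (c : Fin (n + 1) → ℂ) (f : TPow V (n + 1)) :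
    f ∈ jmSpace V id c ↔ (∀ a, slice b n a f ∈ jmSpace V id fun k => c k.castSucc) ∧
      jm V id (Fin.last n) f = c (Fin.last n) • f := by
  let _ := tensorNormed b n
  let _ := tensorInner b n
  let _ := tensorNormed b (n + 1)
  let _ := tensorInner b (n + 1)
  simp only [mem_jmSpace]
  constructor
  · intro h
    exact ⟨fun a k => by rw [← slice_jm, h, map_smul], h _⟩
  · rintro ⟨h1, h2⟩ k
    refine Fin.lastCases h2 (fun k => ?_) k
    rw [← sub_eq_zero]
    refine (isVectorTensor_slice b n).inj _ fun a => ?_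
    rw [map_sub, slice_jm, map_smul, h1, sub_self]

theorem jmSpace_eq_vecEigen (c : Fin (n + 1) → ℂ) :
    letI := tensorNormed b n
    letI := tensorInner b n
    letI := tensorNormed b (n + 1)
    letI := tensorInner b (n + 1)
    jmSpace V id c = vecEigen (slice b n) (jm V id (Fin.last n))
      (jmSpace V id fun k => c k.castSucc) (c (Fin.last n)) := by
  let _ := tensorNormed b n
  let _ := tensorInner b n
  let _ := tensorNormed b (n + 1)
  let _ := tensorInner b (n + 1)
  ext f
  rw [mem_vecEigen, mem_jmSpace_succ b]

instance finiteDimensional_tPow [FiniteDimensional ℂ V] (n : ℕ) :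
    FiniteDimensional ℂ (TPow V n) :=
  (Basis.piTensorProduct fun _ : Fin n => Module.finBasis ℂ V).finiteDimensional_of_finite

/-- Each letter of the word passes from an eigenspace to one component of its tensor product with
`V`: non-zero because the box is addable, with a unique singular line because the possible
eigenvalues are distinct. -/
theorem exists_isHighestWeight_jmSpace {r : ℕ → Fin N} (hr : IsLattice r n) :
    letI := tensorNormed b n
    letI := tensorInner b n
    ∃ v, IsHighestWeight (tensorE b n)
      (jmSpace V id fun k : Fin n => shiftedCount r k (r k)) (fun i => rowCount r n i) v := by
  have : FiniteDimensional ℂ V := b.finiteDimensional_of_finite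
  induction n with
  | zero =>
    let _ := tensorNormed b 0
    let _ := tensorInner b 0
    have h0 : ∀ i j, tensorE b 0 i j = 0 := fun i j => by simp [tensorE, glAction]
    refine ⟨(PiTensorProduct.isEmptyEquiv (R := ℂ) (s := fun _ : Fin 0 => V) (Fin 0)).symm 1,
      fun i j f _ => by simp [h0], by simp [mem_jmSpace],
      (LinearEquiv.map_ne_zero_iff _).2 one_ne_zero, fun i j _ => by simp [h0],
      fun i => by simp [h0, rowCount], fun f _ _ => ⟨PiTensorProduct.isEmptyEquiv (Fin 0) f, ?_⟩⟩
    rw [← map_smul, LinearEquiv.eq_symm_apply, smul_eq_mul, mul_one]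
  | succ n ih =>
    let _ := tensorNormed b n
    let _ := tensorInner b n
    let _ := tensorNormed b (n + 1)
    let _ := tensorInner b (n + 1)
    obtain ⟨v, hv⟩ := ih (hr.mono (Nat.le_succ n))
    have hT := isVectorTensor_slice b n
    have hne := hT.vecEigen_ne_bot hv (isUnitaryGl_tensorE b n) (i := r n)
      fun j _ => hr.shiftedCount_sub_add_one_ne_zero j
    obtain ⟨v', hv'⟩ := hT.isHighestWeight hv (isUnitaryGl_tensorE b (n + 1))
      (hr.mono (Nat.le_succ n)).shiftedCount_injective hne
    refine ⟨v', ?_⟩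
    rw [jmSpace_eq_vecEigen b]
    have hwt : (fun i => (rowCount r (n + 1) i : ℂ)) =
        fun i => (rowCount r n i : ℂ) + if i = r n then 1 else 0 := by
      ext i
      rw [rowCount_succ]
      push_cast
      rfl
    rw [hwt]
    exact hv'

theorem slice_aeval (a : Fin N) (k : Fin n) (p : Polynomial ℂ) (x : TPow V (n + 1)) :
    slice b n a (Polynomial.aeval (jm V id k.castSucc) p x) =
      Polynomial.aeval (jm V id k) p (slice b n a x) := by
  induction p using Polynomial.induction_on' generalizing x with
  | add p q hp hq => simp only [map_add, LinearMap.add_apply, hp, hq]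
  | monomial m c =>
    simp only [Polynomial.aeval_monomial, Module.End.mul_apply, Module.algebraMap_end_apply,
      map_smul]
    congr 1
    induction m generalizing x with
    | zero => simp
    | succ m ih => rw [pow_succ, pow_succ, Module.End.mul_apply, Module.End.mul_apply, ih, slice_jm]

/-- The characteristic identity of a Jucys--Murphy element on a joint eigenspace of the previous
ones. -/
theorem aeval_jm_eq_zero (b : Module.Basis (Fin N) ℂ V) {r : ℕ → Fin N} (m : Fin n)
    (hr : IsLattice r m) (f : TPow V n)
    (hf : ∀ k < m, jm V id k f = shiftedCount r k (r k) • f) :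
    Polynomial.aeval (jm V id m)
      (∏ i : Fin N, (Polynomial.X - Polynomial.C (shiftedCount r m i))) f = 0 := by
  have : FiniteDimensional ℂ V := b.finiteDimensional_of_finite
  induction n with
  | zero => exact m.elim0
  | succ n ih =>
    let _ := tensorNormed b n
    let _ := tensorInner b n
    let _ := tensorNormed b (n + 1)
    let _ := tensorInner b (n + 1)
    have hT := isVectorTensor_slice b n
    induction m using Fin.lastCases with
    | last =>
      obtain ⟨v, hv⟩ := exists_isHighestWeight_jmSpace b (n := n) hr
      refine hT.aeval_eq_zero hv (isUnitaryGl_tensorE b (n + 1)) (mem_vecTensor.2 fun a => ?_)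
      rw [mem_jmSpace]
      intro k
      rw [← slice_jm, hf _ (Fin.castSucc_lt_last k), map_smul]
      rfl
    -- Copies after the `m`-th play no part: slicing off the last one commutes with the earlier
    -- Jucys--Murphy elements.
    | cast m =>
      refine hT.inj _ fun a => ?_
      rw [slice_aeval]
      refine ih m hr _ fun k hk => ?_
      rw [← slice_jm, hf _ (by simpa using hk), map_smul]
      rfl

end Coordinates

/-! ### Weak continuity of products of Yang operators -/

section WeakContinuity

variable {A : Type*} [Ring A] [Algebra ℂ A]

/-- Continuity of an algebra-valued function tested on linear functionals. -/
def WeakContinuousAt (f : ℂ → A) (z₀ : ℂ) : Prop :=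
  ∀ l : Module.Dual ℂ A, ContinuousAt (fun z => l (f z)) z₀

/-- Left multiplication by `f` preserves weak continuity. -/
def WeakMultiplierAt (f : ℂ → A) (z₀ : ℂ) : Prop :=
  ∀ g, WeakContinuousAt g z₀ → WeakContinuousAt (fun z => f z * g z) z₀

theorem weakContinuousAt_const (x : A) (z₀ : ℂ) : WeakContinuousAt (fun _ => x) z₀ :=
  fun _ => continuousAt_const

theorem WeakMultiplierAt.weakContinuousAt {f : ℂ → A} {z₀ : ℂ} (h : WeakMultiplierAt f z₀) :
    WeakContinuousAt f z₀ := by simpa using h _ (weakContinuousAt_const 1 z₀)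

theorem WeakContinuousAt.const_mul {f : ℂ → A} {z₀ : ℂ} (h : WeakContinuousAt f z₀) (x : A) :
    WeakContinuousAt (fun z => x * f z) z₀ := fun l => h (l ∘ₗ LinearMap.mulLeft ℂ x)

/-- The factor is a fixed operator with a scalar coefficient, so the functional can absorb `P`, and
no continuity of multiplication in `A` is involved. -/
theorem weakMultiplierAt_one_sub_smul {φ : ℂ → ℂ} {z₀ : ℂ} (hφ : ContinuousAt φ z₀) (P : A) :
    WeakMultiplierAt (fun z => 1 - φ z • P) z₀ := by
  intro g hg l
  have := (hg l).sub (hφ.mul (hg.const_mul P l))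
  have e : ∀ z, l ((1 - φ z • P) * g z) = l (g z) - φ z * l (P * g z) := fun z => by
    simp [sub_mul]
  simp only [e]
  exact this

theorem weakMultiplierAt_list_prod {K : Type*} {L : List K} {f : K → ℂ → A} {z₀ : ℂ}
    (h : ∀ a ∈ L, WeakMultiplierAt (f a) z₀) :
    WeakMultiplierAt (fun z => (L.map fun a => f a z).prod) z₀ := by
  induction L with
  | nil => intro g hg; simpa using hg
  | cons a l ih =>
    intro g hg
    simp only [List.map_cons, List.prod_cons, mul_assoc]
    exact h a (by simp) _ (ih (fun a ha => h a (by simp [ha])) g hg)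

end WeakContinuity

/-! ### The consecutive evaluations of the fusion function -/

section Fusion

variable {V : Type*} [AddCommGroup V] [Module ℂ V] {n : ℕ}

/-- Conjugation by a transposition of two earlier copies permutes the summands of `J_k`. As `J_j`
with `j < k` is a sum of such transpositions, the Jucys--Murphy elements commute. -/
theorem commute_permOp_jm {a b k : Fin n} (ha : a < k) (hb : b < k) :
    Commute (permOp V a b) (jm V id k) := by
  rw [Commute, SemiconjBy, jm, Finset.mul_sum, Finset.sum_mul]
  simp only [id, permOp_eq V a b, permMap_mul_permOp,
    Equiv.swap_apply_of_ne_of_ne ha.ne' hb.ne']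
  refine Finset.sum_equiv (Equiv.swap a b) (fun i => ?_) fun i _ => rfl
  simp only [Finset.mem_Iio, Equiv.swap_apply_def]
  split_ifs with h1 h2
  · simp [h1, ha, hb]
  · simp [h2, ha, hb]
  · rfl

theorem jm_commute (j k : Fin n) : Commute (jm V id j) (jm V id k) := by
  have key : ∀ j k : Fin n, j < k → Commute (jm V id j) (jm V id k) := fun j k h =>
    Commute.sum_left _ _ _ fun i hi =>
      commute_permOp_jm ((Finset.mem_Iio.1 hi).trans h) h
  rcases lt_trichotomy j k with h | rfl | h
  · exact key j k h
  · exact Commute.refl _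
  · exact (key k j h).symm

theorem sum_Iio_eq {E : Type*} [AddCommMonoid E] (m : Fin n) (g : Fin n → E) :
    ∑ i ∈ Finset.Iio m, g i = ∑ i : Fin m, g (Fin.castLE m.2.le i) := by
  have : Finset.Iio m = Finset.univ.map (Fin.castLEEmb m.2.le) := by
    ext i
    simp only [Finset.mem_Iio, Finset.mem_map, Fin.castLEEmb_apply, Finset.mem_univ, true_and]
    constructor
    · intro h
      exact ⟨⟨i, h⟩, rfl⟩
    · rintro ⟨a, rfl⟩
      exact a.2
  rw [this, Finset.sum_map]
  rfl

theorem jm_castLE (m : Fin n) (k : Fin m) :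
    jm V (Fin.castLE m.2.le) k = jm V id (Fin.castLE m.2.le k) := by
  rw [jm, jm, sum_Iio_eq, sum_Iio_eq]
  rfl

theorem filter_lt_finRange (m : Fin n) :
    (List.finRange n).filter (fun i => i < m) = (List.finRange m).map (Fin.castLE m.2.le) := by
  have hs : ∀ k, (List.finRange k).Pairwise (· < ·) := fun k => List.pairwise_lt_finRange k
  refine List.Perm.eq_of_pairwise (le := (· < ·)) (fun a b _ _ h1 h2 => absurd h1 h2.not_gt)
    ((hs n).filter _) ((hs m).map _ fun a b h => h) ?_
  rw [List.perm_ext_iff_of_nodup ((List.nodup_finRange n).filter _)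
    ((List.nodup_finRange _).map (Fin.castLE_injective _))]
  intro i
  simp only [List.mem_filter, List.mem_finRange, true_and, decide_eq_true_eq, List.mem_map]
  constructor
  · intro h
    exact ⟨⟨i, h⟩, rfl⟩
  · rintro ⟨a, rfl⟩
    exact a.2

variable (V) in
/-- The factor of the fusion function formed by the pairs with a given larger index. -/
def fusionFactor (c : Fin n → ℂ) (m : Fin n) : Module.End ℂ (TPow V n) :=
  (((List.finRange n).filter fun i => i < m).map fun i => yang V i m (c i - c m)).prod

variable (V) in
/-- The product of the `fusionFactor V c k` over `k ≥ m`. -/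
def fusionTail (m : ℕ) (c : Fin n → ℂ) : Module.End ℂ (TPow V n) :=
  (((List.finRange n).drop m).map (fusionFactor V c)).prod

theorem fusionFun_eq (c : Fin n → ℂ) : fusionFun V c = fusionTail V 0 c := by
  have h := List.pairwise_lt_finRange n
  have h1 := prod_filter_lt_eq_lexProd (R := fun i j => yang V i j (c i - c j)) h
  have h2 := prod_filter_gt_eq_lexProd (local_yang V fun i j : Fin n => c i - c j) h
  rw [fusionFun, fusionTail, List.drop_zero]
  exact h1.trans h2.symm

theorem fusionTail_succ (m : Fin n) (c : Fin n → ℂ) :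
    fusionTail V m c = fusionFactor V c m * fusionTail V (m + 1) c := by
  rw [fusionTail, List.drop_eq_getElem_cons (by simp), List.map_cons, List.prod_cons, fusionTail]
  simp

theorem list_prod_reverse_mul {A K : Type*} [Ring A] [Algebra ℂ A] (L : List K) (f g : K → A)
    (κ : K → ℂ) (h : ∀ a ∈ L, f a * g a = κ a • 1) :
    (L.reverse.map f).prod * (L.map g).prod = (L.map κ).prod • 1 := by
  induction L with
  | nil => simp
  | cons a l ih =>
    simp only [List.reverse_cons, List.map_append, List.prod_append, List.map_cons, List.map_nil,
      List.prod_cons, List.prod_nil, mul_one]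
    calc _ = (l.reverse.map f).prod * (f a * g a) * (l.map g).prod := by simp only [mul_assoc]
      _ = κ a • ((l.reverse.map f).prod * (l.map g).prod) := by
          rw [h a (by simp), mul_smul_comm, mul_one, smul_mul_assoc]
      _ = _ := by rw [ih fun a ha => h a (by simp [ha]), smul_smul]

variable {N : ℕ} (r : ℕ → Fin N)

/-- The content of the `k`-th box of the tableau described by the word `r`. -/
def wordContent (k : ℕ) : ℂ := shiftedCount r k (r k)

/-- The scalar by which the inverse of a product of Yang operators differs from the reversed
product. -/
def unitarityFactor (m : ℕ) (z : ℂ) : ℂ :=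
  ∏ k ∈ Finset.range m, (1 - ((z - wordContent r k) ^ 2)⁻¹)

/-- For the empty word the product of `(z + i + 1) / (z + i)` telescopes to `(z + N) / z`. A new box
of content `a` replaces the root `a` of `∏ (z - a_i)` by `a + 1`, and both sides get multiplied by
`(z - a - 1) / (z - a)`. The formula shows that the apparent double poles at earlier contents mostly
cancel. -/
theorem mul_unitarityFactor {m : ℕ} {z : ℂ} (hz : ∀ k < m, z - wordContent r k ≠ 0) :
    z * unitarityFactor r m z * ∏ i, (z - shiftedCount r m i + 1) =
      (z + N) * ∏ i, (z - shiftedCount r m i) := by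
  induction m with
  | zero =>
    have h1 : ∀ i : Fin N, z - shiftedCount r 0 i = z + (i : ℕ) := by
      simp [shiftedCount, rowCount]
    simp only [h1, unitarityFactor, Finset.range_zero, Finset.prod_empty, mul_one]
    rw [Fin.prod_univ_eq_prod_range (fun i => z + (i : ℂ)),
      Fin.prod_univ_eq_prod_range (fun i => z + (i : ℂ) + 1)]
    have := (Finset.prod_range_succ (fun i : ℕ => z + (i : ℂ)) N).symm.trans
      (Finset.prod_range_succ' (fun i : ℕ => z + (i : ℂ)) N)
    rw [mul_comm (z + N), this, Nat.cast_zero, add_zero, mul_comm z]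
    congr 1
    refine Finset.prod_congr rfl fun i _ => ?_
    push_cast
    ring
  | succ m ih =>
    have ih := ih fun k hk => hz k (by omega)
    have ha := hz m (by omega)
    have h1 : shiftedCount r (m + 1) (r m) = wordContent r m + 1 := by
      rw [shiftedCount, rowCount_succ, if_pos rfl, wordContent, shiftedCount]
      push_cast
      ring
    have h2 : ∀ i ∈ Finset.univ.erase (r m), shiftedCount r (m + 1) i = shiftedCount r m i := by
      intro i hi
      rw [shiftedCount, rowCount_succ, if_neg (Finset.ne_of_mem_erase hi), shiftedCount, add_zero]
    have hP : ∏ i, (z - shiftedCount r (m + 1) i + 1) = (z - wordContent r m) *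
        ∏ i ∈ Finset.univ.erase (r m), (z - shiftedCount r m i + 1) := by
      rw [← Finset.mul_prod_erase _ _ (Finset.mem_univ (r m)), h1]
      congr 1
      · ring
      · exact Finset.prod_congr rfl fun i hi => by rw [h2 i hi]
    have hQ : ∏ i, (z - shiftedCount r (m + 1) i) = (z - wordContent r m - 1) *
        ∏ i ∈ Finset.univ.erase (r m), (z - shiftedCount r m i) := by
      rw [← Finset.mul_prod_erase _ _ (Finset.mem_univ (r m)), h1]
      congr 1
      · ring
      · exact Finset.prod_congr rfl fun i hi => by rw [h2 i hi]
    rw [hP, hQ, unitarityFactor, Finset.prod_range_succ, ← unitarityFactor]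
    rw [← Finset.mul_prod_erase _ _ (Finset.mem_univ (r m)),
      ← Finset.mul_prod_erase _ _ (Finset.mem_univ (r m))] at ih
    rw [show shiftedCount r m (r m) = wordContent r m from rfl] at ih
    set a := wordContent r m
    set R := ∏ i ∈ Finset.univ.erase (r m), (z - shiftedCount r m i + 1)
    set S := ∏ i ∈ Finset.univ.erase (r m), (z - shiftedCount r m i)
    set κ := unitarityFactor r m z
    have e : (1 - ((z - a) ^ 2)⁻¹) * (z - a) = (z - a - 1) * (z - a + 1) * (z - a)⁻¹ := by
      field_simp
      ring
    calc _ = z * κ * ((1 - ((z - a) ^ 2)⁻¹) * (z - a)) * R := by ring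
      _ = (z - a - 1) * (z - a)⁻¹ * (z * κ * ((z - a + 1) * R)) := by rw [e]; ring
      _ = (z - a - 1) * ((z - a)⁻¹ * (z - a)) * ((z + N) * S) := by rw [ih]; ring
      _ = _ := by rw [inv_mul_cancel₀ ha]; ring

/-- The coefficient of the `i`-th spectral projection in a fused product of Yang operators. -/
def fusionCoeff (m : ℕ) (i : Fin N) (z : ℂ) : ℂ :=
  (z + N) * (∏ j ∈ Finset.univ.erase i, (z - shiftedCount r m j)) /
    ∏ j, (z - shiftedCount r m j + 1)

variable (V) in
/-- The spectral projection of the `m`-th Jucys--Murphy element for the eigenvalue attached to the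
`i`-th row. -/
def rowProj (m : Fin n) (i : Fin N) : Module.End ℂ (TPow V n) :=
  Polynomial.aeval (jm V id m) (Lagrange.basis Finset.univ (shiftedCount r m) i)

variable (V n) in
/-- The value of the fusion function after `m` consecutive evaluations, without the factors of
larger index. -/
def fusionStage : ℕ → Module.End ℂ (TPow V n)
  | 0 => 1
  | m + 1 => fusionStage m * if h : m < n then
      fusionCoeff r m (r m) (wordContent r m) • rowProj V r ⟨m, h⟩ (r m) else 1

theorem fusionStage_succ (m : Fin n) : fusionStage V n r (m + 1) = fusionStage V n r m *
    (fusionCoeff r m (r m) (wordContent r m) • rowProj V r m (r m)) := by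
  rw [fusionStage, dif_pos m.2]

theorem commute_aeval {A : Type*} [Ring A] [Algebra ℂ A] {x y : A} (h : Commute x y)
    (p : Polynomial ℂ) : Commute (Polynomial.aeval x p) y := by
  induction p using Polynomial.induction_on' with
  | add p q hp hq => rw [map_add]; exact hp.add_left hq
  | monomial m c =>
    rw [Polynomial.aeval_monomial]
    exact (Algebra.commute_algebraMap_left c y).mul_left (h.pow_left m)

theorem rowProj_commute_jm (m : Fin n) (i : Fin N) (k : Fin n) :
    Commute (rowProj V r m i) (jm V id k) := commute_aeval (jm_commute m k) _

theorem fusionStage_commute_jm (m : ℕ) (k : Fin n) :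
    Commute (fusionStage V n r m) (jm V id k) := by
  induction m with
  | zero => exact Commute.one_left _
  | succ m ih =>
    rw [fusionStage]
    split_ifs with h
    · exact ih.mul_left ((rowProj_commute_jm r _ _ k).smul_left _)
    · rwa [mul_one]

variable {r}

/-- Multiplied by `X - a_i`, the `i`-th Lagrange polynomial becomes a multiple of the full product,
which annihilates `f`. -/
theorem jm_mul_rowProj {m : Fin n} {f : Module.End ℂ (TPow V n)}
    (hf : Polynomial.aeval (jm V id m)
      (∏ i : Fin N, (Polynomial.X - Polynomial.C (shiftedCount r m i))) * f = 0) (i : Fin N) :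
    jm V id m * (rowProj V r m i * f) = shiftedCount r m i • (rowProj V r m i * f) := by
  have h1 : (Polynomial.X - Polynomial.C (shiftedCount r m i)) *
      Lagrange.basis Finset.univ (shiftedCount r m) i =
      Polynomial.C (∏ j ∈ Finset.univ.erase i, (shiftedCount r m i - shiftedCount r m j)⁻¹) *
        ∏ i : Fin N, (Polynomial.X - Polynomial.C (shiftedCount r m i)) := by
    rw [Lagrange.basis, ← Finset.mul_prod_erase _ (fun i => Polynomial.X - _) (Finset.mem_univ i),
      map_prod, mul_left_comm, ← Finset.prod_mul_distrib]
    rfl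
  have h2 := congrArg (fun p => Polynomial.aeval (jm V id m) p * f) h1
  simp only [map_mul, mul_assoc, hf, mul_zero, map_sub, Polynomial.aeval_X, Polynomial.aeval_C,
    sub_mul] at h2
  rw [sub_eq_zero] at h2
  rw [rowProj, h2, Algebra.algebraMap_eq_smul_one, smul_mul_assoc, one_mul]

theorem aeval_mul_eq_zero (b : Module.Basis (Fin N) ℂ V) {m : Fin n} (hr : IsLattice r m)
    {f : Module.End ℂ (TPow V n)} (hf : ∀ k < m, jm V id k * f = wordContent r k • f) :
    Polynomial.aeval (jm V id m)
      (∏ i : Fin N, (Polynomial.X - Polynomial.C (shiftedCount r m i))) * f = 0 := by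
  refine LinearMap.ext fun x => ?_
  exact aeval_jm_eq_zero b m hr (f x) fun k hk => LinearMap.congr_fun (hf k hk) x

theorem jm_mul_fusionStage (b : Module.Basis (Fin N) ℂ V) {m : ℕ} (hm : m ≤ n)
    (hr : IsLattice r m) (k : Fin n) (hk : (k : ℕ) < m) :
    jm V id k * fusionStage V n r m = wordContent r k • fusionStage V n r m := by
  induction m generalizing k with
  | zero => omega
  | succ m ih =>
    have ih := ih (by omega) (hr.mono (Nat.le_succ m))
    have hsucc := fusionStage_succ (V := V) r ⟨m, hm⟩
    simp only at hsucc
    rw [hsucc]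
    rcases Nat.lt_succ_iff_lt_or_eq.1 hk with hk | hk
    · rw [← mul_assoc, ih k hk, smul_mul_assoc]
    · obtain rfl : k = ⟨m, hm⟩ := Fin.ext hk
      have h1 := jm_mul_rowProj (aeval_mul_eq_zero b (m := ⟨m, hm⟩) (hr.mono (Nat.le_succ m))
        fun k hk => ih k hk) (r m)
      have h2 : Commute (fusionStage V n r m) (rowProj V r ⟨m, hm⟩ (r m)) :=
        (commute_aeval (fusionStage_commute_jm r m ⟨m, hm⟩).symm _).symm
      rw [mul_smul_comm, h2.eq, mul_smul_comm, h1, smul_comm]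
      rfl

/-- Write `F` for the stage and `J` for `J_m`. By `mul_prod_yang` the reversed product `desc`
satisfies `F * desc = F - z⁻¹ F J`, and by unitarity `desc * asc` is the scalar `κ(z)`. Hence `(z -
J) F asc = z κ(z) F`, so that `F asc` is `z κ(z)` times the resolvent of `J` applied to `F`. Its
component for the eigenvalue `a_i` has coefficient `z κ(z) / (z - a_i)`, which `mul_unitarityFactor`
rewrites as `fusionCoeff`. -/
theorem fusionStage_mul_fusionFactor (b : Module.Basis (Fin N) ℂ V) {m : Fin n}
    (hr : IsLattice r m) {c : Fin n → ℂ} (hc : ∀ k < m, c k = wordContent r k)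
    (hz : c m ≠ 0) (hzk : ∀ k < (m : ℕ), c m - wordContent r k ≠ 0)
    (hzi : ∀ i, c m - shiftedCount r m i ≠ 0)
    (hzi' : ∏ i, (c m - shiftedCount r m i + 1) ≠ 0) :
    fusionStage V n r m * fusionFactor V c m =
      ∑ i, fusionCoeff r m i (c m) • (fusionStage V n r m * rowProj V r m i) := by
  set z := c m with hz_def
  set F := fusionStage V n r m with hF
  set J := jm V id m with hJ
  set e : Fin m → Fin n := Fin.castLE m.2.le with he
  have hFk : ∀ k < m, jm V id k * F = wordContent r k • F := fun k hk =>
    jm_mul_fusionStage b m.2.le hr k hk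
  set asc := ((List.finRange m).map fun i => yang V (e i) m (wordContent r i - z)).prod with hasc
  have hfac : fusionFactor V c m = asc := by
    rw [fusionFactor, filter_lt_finRange, List.map_map]
    congr 1
    refine List.map_congr_left fun i _ => ?_
    rw [Function.comp_apply, hc _ (show Fin.castLE m.2.le i < m from i.2)]
    rfl
  set desc := ((List.finRange m).reverse.map fun i => yang V (e i) m (z - wordContent r i)).prod
    with hdesc
  have h1 : desc * asc = unitarityFactor r m z • 1 := by
    rw [hdesc, hasc, list_prod_reverse_mul (List.finRange m) _ _
      (fun i => 1 - ((z - wordContent r i) ^ 2)⁻¹)]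
    · rw [unitarityFactor, Finset.prod_range, ← List.prod_ofFn, List.ofFn_eq_map]
    · intro i _
      rw [← yang_mul_yang_neg, neg_sub]
  have h2 : F * desc = F - z⁻¹ • (F * J) := by
    have := mul_prod_yang (V := V) (e := e) (Fin.castLE_injective _) (x := m)
      (fun i h => i.2.ne (congrArg Fin.val h))
      (c := fun i => wordContent r i) (f := F) ?_ (v := z) hz fun i => hzk i i.2
    · rw [hdesc, this, hJ, jm, sum_Iio_eq]
      rfl
    · intro k
      rw [he, jm_castLE, (fusionStage_commute_jm r m _).eq, hFk _ k.2]
      rfl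
  have hFJ : F * J = J * F := (fusionStage_commute_jm r m m).eq
  set X := F * asc with hX
  have h3 : z • X - J * X = (z * unitarityFactor r m z) • F := by
    have h4 : F * desc * asc = unitarityFactor r m z • F := by
      rw [mul_assoc, h1, mul_smul_comm, mul_one]
    rw [h2, sub_mul, smul_mul_assoc, hFJ, mul_assoc] at h4
    rw [mul_smul, ← h4, smul_sub, smul_smul, mul_inv_cancel₀ hz, one_smul]
  have hχ := aeval_mul_eq_zero b hr hFk
  have h5 : ∀ i, rowProj V r m i * X = fusionCoeff r m i z • (F * rowProj V r m i) := by
    intro i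
    have hcomm : rowProj V r m i * F = F * rowProj V r m i :=
      (commute_aeval (fusionStage_commute_jm r m m).symm _).eq
    have hcJ : rowProj V r m i * J = J * rowProj V r m i := (rowProj_commute_jm r m i m).eq
    have h6 := congrArg (rowProj V r m i * ·) h3
    have h7 := congrArg (· * asc) (jm_mul_rowProj hχ i)
    simp only [mul_assoc, smul_mul_assoc] at h7
    simp only [mul_sub, mul_smul_comm] at h6
    rw [← mul_assoc _ J X, hcJ, mul_assoc J, hX, h7, ← hX, hcomm] at h6
    replace h6 : (z - shiftedCount r m i) • (rowProj V r m i * X) =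
        (z * unitarityFactor r m z) • (F * rowProj V r m i) := (sub_smul _ _ _).trans h6
    have h8 : fusionCoeff r m i z = (z - shiftedCount r m i)⁻¹ * (z * unitarityFactor r m z) := by
      rw [fusionCoeff, div_eq_iff hzi', mul_assoc, mul_unitarityFactor r hzk,
        ← Finset.mul_prod_erase _ _ (Finset.mem_univ i), mul_left_comm (z + N),
        inv_mul_cancel_left₀ (hzi i)]
    rw [h8, mul_smul, ← h6, smul_smul, inv_mul_cancel₀ (hzi i), one_smul]
  have h9 : ∑ i, rowProj V r m i = 1 := by
    simp only [rowProj]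
    rw [← map_sum, Lagrange.sum_basis, map_one]
    · exact hr.shiftedCount_injective.injOn
    · exact ⟨r m, Finset.mem_univ _⟩
  rw [hfac, ← hX, ← one_mul X, ← h9, Finset.sum_mul]
  exact Finset.sum_congr rfl fun i _ => h5 i

end Fusion

/-! ### Limits of the partial evaluations and the image of the result. -/

section Fusion

variable {V : Type*} [AddCommGroup V] [Module ℂ V] {n N : ℕ} {r : ℕ → Fin N}

theorem eventually_ne_punctured (z₀ a : ℂ) : ∀ᶠ z in 𝓝[≠] z₀, z ≠ a := by
  rcases eq_or_ne z₀ a with rfl | h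
  · exact self_mem_nhdsWithin
  · exact nhdsWithin_le_nhds (isOpen_ne.mem_nhds h)

/-- The `m`-th variable enters the tail only through its differences with later variables, and these
are non-zero at `a`. -/
theorem weakContinuousAt_fusionTail {m : Fin n} {c : Fin n → ℂ} {a : ℂ}
    (h : ∀ k > m, c k ≠ a) :
    WeakContinuousAt (fun z => fusionTail V (m + 1) (Function.update c m z)) a := by
  refine (weakMultiplierAt_list_prod fun k hk => ?_).weakContinuousAt
  have hk : m < k := by
    obtain ⟨i, hi, rfl⟩ := List.mem_iff_getElem.1 hk
    rw [List.getElem_drop, List.getElem_finRange, Fin.lt_def]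
    simp only [Fin.val_cast]
    omega
  refine weakMultiplierAt_list_prod fun i hi => weakMultiplierAt_one_sub_smul ?_ _
  simp only [Function.update_of_ne hk.ne']
  rcases eq_or_ne i m with rfl | him
  · simp only [Function.update_self]
    exact (continuousAt_id.sub continuousAt_const).inv₀ (sub_ne_zero.2 (h k hk).symm)
  · simp only [Function.update_of_ne him]
    exact continuousAt_const

theorem continuousAt_fusionCoeff {m : ℕ} (hr : IsLattice r (m + 1)) (i : Fin N) :
    ContinuousAt (fusionCoeff r m i) (wordContent r m) := by
  unfold fusionCoeff
  refine ContinuousAt.div (by fun_prop) (by fun_prop) ?_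
  exact Finset.prod_ne_zero_iff.2 fun j _ => hr.shiftedCount_sub_add_one_ne_zero j

theorem fusionCoeff_eq_zero {m : ℕ} {i : Fin N} (hi : i ≠ r m) :
    fusionCoeff r m i (wordContent r m) = 0 := by
  rw [fusionCoeff, Finset.prod_eq_zero (Finset.mem_erase.2 ⟨hi.symm, Finset.mem_univ _⟩)
    (sub_self (shiftedCount r m (r m))), mul_zero, zero_div]

theorem fusionCoeff_ne_zero {m : ℕ} (hr : IsLattice r (m + 1)) :
    fusionCoeff r m (r m) (wordContent r m) ≠ 0 := by
  refine div_ne_zero (mul_ne_zero ?_ ?_) ?_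
  · have h : wordContent r m + N = ((rowCount r m (r m) + (N - (r m : ℕ)) : ℕ) : ℂ) := by
      rw [wordContent, shiftedCount]
      push_cast [(r m).2.le]
      ring
    rw [h]
    have := (r m).2
    exact Nat.cast_ne_zero.2 (by omega)
  · refine Finset.prod_ne_zero_iff.2 fun j hj => sub_ne_zero.2 fun h => ?_
    exact Finset.ne_of_mem_erase hj
      ((hr.mono (Nat.le_succ m)).shiftedCount_injective h).symm
  · exact Finset.prod_ne_zero_iff.2 fun j _ => hr.shiftedCount_sub_add_one_ne_zero j

/-- At the content of the new box the coefficients of all other rows vanish and that of `r m` is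
finite. The spectral sum thus tends to the single term that defines the next stage. -/
theorem tendsto_fusionStage (b : Module.Basis (Fin N) ℂ V) {m : Fin n}
    (hr : IsLattice r (m + 1)) {c : Fin n → ℂ} (hc : ∀ k ≤ m, c k = wordContent r k)
    (hc' : ∀ k > m, c k ≠ wordContent r m) (l : Module.Dual ℂ (Module.End ℂ (TPow V n))) :
    Filter.Tendsto
      (fun z => l (fusionStage V n r m * fusionTail V m (Function.update c m z)))
      (𝓝[≠] wordContent r m)
      (𝓝 (l (fusionStage V n r (m + 1) * fusionTail V (m + 1) c))) := by
  -- The spectral formula needs `z` to avoid a finite set, which may contain the limit point itself;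
  -- hence the punctured neighbourhood.
  have hev : ∀ᶠ z in 𝓝[≠] wordContent r m,
      ∑ i, fusionCoeff r m i z * l (fusionStage V n r m * rowProj V r m i *
        fusionTail V (m + 1) (Function.update c m z)) =
      l (fusionStage V n r m * fusionTail V m (Function.update c m z)) := by
    filter_upwards [eventually_ne_punctured _ 0,
      Filter.eventually_all.2 fun k : Fin m => eventually_ne_punctured _ (wordContent r k),
      Filter.eventually_all.2 fun i => eventually_ne_punctured _ (shiftedCount r m i),
      Filter.eventually_all.2 fun i => eventually_ne_punctured _ (shiftedCount r m i - 1)]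
      with z h0 h1 h2 h3
    have := fusionStage_mul_fusionFactor (V := V) b (hr.mono (Nat.le_succ m))
      (c := Function.update c m z)
      (fun k hk => by rw [Function.update_of_ne hk.ne, hc k hk.le])
      (by rwa [Function.update_self])
      (fun k hk => by rw [Function.update_self]; exact sub_ne_zero.2 (h1 ⟨k, hk⟩))
      (fun i => by rw [Function.update_self]; exact sub_ne_zero.2 (h2 i))
      (by
        rw [Function.update_self]
        exact Finset.prod_ne_zero_iff.2 fun i _ h => h3 i (by linear_combination h))
    rw [fusionTail_succ, ← mul_assoc, this, Finset.sum_mul, map_sum]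
    simp only [Function.update_self, smul_mul_assoc, map_smul, smul_eq_mul]
  refine Filter.Tendsto.congr' hev ?_
  have hlim : l (fusionStage V n r (m + 1) * fusionTail V (m + 1) c) =
      ∑ i, fusionCoeff r m i (wordContent r m) * l (fusionStage V n r m * rowProj V r m i *
        fusionTail V (m + 1) (Function.update c m (wordContent r m))) := by
    rw [Finset.sum_eq_single (r m) (fun i _ hi => by rw [fusionCoeff_eq_zero hi, zero_mul])
      (by simp), fusionStage_succ, ← hc m le_rfl, Function.update_eq_self, hc m le_rfl,
      mul_smul_comm, smul_mul_assoc, map_smul, smul_eq_mul]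
  rw [hlim]
  refine tendsto_finsetSum _ fun i _ => ?_
  exact ((continuousAt_fusionCoeff hr i).mul
    ((weakContinuousAt_fusionTail hc').const_mul _ l)).tendsto.mono_left nhdsWithin_le_nhds

variable (n r) in
/-- The arguments of the fusion function after the first `m` evaluations. -/
def evaluatedArgs {d : ℕ} (m : ℕ) (w : Fin d → ℂ) (k : Fin n) : ℂ :=
  if h : m ≤ k ∧ k - m < d then w ⟨k - m, h.2⟩ else wordContent r k

theorem evaluatedArgs_cons {d : ℕ} {m : ℕ} (hm : m < n) (z : ℂ) (w : Fin d → ℂ) :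
    evaluatedArgs n r m (Fin.cons z w : Fin (d + 1) → ℂ) =
      Function.update (evaluatedArgs n r (m + 1) w) ⟨m, hm⟩ z := by
  funext k
  rcases lt_trichotomy (k : ℕ) m with h | h | h
  · rw [Function.update_of_ne (fun e => h.ne (congrArg Fin.val e)), evaluatedArgs, evaluatedArgs,
      dif_neg (by omega), dif_neg (by omega)]
  · obtain rfl : k = ⟨m, hm⟩ := Fin.ext h
    rw [Function.update_self, evaluatedArgs, dif_pos (by simp)]
    simp
  · rw [Function.update_of_ne (fun e => h.ne' (congrArg Fin.val e)), evaluatedArgs, evaluatedArgs]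
    by_cases hd : (k : ℕ) - m < d + 1
    · rw [dif_pos ⟨h.le, hd⟩, dif_pos ⟨h, by omega⟩]
      have : (⟨k - m, hd⟩ : Fin (d + 1)) = Fin.succ ⟨k - (m + 1), by omega⟩ :=
        Fin.ext (by simp; omega)
      rw [this, Fin.cons_succ]
    · rw [dif_neg (by omega), dif_neg (by omega)]

theorem isConsecutiveValue_fusionStage_tail (b : Module.Basis (Fin N) ℂ V) (hr : IsLattice r n)
    (d : ℕ) : ∀ m, m + d = n →
      IsConsecutiveValue
        (fun w : Fin d → ℂ => fusionStage V n r m * fusionTail V m (evaluatedArgs n r m w))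
        (fun i => wordContent r (m + i)) (fusionStage V n r n) := by
  induction d with
  | zero =>
    rintro m rfl
    change _ * _ = _
    rw [fusionTail, List.drop_of_length_le (by simp), List.map_nil, List.prod_nil, mul_one]
    rfl
  | succ d ih =>
    intro m hm
    have hmn : m < n := by omega
    -- The genericity polynomial keeps the remaining variables away from the value being
    -- substituted, so the tail has no singular factor there.
    refine ⟨fun w => fusionStage V n r (m + 1) *
      fusionTail V (m + 1) (evaluatedArgs n r (m + 1) w), ⟨∏ k, (MvPolynomial.X k -
        MvPolynomial.C (wordContent r m)), Finset.prod_ne_zero_iff.2 fun k _ h => ?_,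
        fun w hw l => ?_⟩, ?_⟩
    · have := congrArg (MvPolynomial.eval fun _ => wordContent r m + 1) h
      simp at this
    · simp only [evaluatedArgs_cons hmn]
      refine tendsto_fusionStage b (m := ⟨m, hmn⟩) (hr.mono hmn) (fun k hk => ?_)
        (fun k hk => ?_) l
      · have : (k : ℕ) ≤ m := hk
        rw [evaluatedArgs, dif_neg (by omega)]
      · have hk : m < (k : ℕ) := hk
        have := k.2
        rw [evaluatedArgs, dif_pos ⟨hk, by omega⟩]
        rw [map_prod] at hw
        have := Finset.prod_ne_zero_iff.1 hw ⟨k - (m + 1), by omega⟩ (Finset.mem_univ _)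
        simpa [sub_ne_zero] using this
    · convert ih (m + 1) (by omega) using 1
      funext i
      simp only [Fin.tail, Fin.val_succ]
      congr 1
      omega

theorem isConsecutiveValue_fusionFun (b : Module.Basis (Fin N) ℂ V) (hr : IsLattice r n) :
    IsConsecutiveValue (fun c => fusionFun V c) (fun k : Fin n => wordContent r k)
      (fusionStage V n r n) := by
  convert isConsecutiveValue_fusionStage_tail (V := V) b hr n 0 (Nat.zero_add n) using 2 with w k
  · have : evaluatedArgs n r 0 w = w := by
      funext k
      rw [evaluatedArgs, dif_pos ⟨Nat.zero_le _, k.2⟩]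
      rfl
    rw [this, fusionFun_eq, fusionStage, one_mul]
  · rw [Nat.zero_add]

theorem rowProj_apply {m : Fin n} (hr : IsLattice r m) {f : TPow V n}
    (hf : jm V id m f = wordContent r m • f) : rowProj V r m (r m) f = f := by
  rcases eq_or_ne f 0 with rfl | hne
  · exact map_zero _
  · rw [rowProj, Module.End.aeval_apply_of_hasEigenvector
      (μ := wordContent r m) ⟨Module.End.mem_eigenspace_iff.2 hf, hne⟩,
      show wordContent r m = shiftedCount r m (r m) from rfl,
      Lagrange.eval_basis_self hr.shiftedCount_injective.injOn (Finset.mem_univ _), one_smul]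

theorem range_fusionStage (b : Module.Basis (Fin N) ℂ V) (hr : IsLattice r n) :
    LinearMap.range (fusionStage V n r n) = jmSpace V id fun k : Fin n => wordContent r k := by
  refine le_antisymm ?_ fun f hf => ?_
  · rintro _ ⟨x, rfl⟩
    exact mem_jmSpace.2 fun k => LinearMap.congr_fun (jm_mul_fusionStage b le_rfl hr k k.2) x
  -- On a joint eigenvector every spectral projection is the identity, so a stage acts by a product
  -- of non-zero coefficients.
  · have key : ∀ m ≤ n, ∃ s : ℂ, s ≠ 0 ∧ fusionStage V n r m f = s • f := by
      intro m
      induction m with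
      | zero => exact fun _ => ⟨1, one_ne_zero, (one_smul _ _).symm⟩
      | succ m ih =>
        intro hm
        obtain ⟨s, hs, h⟩ := ih (by omega)
        refine ⟨fusionCoeff r m (r m) (wordContent r m) * s,
          mul_ne_zero (fusionCoeff_ne_zero (hr.mono hm)) hs, ?_⟩
        have h1 := fusionStage_succ (V := V) r ⟨m, hm⟩
        simp only at h1
        rw [h1, Module.End.mul_apply, LinearMap.smul_apply,
          rowProj_apply (m := ⟨m, hm⟩) (hr.mono (by simp; omega)) (mem_jmSpace.1 hf ⟨m, hm⟩),
          map_smul, h, smul_smul]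
    obtain ⟨s, hs, h⟩ := key n le_rfl
    exact ⟨s⁻¹ • f, by rw [map_smul, h, inv_smul_smul₀ hs]⟩

end Fusion

/-! ### The irreducible highest-weight module as a quotient of the enveloping algebra. -/

section EnvelopingAlgebra

variable {V : Type*} [AddCommGroup V] [Module ℂ V] {N : ℕ} (b : Module.Basis (Fin N) ℂ V)

/-- The matrix units in the enveloping algebra. -/
def elemU (i j : Fin N) : UGl V := UniversalEnvelopingAlgebra.ι ℂ (elemGl b i j)

theorem elemU_mul (i j k l : Fin N) :
    elemU b i j * elemU b k l = elemU b k l * elemU b i j +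
      ((if j = k then elemU b i l else 0) - if l = i then elemU b k j else 0) := by
  have h : ⁅elemGl b i j, elemGl b k l⁆ =
      (if j = k then elemGl b i l else 0) - if l = i then elemGl b k j else 0 := by
    rw [Ring.lie_def, elemGl_mul, elemGl_mul]
  have h1 := LieHom.map_lie (UniversalEnvelopingAlgebra.ι ℂ) (elemGl b i j) (elemGl b k l)
  rw [h, Ring.lie_def, map_sub, apply_ite (UniversalEnvelopingAlgebra.ι ℂ),
    apply_ite (UniversalEnvelopingAlgebra.ι ℂ), map_zero] at h1
  rw [elemU, elemU, elemU, elemU, h1]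
  abel

theorem ι_eq_sum_elemU (g : Module.End ℂ V) :
    ∃ c : Fin N → Fin N → ℂ,
      UniversalEnvelopingAlgebra.ι ℂ g = ∑ i, ∑ j, c i j • elemU b i j := by
  refine ⟨LinearMap.toMatrix b b g, ?_⟩
  have h : g = ∑ i, ∑ j, (LinearMap.toMatrix b b g) i j • elemGl b i j := by
    conv_lhs => rw [← Matrix.toLin_toMatrix b b g, Matrix.matrix_eq_sum_single
      (LinearMap.toMatrix b b g)]
    simp only [map_sum]
    refine Finset.sum_congr rfl fun i _ => Finset.sum_congr rfl fun j _ => ?_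
    rw [elemGl, ← map_smul, Matrix.smul_single, smul_eq_mul, mul_one]
  conv_lhs => rw [h]
  simp only [map_sum, map_smul]
  rfl

theorem adjoin_range_ι :
    Algebra.adjoin ℂ (Set.range (UniversalEnvelopingAlgebra.ι ℂ (L := Module.End ℂ V))) = ⊤ := by
  set S := Algebra.adjoin ℂ (Set.range (UniversalEnvelopingAlgebra.ι ℂ (L := Module.End ℂ V)))
  have hmem : ∀ g : Module.End ℂ V, UniversalEnvelopingAlgebra.ι ℂ g ∈ S := fun g =>
    Algebra.subset_adjoin ⟨g, rfl⟩
  let f : Module.End ℂ V →ₗ⁅ℂ⁆ S :=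
    { toFun := fun g => ⟨UniversalEnvelopingAlgebra.ι ℂ g, hmem g⟩
      map_add' := fun x y => Subtype.ext (map_add _ x y)
      map_smul' := fun c x => Subtype.ext (map_smul _ c x)
      map_lie' := fun {x y} => Subtype.ext (by
        change _ = ((_ : S) : UGl V) * _ - _
        exact LieHom.map_lie (UniversalEnvelopingAlgebra.ι ℂ) x y) }
  have h : S.val.comp (UniversalEnvelopingAlgebra.lift ℂ f) = AlgHom.id ℂ (UGl V) := by
    apply UniversalEnvelopingAlgebra.hom_ext
    ext g
    simp [f]
  rw [eq_top_iff]
  rintro x -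
  have := DFunLike.congr_fun h x
  rw [← show _ = x from this]
  exact (UniversalEnvelopingAlgebra.lift ℂ f x).2

/-- Products of lowering operators, with their heights. -/
inductive IsLoweringProduct : ℕ → UGl V → Prop
  | one : IsLoweringProduct 0 1
  | mul {h : ℕ} {y : UGl V} (i j : Fin N) (hij : j < i) (hy : IsLoweringProduct h y) :
    IsLoweringProduct (h + (i - j)) (elemU b i j * y)

/-- The sum of the span of the products of lowering operators and of the left ideal defining the
Verma module. -/
def loweringSpan (wt : Fin N → ℂ) : Submodule ℂ (UGl V) :=
  Submodule.span ℂ {y | ∃ h, IsLoweringProduct b h y} ⊔ (vermaIdeal b wt).restrictScalars ℂ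

variable {b} {wt : Fin N → ℂ}

theorem IsLoweringProduct.mem {h : ℕ} {y : UGl V} (hy : IsLoweringProduct b h y) :
    y ∈ loweringSpan b wt :=
  Submodule.mem_sup_left (Submodule.subset_span ⟨h, hy⟩)

theorem mem_loweringSpan_of_mem_vermaIdeal {y : UGl V} (hy : y ∈ vermaIdeal b wt) :
    y ∈ loweringSpan b wt := Submodule.mem_sup_right hy

theorem elemU_mem_vermaIdeal {i j : Fin N} (h : i < j) : elemU b i j ∈ vermaIdeal b wt :=
  Submodule.subset_span (Or.inl ⟨i, j, h, rfl⟩)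

theorem elemU_sub_mem_vermaIdeal (i : Fin N) :
    elemU b i i - algebraMap ℂ (UGl V) (wt i) ∈ vermaIdeal b wt :=
  Submodule.subset_span (Or.inr ⟨i, rfl⟩)

theorem mul_mem_loweringSpan {x : UGl V}
    (hx : ∀ h y, IsLoweringProduct b h y → x * y ∈ loweringSpan b wt) {t : UGl V}
    (ht : t ∈ loweringSpan b wt) : x * t ∈ loweringSpan b wt := by
  have : loweringSpan b wt ≤ (loweringSpan b wt).comap (LinearMap.mulLeft ℂ x) := by
    refine sup_le (Submodule.span_le.2 ?_) fun y hy => ?_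
    · rintro y ⟨h, hy⟩
      exact hx h y hy
    · exact mem_loweringSpan_of_mem_vermaIdeal (Submodule.smul_mem (vermaIdeal b wt) x hy)
  exact this ht

/-- Straightening: a raising or diagonal unit is commuted to the right past the lowering ones. The
commutators are again matrix units times a shorter product, and a unit that reaches `1` lies in the
Verma ideal up to a scalar. Only the spanning half of the Poincaré--Birkhoff--Witt theorem is
obtained in this way, and it is enough. -/
theorem elemU_mul_mem_loweringSpan {h : ℕ} {y : UGl V} (hy : IsLoweringProduct b h y)
    (i j : Fin N) : elemU b i j * y ∈ loweringSpan b wt := by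
  induction hy generalizing i j with
  | one =>
    rw [mul_one]
    rcases lt_trichotomy i j with hij | rfl | hij
    · exact mem_loweringSpan_of_mem_vermaIdeal (elemU_mem_vermaIdeal hij)
    · have h1 : (1 : UGl V) ∈ loweringSpan b wt := IsLoweringProduct.one.mem
      have h2 := Submodule.add_mem _ (mem_loweringSpan_of_mem_vermaIdeal
        (elemU_sub_mem_vermaIdeal (wt := wt) (b := b) i)) (Submodule.smul_mem _ (wt i) h1)
      rwa [← Algebra.algebraMap_eq_smul_one, sub_add_cancel] at h2
    · simpa using (IsLoweringProduct.mul (b := b) i j hij .one).mem (wt := wt)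
  | @mul h y k l hkl hy ih =>
    by_cases hij : j < i
    · exact (IsLoweringProduct.mul i j hij (IsLoweringProduct.mul k l hkl hy)).mem
    · rw [← mul_assoc, elemU_mul, add_mul, mul_assoc]
      refine Submodule.add_mem _ (mul_mem_loweringSpan (fun h' y' hy' =>
        (IsLoweringProduct.mul k l hkl hy').mem) (ih i j)) ?_
      rw [sub_mul, ite_mul, ite_mul, zero_mul]
      refine Submodule.sub_mem _ ?_ ?_
      · split_ifs
        exacts [ih i l, Submodule.zero_mem _]
      · split_ifs
        exacts [ih k j, Submodule.zero_mem _]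

theorem loweringSpan_eq_top : loweringSpan b wt = ⊤ := by
  have key : ∀ x : UGl V, ∀ t ∈ loweringSpan b wt, x * t ∈ loweringSpan b wt := by
    intro x
    have hx : x ∈ Algebra.adjoin ℂ
        (Set.range (UniversalEnvelopingAlgebra.ι ℂ (L := Module.End ℂ V))) := by
      rw [adjoin_range_ι]; trivial
    induction hx using Algebra.adjoin_induction with
    | mem x hx =>
      obtain ⟨g, rfl⟩ := hx
      obtain ⟨c, hc⟩ := ι_eq_sum_elemU b g
      intro t ht
      rw [hc, Finset.sum_mul]
      refine Submodule.sum_mem _ fun i _ => ?_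
      rw [Finset.sum_mul]
      refine Submodule.sum_mem _ fun j _ => ?_
      rw [smul_mul_assoc]
      exact Submodule.smul_mem _ _ (mul_mem_loweringSpan (fun h y hy =>
        elemU_mul_mem_loweringSpan hy i j) ht)
    | algebraMap c =>
      intro t ht
      rw [← Algebra.smul_def]
      exact Submodule.smul_mem _ _ ht
    | add x y _ _ hx hy =>
      intro t ht
      rw [add_mul]
      exact Submodule.add_mem _ (hx t ht) (hy t ht)
    | mul x y _ _ hx hy =>
      intro t ht
      rw [mul_assoc]
      exact hx _ (hy t ht)
  rw [eq_top_iff]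
  rintro x -
  simpa using key x 1 IsLoweringProduct.one.mem

theorem IsLoweringProduct.eq_one {h : ℕ} {y : UGl V} (hy : IsLoweringProduct b h y)
    (h0 : h = 0) : y = 1 := by
  cases hy with
  | one => rfl
  | mul i j hij hy =>
    have : (j : ℕ) < i := hij
    omega

variable (b) in
/-- A diagonal element whose commutator with a lowering product measures its height. -/
def gradingU : UGl V := ∑ k : Fin N, (-(k : ℂ)) • elemU b k k

/-- The eigenvalue of `gradingU` on a highest weight vector of weight `wt`. -/
def gradingEval (wt : Fin N → ℂ) : ℂ := ∑ k : Fin N, (-(k : ℂ)) * wt k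

theorem gradingU_mul_elemU (i j : Fin N) :
    gradingU b * elemU b i j = elemU b i j * gradingU b + ((j : ℂ) - i) • elemU b i j := by
  simp only [gradingU, Finset.sum_mul, Finset.mul_sum, smul_mul_assoc, mul_smul_comm]
  rw [← sub_eq_iff_eq_add', ← Finset.sum_sub_distrib]
  simp only [← smul_sub, elemU_mul b _ _ i j, add_sub_cancel_left]
  simp only [smul_sub, smul_ite, smul_zero, Finset.sum_sub_distrib]
  rw [Finset.sum_ite_eq' Finset.univ i, Finset.sum_ite_eq Finset.univ j]
  simp only [Finset.mem_univ, if_true]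
  rw [← sub_smul]
  congr 1
  ring

theorem IsLoweringProduct.gradingU_mul {h : ℕ} {y : UGl V} (hy : IsLoweringProduct b h y) :
    gradingU b * y = y * gradingU b - (h : ℂ) • y := by
  induction hy with
  | one => simp
  | @mul h y i j hij hy ih =>
    rw [← mul_assoc, gradingU_mul_elemU, add_mul, mul_assoc, ih, mul_sub, mul_smul_comm,
      smul_mul_assoc, ← mul_assoc]
    rw [Nat.cast_add, Nat.cast_sub (show (j : ℕ) ≤ i from hij.le)]
    module

theorem gradingU_sub_mem : gradingU b - algebraMap ℂ (UGl V) (gradingEval wt) ∈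
    vermaIdeal b wt := by
  have : gradingU b - algebraMap ℂ (UGl V) (gradingEval wt) =
      ∑ k : Fin N, algebraMap ℂ (UGl V) (-(k : ℂ)) *
        (elemU b k k - algebraMap ℂ (UGl V) (wt k)) := by
    simp only [gradingU, gradingEval, map_sum, map_mul, mul_sub, Finset.sum_sub_distrib,
      Algebra.smul_def]
  rw [this]
  exact Submodule.sum_mem _ fun k _ => Submodule.smul_mem _ _ (elemU_sub_mem_vermaIdeal k)

theorem aeval_gradingU_sub_mem (p : Polynomial ℂ) :
    Polynomial.aeval (gradingU b) p - algebraMap ℂ (UGl V) (p.eval (gradingEval wt)) ∈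
      vermaIdeal b wt := by
  obtain ⟨q, hq⟩ := Polynomial.X_sub_C_dvd_sub_C_eval (a := gradingEval wt) (p := p)
  have := congrArg (Polynomial.aeval (gradingU b)) hq
  rw [mul_comm] at this
  simp only [map_sub, map_mul, Polynomial.aeval_C, Polynomial.aeval_X] at this
  rw [this]
  exact Submodule.smul_mem _ _ gradingU_sub_mem

/-- Modulo the Verma ideal, a lowering product of height `h` is an eigenvector of the grading
element with eigenvalue `gradingEval wt - h`. A polynomial in this element can kill all parts of
positive height without vanishing at `gradingEval wt`, which leaves a scalar. Linear independence of
the lowering products is not needed. -/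
theorem exists_aeval_gradingU_mul_sub_mem (z : UGl V) :
    ∃ (p : Polynomial ℂ) (c : ℂ), p.eval (gradingEval wt) ≠ 0 ∧
      Polynomial.aeval (gradingU b) p * z - algebraMap ℂ (UGl V) c ∈ vermaIdeal b wt := by
  have hz : z ∈ loweringSpan b wt := by rw [loweringSpan_eq_top]; trivial
  obtain ⟨x, hx, y, hy, rfl⟩ := Submodule.mem_sup.1 hz
  suffices h : ∃ (p : Polynomial ℂ) (c : ℂ), p.eval (gradingEval wt) ≠ 0 ∧
      Polynomial.aeval (gradingU b) p * x - algebraMap ℂ (UGl V) c ∈ vermaIdeal b wt by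
    obtain ⟨p, c, hp, h⟩ := h
    refine ⟨p, c, hp, ?_⟩
    rw [mul_add, add_sub_right_comm]
    exact Submodule.add_mem _ h (Submodule.smul_mem (vermaIdeal b wt) _ hy)
  clear hy hz y
  induction hx using Submodule.span_induction with
  | mem y hy =>
    obtain ⟨h, hy⟩ := hy
    have hh : gradingU b * y = y * gradingU b - (h : ℂ) • y := hy.gradingU_mul
    rcases Nat.eq_zero_or_pos h with rfl | hpos
    · obtain rfl := hy.eq_one rfl
      exact ⟨1, 1, by simp, by simp⟩
    -- The root is the eigenvalue attached to the height `h`, and the value at `gradingEval wt` is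
    -- `h`, which is non-zero.
    · refine ⟨Polynomial.X - Polynomial.C (gradingEval wt - h), 0, by simp; omega, ?_⟩
      have : Polynomial.aeval (gradingU b) (Polynomial.X - Polynomial.C (gradingEval wt - h)) * y -
          algebraMap ℂ (UGl V) 0 = y * (gradingU b - algebraMap ℂ (UGl V) (gradingEval wt)) := by
        simp only [map_sub, Polynomial.aeval_X, Polynomial.aeval_C, sub_mul, hh, map_zero, sub_zero,
          ← Algebra.smul_def, mul_sub, ← Algebra.commutes]
        module
      rw [this]
      exact Submodule.smul_mem _ _ gradingU_sub_mem
  | zero => exact ⟨1, 0, by simp, by simp⟩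
  | add x y _ _ hx hy =>
    obtain ⟨p, c, hp, h⟩ := hx
    obtain ⟨q, d, hq, h'⟩ := hy
    refine ⟨p * q, q.eval (gradingEval wt) * c + p.eval (gradingEval wt) * d,
      by rw [Polynomial.eval_mul]; exact mul_ne_zero hp hq, ?_⟩
    have e : Polynomial.aeval (gradingU b) (p * q) * (x + y) - algebraMap ℂ (UGl V)
          (q.eval (gradingEval wt) * c + p.eval (gradingEval wt) * d) =
        Polynomial.aeval (gradingU b) q *
            (Polynomial.aeval (gradingU b) p * x - algebraMap ℂ (UGl V) c) +
          Polynomial.aeval (gradingU b) p *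
            (Polynomial.aeval (gradingU b) q * y - algebraMap ℂ (UGl V) d) +
        (algebraMap ℂ (UGl V) c * (Polynomial.aeval (gradingU b) q -
            algebraMap ℂ (UGl V) (q.eval (gradingEval wt))) +
          algebraMap ℂ (UGl V) d * (Polynomial.aeval (gradingU b) p -
            algebraMap ℂ (UGl V) (p.eval (gradingEval wt)))) := by
      have h1 : Polynomial.aeval (gradingU b) (p * q) = Polynomial.aeval (gradingU b) q *
        Polynomial.aeval (gradingU b) p := by rw [mul_comm, map_mul]
      have h2 : Polynomial.aeval (gradingU b) (p * q) = Polynomial.aeval (gradingU b) p *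
        Polynomial.aeval (gradingU b) q := map_mul _ _ _
      rw [mul_add, h1, mul_assoc, ← h1, h2, mul_assoc, map_add, map_mul, map_mul]
      simp only [mul_sub, ← Algebra.commutes c, ← Algebra.commutes d, ← map_mul, mul_comm c,
        mul_comm d]
      abel
    rw [e]
    refine Submodule.add_mem _ (Submodule.add_mem _ (Submodule.smul_mem _ _ h)
      (Submodule.smul_mem _ _ h')) (Submodule.add_mem _
        (Submodule.smul_mem _ _ (aeval_gradingU_sub_mem q))
        (Submodule.smul_mem _ _ (aeval_gradingU_sub_mem p)))
  | smul a x _ hx =>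
    obtain ⟨p, c, hp, h⟩ := hx
    refine ⟨p, a * c, hp, ?_⟩
    rw [mul_smul_comm, map_mul, ← Algebra.smul_def, ← smul_sub, Algebra.smul_def]
    exact Submodule.smul_mem _ _ h

/-! ### Simple highest-weight representations as quotients of the Verma module. -/

section Module

variable {M : Type*} [AddCommGroup M] [Module ℂ M] (ρ : UGl V →ₐ[ℂ] Module.End ℂ M)
  {W : Submodule ℂ M} {v : M}

theorem map_apply_mem_of_stable (hst : ∀ i j, ∀ f ∈ W, ρ (elemU b i j) f ∈ W) (x : UGl V) :
    ∀ f ∈ W, ρ x f ∈ W := by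
  have hx : x ∈ Algebra.adjoin ℂ
      (Set.range (UniversalEnvelopingAlgebra.ι ℂ (L := Module.End ℂ V))) := by
    rw [adjoin_range_ι]; trivial
  induction hx using Algebra.adjoin_induction with
  | mem x hx =>
    obtain ⟨g, rfl⟩ := hx
    obtain ⟨c, hc⟩ := ι_eq_sum_elemU b g
    intro f hf
    rw [hc]
    simp only [map_sum, map_smul, LinearMap.sum_apply, LinearMap.smul_apply]
    exact W.sum_mem fun i _ => W.sum_mem fun j _ => W.smul_mem _ (hst i j f hf)
  | algebraMap c =>
    intro f hf
    rw [AlgHom.commutes, Module.algebraMap_end_apply]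
    exact W.smul_mem _ hf
  | add x y _ _ hx hy =>
    intro f hf
    rw [map_add]
    exact W.add_mem (hx f hf) (hy f hf)
  | mul x y _ _ hx hy =>
    intro f hf
    rw [map_mul]
    exact hx _ (hy f hf)

/-- A simple module generated by a highest weight vector is the irreducible quotient of the Verma
module. -/
theorem exists_irrModule_equiv (hst : ∀ i j, ∀ f ∈ W, ρ (elemU b i j) f ∈ W)
    (hirr : ∀ U ≤ W, (∀ i j, ∀ f ∈ U, ρ (elemU b i j) f ∈ U) → U ≠ ⊥ → U = W)
    (hv : v ∈ W) (hv0 : v ≠ 0) (hsing : ∀ i j, i < j → ρ (elemU b i j) v = 0)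
    (hwt : ∀ i, ρ (elemU b i i) v = wt i • v) :
    ∃ φ : IrrModule b wt ≃ₗ[ℂ] W, ∀ (x : UGl V) (m : IrrModule b wt),
      (φ (x • m) : M) = ρ x (φ m) := by
  let ev : UGl V →ₗ[ℂ] M := (LinearMap.applyₗ v) ∘ₗ ρ.toLinearMap
  have hev : ∀ x, ev x = ρ x v := fun x => rfl
  -- By irreducibility every non-zero vector of `W` is cyclic.
  have hgen : ∀ f ∈ W, f ≠ 0 → ∀ g ∈ W, ∃ x, ρ x f = g := by
    intro f hf hf0 g hg
    let e : UGl V →ₗ[ℂ] M := (LinearMap.applyₗ f) ∘ₗ ρ.toLinearMap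
    have he : ∀ x, e x = ρ x f := fun x => rfl
    have h : LinearMap.range e = W := by
      refine hirr _ ?_ ?_ fun h => hf0 ?_
      · rintro _ ⟨x, rfl⟩
        exact map_apply_mem_of_stable ρ hst x f hf
      · rintro i j _ ⟨x, rfl⟩
        exact ⟨elemU b i j * x, by rw [he, he, map_mul]; rfl⟩
      · have : e 1 ∈ LinearMap.range e := ⟨1, rfl⟩
        rw [h, Submodule.mem_bot, he, map_one] at this
        exact this
    rw [← h] at hg
    exact hg
  have hverma : ∀ x ∈ vermaIdeal b wt, ρ x v = 0 := by
    intro x hx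
    induction hx using Submodule.span_induction with
    | mem x hx =>
      rcases hx with ⟨i, j, hij, rfl⟩ | ⟨i, rfl⟩
      · exact hsing i j hij
      · rw [map_sub, AlgHom.commutes, LinearMap.sub_apply, Module.algebraMap_end_apply]
        exact sub_eq_zero.2 (hwt i)
    | zero => rw [map_zero, LinearMap.zero_apply]
    | add x y _ _ hx hy => rw [map_add, LinearMap.add_apply, hx, hy, add_zero]
    | smul a x _ hx => rw [smul_eq_mul, map_mul, Module.End.mul_apply, hx, map_zero]
  let Ann : Submodule (UGl V) (UGl V) :=
    { carrier := {x | ρ x v = 0}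
      add_mem' := fun {x y} hx hy => by
        change ρ (x + y) v = 0
        rw [map_add, LinearMap.add_apply, show ρ x v = 0 from hx, show ρ y v = 0 from hy, add_zero]
      zero_mem' := by
        change ρ 0 v = 0
        rw [map_zero, LinearMap.zero_apply]
      smul_mem' := fun a x hx => by
        change ρ (a * x) v = 0
        rw [map_mul, Module.End.mul_apply, show ρ x v = 0 from hx, map_zero] }
  have hmem : ∀ x, x ∈ Ann ↔ ρ x v = 0 := fun x => Iff.rfl
  -- The annihilator of `v` is proper and contains every proper left ideal `J` above the Verma
  -- ideal. If `x ∈ J` and `x v ≠ 0`, some `y` gives `y x v = v`. A grading polynomial turns `y x`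
  -- into a scalar `c` modulo the Verma ideal, and applying this to `v` shows that `c` is the value
  -- of the polynomial at `gradingEval wt`. So `c ≠ 0` lies in `J`, and `J` is everything.
  have hmax : maxIdeal b wt = Ann := by
    refine le_antisymm (sSup_le ?_) (le_sSup ⟨fun x hx => hverma x hx, fun h => hv0 ?_⟩)
    · rintro J ⟨hJ, hJtop⟩ x hx
      by_contra hxA
      obtain ⟨y, hy⟩ := hgen (ρ x v) (map_apply_mem_of_stable ρ hst x v hv) hxA v hv
      obtain ⟨p, c, hp, hpc⟩ := exists_aeval_gradingU_mul_sub_mem (b := b) (wt := wt) (y * x)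
      have h1 : ρ (Polynomial.aeval (gradingU b) p * (y * x)) v =
          p.eval (gradingEval wt) • v := by
        have := hverma _ (aeval_gradingU_sub_mem (b := b) (wt := wt) p)
        rw [map_sub, AlgHom.commutes, LinearMap.sub_apply, Module.algebraMap_end_apply,
          sub_eq_zero] at this
        rw [map_mul, map_mul, Module.End.mul_apply, Module.End.mul_apply, hy, this]
      have h2 := hverma _ hpc
      rw [map_sub, LinearMap.sub_apply, h1, AlgHom.commutes, Module.algebraMap_end_apply,
        ← sub_smul, smul_eq_zero, or_iff_left hv0, sub_eq_zero] at h2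
      refine hJtop (Submodule.eq_top_iff'.2 fun z => ?_)
      have h3 : algebraMap ℂ (UGl V) c ∈ J := by
        have h4 : Polynomial.aeval (gradingU b) p * (y * x) ∈ J :=
          J.smul_mem _ (J.smul_mem y hx)
        have := J.sub_mem h4 (hJ hpc)
        rwa [sub_sub_cancel] at this
      have h5 : z = (z * algebraMap ℂ (UGl V) c⁻¹) * algebraMap ℂ (UGl V) c := by
        rw [mul_assoc, ← map_mul, inv_mul_cancel₀ (h2 ▸ hp), map_one, mul_one]
      rw [h5]
      exact J.smul_mem _ h3
    · have : (1 : UGl V) ∈ Ann := h ▸ Submodule.mem_top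
      rw [hmem, map_one] at this
      exact this
  have hker : (maxIdeal b wt).restrictScalars ℂ = LinearMap.ker ev := by
    rw [hmax]
    rfl
  have hrange : LinearMap.range ev = W := by
    refine le_antisymm ?_ fun f hf => hgen v hv hv0 f hf
    rintro _ ⟨x, rfl⟩
    exact map_apply_mem_of_stable ρ hst x v hv
  let φ : IrrModule b wt ≃ₗ[ℂ] W :=
    ((Submodule.Quotient.restrictScalarsEquiv ℂ (maxIdeal b wt)).symm ≪≫ₗ
      Submodule.quotEquivOfEq _ _ hker) ≪≫ₗ ev.quotKerEquivRange ≪≫ₗ LinearEquiv.ofEq _ _ hrange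
  have hφ : ∀ x : UGl V, (φ (Submodule.Quotient.mk x) : M) = ρ x v := fun x => rfl
  refine ⟨φ, fun x m => ?_⟩
  obtain ⟨y, rfl⟩ := Submodule.Quotient.mk_surjective _ m
  rw [← Submodule.Quotient.mk_smul, hφ, hφ, smul_eq_mul, map_mul]
  rfl

end Module

variable (b) in
/-- The simultaneous eigenspace of the Jucys--Murphy elements attached to a lattice word is the
irreducible module of highest weight the content of the word. -/
theorem exists_irrModule_equiv_jmSpace {n : ℕ} {r : ℕ → Fin N} (hr : IsLattice r n) :
    ∃ φ : IrrModule b (fun i => (rowCount r n i : ℂ)) ≃ₗ[ℂ]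
        jmSpace V id (fun k : Fin n => wordContent r k),
      ∀ (g : Module.End ℂ V) (m : IrrModule b fun i => (rowCount r n i : ℂ)),
        (φ (UniversalEnvelopingAlgebra.ι ℂ g • m) : TPow V n) = glAction n g (φ m) := by
  have : FiniteDimensional ℂ V := b.finiteDimensional_of_finite
  let _ := tensorNormed b n
  let _ := tensorInner b n
  obtain ⟨v, hv⟩ := exists_isHighestWeight_jmSpace b hr
  have hρ : ∀ g, UniversalEnvelopingAlgebra.lift ℂ (glHom V n) (UniversalEnvelopingAlgebra.ι ℂ g) =
      glAction n (V := V) g := fun g => UniversalEnvelopingAlgebra.lift_ι_apply ℂ _ g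
  have hE : ∀ i j, UniversalEnvelopingAlgebra.lift ℂ (glHom V n) (elemU b i j) = tensorE b n i j :=
    fun i j => hρ _
  obtain ⟨φ, hφ⟩ := exists_irrModule_equiv (b := b) (wt := fun i => (rowCount r n i : ℂ))
    (UniversalEnvelopingAlgebra.lift ℂ (glHom V n)) (v := v)
    (W := jmSpace V id fun k : Fin n => wordContent r k)
    (fun i j f hf => by rw [hE]; exact hv.stable i j f hf)
    (fun U hU hst hne => hv.eq_of_le (isUnitaryGl_tensorE b n) hU
      (fun i j f hf => by rw [← hE]; exact hst i j f hf) hne)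
    hv.mem hv.ne_zero (fun i j hij => by rw [hE]; exact hv.singular i j hij)
    (fun i => by rw [hE]; exact hv.weight i)
  exact ⟨φ, fun g m => by rw [hφ, hρ]⟩

end EnvelopingAlgebra

/-! ### The word of a standard tableau -/

section TableauWord

variable {N : ℕ} (T : Tableaux N)

theorem Tableaux.fst_lt (p : T.1.shape.cells) : p.1.1 < N := by
  have h : (p.1.1, 0) ∈ T.1.shape :=
    T.1.shape.up_left_mem le_rfl (Nat.zero_le p.1.2) ((YoungDiagram.mem_cells _).1 p.2)
  exact (YoungDiagram.mem_iff_lt_colLen.1 h).trans_le T.2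

/-- The sequence of the rows of the entries of a tableau. -/
def Tableaux.word (k : ℕ) : Fin N :=
  if h : k < T.1.size then ⟨(T.1.entry.symm ⟨k, h⟩).1.1, T.fst_lt _⟩
  else ⟨(T.1.entry.symm ⟨0, T.1.size_pos⟩).1.1, T.fst_lt _⟩

theorem Tableaux.word_val (k : Fin T.1.size) : (T.word k : ℕ) = (T.1.entry.symm k).1.1 := by
  rw [Tableaux.word, dif_pos k.2]

theorem Tableaux.rowCount_word {k : ℕ} (hk : k ≤ T.1.size) (i : Fin N) :
    rowCount T.word k i = (Finset.univ.filter fun p : T.1.shape.cells =>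
      p.1.1 = i ∧ (T.1.entry p : ℕ) < k).card := by
  rw [rowCount]
  symm
  refine Finset.card_bij (fun p _ => (T.1.entry p : ℕ)) ?_ ?_ ?_
  · intro p hp
    simp only [Finset.mem_filter, Finset.mem_univ, true_and, Finset.mem_range] at hp ⊢
    refine ⟨hp.2, Fin.ext ?_⟩
    rw [T.word_val, Equiv.symm_apply_apply, hp.1]
  · intro p _ q _ h
    exact T.1.entry.injective (Fin.ext h)
  · intro m hm
    simp only [Finset.mem_filter, Finset.mem_range] at hm
    have hmn : m < T.1.size := hm.1.trans_le hk
    refine ⟨T.1.entry.symm ⟨m, hmn⟩, ?_, by simp⟩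
    simp only [Finset.mem_filter, Finset.mem_univ, true_and, Equiv.apply_symm_apply]
    exact ⟨by rw [← T.word_val ⟨m, hmn⟩, ← hm.2], hm.1⟩

theorem StandardTableau.entry_mono (T : StandardTableau) {p q : T.shape.cells}
    (h1 : p.1.1 ≤ q.1.1) (h2 : p.1.2 ≤ q.1.2) : T.entry p ≤ T.entry q := by
  rcases eq_or_ne p q with rfl | h
  · exact le_rfl
  · exact (T.increasing p q h1 h2 h).le

/-- Moving a cell of row `j` straight up to row `i` is injective and does not increase the entry. -/
theorem Tableaux.isLattice_word : IsLattice T.word T.1.size := by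
  intro k hk i j hij
  rw [T.rowCount_word hk, T.rowCount_word hk]
  have hmem : ∀ p : T.1.shape.cells, p.1.1 = j → ((i : ℕ), p.1.2) ∈ T.1.shape.cells := fun p hp =>
    (YoungDiagram.mem_cells _).2 (T.1.shape.up_left_mem (hp ▸ hij) le_rfl
      ((YoungDiagram.mem_cells _).1 p.2))
  refine Finset.card_le_card_of_injOn
    (fun p => if h : p.1.1 = j then ⟨((i : ℕ), p.1.2), hmem p h⟩ else p) ?_ ?_
  · intro p hp
    simp only [Finset.coe_filter, Finset.mem_univ, true_and, Set.mem_ofPred_eq] at hp ⊢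
    rw [dif_pos hp.1]
    refine ⟨rfl, lt_of_le_of_lt ?_ hp.2⟩
    exact T.1.entry_mono (hp.1.symm ▸ hij : (i : ℕ) ≤ p.1.1) le_rfl
  · intro p hp q hq h
    simp only [Finset.coe_filter, Finset.mem_univ, true_and, Set.mem_ofPred_eq] at hp hq
    simp only [dif_pos hp.1, dif_pos hq.1, Subtype.mk.injEq, Prod.mk.injEq, true_and] at h
    exact Subtype.ext (Prod.ext (hp.1.trans hq.1.symm) h)

theorem Tableaux.rowCount_word_size (i : Fin N) :
    rowCount T.word T.1.size i = T.1.shape.rowLen i := by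
  rw [T.rowCount_word le_rfl, YoungDiagram.rowLen_eq_card]
  refine Finset.card_bij (fun p _ => p.1) (fun p hp => ?_) (fun p _ q _ h => Subtype.ext h)
    fun c hc => ?_
  · rw [YoungDiagram.mem_row_iff]
    exact ⟨(YoungDiagram.mem_cells _).1 p.2, (Finset.mem_filter.1 hp).2.1⟩
  · rw [YoungDiagram.mem_row_iff] at hc
    exact ⟨⟨c, (YoungDiagram.mem_cells _).2 hc.1⟩,
      Finset.mem_filter.2 ⟨Finset.mem_univ _, hc.2, Fin.is_lt _⟩, rfl⟩

/-- Entries increase along a row, so the earlier entries of the same row are exactly those in the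
cells to the left. With columns counted from `0`, their number is the column. -/
theorem Tableaux.rowCount_word_self (k : Fin T.1.size) :
    rowCount T.word k (T.word k) = (T.1.entry.symm k).1.2 := by
  rw [T.rowCount_word k.2.le, ← Finset.card_range (T.1.entry.symm k).1.2]
  set q := T.1.entry.symm k with hq
  have hqk : T.1.entry q = k := T.1.entry.apply_symm_apply k
  have hrow : (T.word k : ℕ) = q.1.1 := T.word_val k
  refine Finset.card_bij (fun p _ => p.1.2) (fun p hp => ?_) (fun p hp p' hp' h => ?_)
    fun c hc => ?_
  · obtain ⟨-, h1, h2⟩ := Finset.mem_filter.1 hp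
    rw [Finset.mem_range]
    by_contra hlt
    have := T.1.entry_mono (p := q) (q := p) (by rw [h1, hrow]) (not_lt.1 hlt)
    rw [hqk, Fin.le_def] at this
    omega
  · exact Subtype.ext (Prod.ext
      ((Finset.mem_filter.1 hp).2.1.trans (Finset.mem_filter.1 hp').2.1.symm) h)
  · rw [Finset.mem_range] at hc
    have hmem : (q.1.1, c) ∈ T.1.shape.cells := (YoungDiagram.mem_cells _).2
      (T.1.shape.up_left_mem le_rfl hc.le ((YoungDiagram.mem_cells _).1 q.2))
    refine ⟨⟨_, hmem⟩, Finset.mem_filter.2 ⟨Finset.mem_univ _, hrow.symm, ?_⟩, rfl⟩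
    have := T.1.increasing ⟨_, hmem⟩ q le_rfl hc.le
      (fun h => hc.ne (congrArg (fun p => p.1.2) h))
    rwa [hqk] at this

theorem Tableaux.content_eq : T.1.content = fun k : Fin T.1.size => wordContent T.word k := by
  funext k
  rw [StandardTableau.content, wordContent, shiftedCount, T.rowCount_word_self, T.word_val]

/-- The first entry sits in the corner. Consequently regularity at `u` includes `u + c_i ≠ 0`, which
the collapsed rows in `rowOp` require. -/
theorem Tableaux.content_zero : T.1.content ⟨0, T.1.size_pos⟩ = 0 := by
  rw [T.content_eq]
  have : T.word 0 = ⟨0, (Nat.zero_le _).trans_lt (T.word 0).2⟩ := by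
    by_contra h
    have h1 := T.isLattice_word 1 T.1.size_pos
      ⟨0, (Nat.zero_le _).trans_lt (T.word 0).2⟩ (T.word 0) (Nat.zero_le _)
    rw [rowCount_succ, rowCount_succ, if_pos rfl, if_neg (Ne.symm h)] at h1
    simp [rowCount] at h1
  simp [wordContent, shiftedCount, rowCount, this]

theorem shapeWeight_eq_rowCount :
    shapeWeight N T.1.shape = fun i => (rowCount T.word T.1.size i : ℂ) := by
  funext i
  rw [shapeWeight, T.rowCount_word_size]

variable {V : Type*} [AddCommGroup V] [Module ℂ V] (b : Module.Basis (Fin N) ℂ V)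
include b

theorem isConsecutiveValue_tableauOp :
    IsConsecutiveValue (fun c => fusionFun V c) T.1.content (tableauOp V T.1) := by
  have h : ∃ X, IsConsecutiveValue (fun c => fusionFun V c) T.1.content X :=
    ⟨_, T.content_eq ▸ isConsecutiveValue_fusionFun b T.isLattice_word⟩
  rw [tableauOp, dif_pos h]
  exact h.choose_spec

/-- The operator `tableauOp` is a chosen consecutive value; uniqueness identifies it with the last
stage, whose image is known. -/
theorem tableauSpace_eq_jmSpace : tableauSpace V T.1 = jmSpace V id T.1.content := by
  have h : tableauOp V T.1 = fusionStage V T.1.size T.word T.1.size :=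
    IsConsecutiveValue.unique ⟨1, one_ne_zero, fun _ _ => rfl⟩ (isConsecutiveValue_tableauOp T b)
      (T.content_eq ▸ isConsecutiveValue_fusionFun b T.isLattice_word)
  rw [tableauSpace, h, range_fusionStage b T.isLattice_word, T.content_eq]

theorem exists_irrModule_equiv_tableauSpace :
    ∃ φ : IrrModule b (shapeWeight N T.1.shape) ≃ₗ[ℂ] tableauSpace V T.1,
      ∀ (g : Module.End ℂ V) (m : IrrModule b (shapeWeight N T.1.shape)),
        (φ (UniversalEnvelopingAlgebra.ι ℂ g • m) : TPow V T.1.size) =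
          glAction T.1.size g (φ m) := by
  rw [tableauSpace_eq_jmSpace T b, shapeWeight_eq_rowCount, T.content_eq]
  exact exists_irrModule_equiv_jmSpace b T.isLattice_word

end TableauWord

/-! ### Restrictions of the fused operators -/

section FusedRestriction

variable {V : Type*} [AddCommGroup V] [Module ℂ V] {n n' N : ℕ} (b : Module.Basis (Fin N) ℂ V)

theorem list_prod_intertwine {X Y K : Type*} [AddCommGroup X] [Module ℂ X] [AddCommGroup Y]
    [Module ℂ Y] {s : X →ₗ[ℂ] Y} {f : K → Module.End ℂ X} {g : K → Module.End ℂ Y} {L : List K}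
    (h : ∀ a ∈ L, s ∘ₗ f a = g a ∘ₗ s) : s ∘ₗ (L.map f).prod = (L.map g).prod ∘ₗ s := by
  induction L with
  | nil => rfl
  | cons a l ih =>
    rw [List.map_cons, List.prod_cons, List.map_cons, List.prod_cons, Module.End.mul_eq_comp,
      Module.End.mul_eq_comp, ← LinearMap.comp_assoc, h a (by simp), LinearMap.comp_assoc,
      ih fun a ha => h a (by simp [ha]), LinearMap.comp_assoc]

section Casimir

variable {X Y : Type*} [AddCommGroup X] [Module ℂ X] [AddCommGroup Y] [Module ℂ Y]

variable (n) in
/-- The mixed Casimir operator of the `i`-th copy of `V` and of a representation. -/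
def rowCasimir (i : Fin n) (ρ : Fin N → Fin N → Module.End ℂ Y) :
    Module.End ℂ (TPow V n ⊗[ℂ] Y) :=
  ∑ p, ∑ q, TensorProduct.map (opAt V i (elemGl b p q)) (ρ q p)

variable (n') in
/-- The mixed Casimir operator of a representation and of the `j`-th copy of `V`. -/
def colCasimir (j : Fin n') (σ : Fin N → Fin N → Module.End ℂ X) :
    Module.End ℂ (X ⊗[ℂ] TPow V n') :=
  ∑ p, ∑ q, TensorProduct.map (σ q p) (opAt V j (elemGl b p q))

theorem lTensor_comp_rowCasimir {Y' : Type*} [AddCommGroup Y'] [Module ℂ Y'] {s : Y →ₗ[ℂ] Y'}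
    {ρ : Fin N → Fin N → Module.End ℂ Y} {ρ' : Fin N → Fin N → Module.End ℂ Y'}
    (h : ∀ p q, s ∘ₗ ρ p q = ρ' p q ∘ₗ s) (i : Fin n) :
    s.lTensor (TPow V n) ∘ₗ rowCasimir n b i ρ = rowCasimir n b i ρ' ∘ₗ s.lTensor (TPow V n) := by
  refine LinearMap.ext fun x => ?_
  simp only [rowCasimir, LinearMap.comp_apply, LinearMap.sum_apply, map_sum]
  refine Finset.sum_congr rfl fun p _ => Finset.sum_congr rfl fun q _ => ?_
  rw [← LinearMap.comp_apply, ← LinearMap.comp_apply, LinearMap.lTensor_comp_map,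
    LinearMap.map_comp_lTensor, h]

theorem rTensor_comp_colCasimir {X' : Type*} [AddCommGroup X'] [Module ℂ X'] {s : X →ₗ[ℂ] X'}
    {σ : Fin N → Fin N → Module.End ℂ X} {σ' : Fin N → Fin N → Module.End ℂ X'}
    (h : ∀ p q, s ∘ₗ σ p q = σ' p q ∘ₗ s) (j : Fin n') :
    s.rTensor (TPow V n') ∘ₗ colCasimir n' b j σ =
      colCasimir n' b j σ' ∘ₗ s.rTensor (TPow V n') := by
  refine LinearMap.ext fun x => ?_
  simp only [colCasimir, LinearMap.comp_apply, LinearMap.sum_apply, map_sum]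
  refine Finset.sum_congr rfl fun p _ => Finset.sum_congr rfl fun q _ => ?_
  rw [← LinearMap.comp_apply, ← LinearMap.comp_apply, LinearMap.rTensor_comp_map,
    LinearMap.map_comp_rTensor, h]

/-- Summing `P_{i,j} = ∑ E_{pq} ⊗ E_{qp}` over all copies `j` of the second block leaves an operator
that uses that block only through its `gl(V)`-action. -/
theorem tmulEquiv_rowCasimir (i : Fin n) (x : TPow V n ⊗[ℂ] TPow V n') :
    PiTensorProduct.tmulEquiv ℂ V (rowCasimir n b i (tensorE b n') x) =
      ∑ j, permOp V (Sum.inr j) (Sum.inl i) (PiTensorProduct.tmulEquiv ℂ V x) := by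
  have h1 : ∀ (g : Module.End ℂ V) (x : TPow V n ⊗[ℂ] TPow V n'), PiTensorProduct.tmulEquiv ℂ V
      ((glAction n' g).lTensor _ x) =
        ∑ j, opAt V (Sum.inr j) g (PiTensorProduct.tmulEquiv ℂ V x) := by
    intro g x
    rw [glAction_eq, ← LinearMap.coe_lTensorHom, map_sum, LinearMap.sum_apply, map_sum]
    exact Finset.sum_congr rfl fun j _ => tmulEquiv_lTensor_opAt j g x
  simp only [rowCasimir, LinearMap.sum_apply, map_sum, ← LinearMap.rTensor_comp_lTensor,
    LinearMap.comp_apply, tmulEquiv_rTensor_opAt, tensorE, h1]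
  simp only [fun j : Fin n' => permOp_comm V (Sum.inr j : Fin n ⊕ Fin n') (Sum.inl i),
    permOp_eq_sum_opAt b Sum.inl_ne_inr, LinearMap.sum_apply, Module.End.mul_apply]
  symm
  rw [Finset.sum_comm]
  exact Finset.sum_congr rfl fun p _ => Finset.sum_comm

theorem tmulEquiv_colCasimir (j : Fin n') (x : TPow V n ⊗[ℂ] TPow V n') :
    PiTensorProduct.tmulEquiv ℂ V (colCasimir n' b j (tensorE b n) x) =
      ∑ i, permOp V (Sum.inl i) (Sum.inr j) (PiTensorProduct.tmulEquiv ℂ V x) := by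
  have h1 : ∀ (g : Module.End ℂ V) (x : TPow V n ⊗[ℂ] TPow V n'), PiTensorProduct.tmulEquiv ℂ V
      ((glAction n g).rTensor _ x) =
        ∑ i, opAt V (Sum.inl i) g (PiTensorProduct.tmulEquiv ℂ V x) := by
    intro g x
    rw [glAction_eq, ← LinearMap.coe_rTensorHom, map_sum, LinearMap.sum_apply, map_sum]
    exact Finset.sum_congr rfl fun j _ => tmulEquiv_rTensor_opAt j g x
  simp only [colCasimir, LinearMap.sum_apply, map_sum, ← LinearMap.lTensor_comp_rTensor,
    LinearMap.comp_apply, tmulEquiv_lTensor_opAt, tensorE, h1]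
  simp only [fun i : Fin n => permOp_comm V (Sum.inl i : Fin n ⊕ Fin n') (Sum.inr j),
    permOp_eq_sum_opAt b Sum.inr_ne_inl, LinearMap.sum_apply, Module.End.mul_apply]
  symm
  rw [Finset.sum_comm]
  exact Finset.sum_congr rfl fun p _ => Finset.sum_comm

theorem jm_inr_tmulEquiv (k : Fin n') (x : TPow V n ⊗[ℂ] TPow V n') :
    jm V (Sum.inr : Fin n' → Fin n ⊕ Fin n') k (PiTensorProduct.tmulEquiv ℂ V x) =
      PiTensorProduct.tmulEquiv ℂ V ((jm V id k).lTensor _ x) := by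
  rw [jm, jm, ← LinearMap.coe_lTensorHom, map_sum, LinearMap.sum_apply, LinearMap.sum_apply,
    map_sum]
  exact Finset.sum_congr rfl fun i _ => (tmulEquiv_lTensor_permOp i k x).symm

theorem jm_inl_tmulEquiv (k : Fin n) (x : TPow V n ⊗[ℂ] TPow V n') :
    jm V (Sum.inl : Fin n → Fin n ⊕ Fin n') k (PiTensorProduct.tmulEquiv ℂ V x) =
      PiTensorProduct.tmulEquiv ℂ V ((jm V id k).rTensor _ x) := by
  rw [jm, jm, ← LinearMap.coe_rTensorHom, map_sum, LinearMap.sum_apply, LinearMap.sum_apply,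
    map_sum]
  exact Finset.sum_congr rfl fun i _ => (tmulEquiv_rTensor_permOp i k x).symm

theorem lTensor_mem_jmSpace {c' : Fin n' → ℂ} {s : Y →ₗ[ℂ] TPow V n'}
    (hs : ∀ y, s y ∈ jmSpace V id c') (x : TPow V n ⊗[ℂ] Y) :
    PiTensorProduct.tmulEquiv ℂ V (s.lTensor (TPow V n) x) ∈
      jmSpace V (Sum.inr : Fin n' → Fin n ⊕ Fin n') c' := by
  refine mem_jmSpace.2 fun k => ?_
  have h : jm V id k ∘ₗ s = c' k • s := LinearMap.ext fun y => mem_jmSpace.1 (hs y) k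
  rw [jm_inr_tmulEquiv, ← LinearMap.lTensor_comp_apply, h, LinearMap.lTensor_smul,
    LinearMap.smul_apply, map_smul]

theorem rTensor_mem_jmSpace {c : Fin n → ℂ} {s : X →ₗ[ℂ] TPow V n}
    (hs : ∀ y, s y ∈ jmSpace V id c) (x : X ⊗[ℂ] TPow V n') :
    PiTensorProduct.tmulEquiv ℂ V (s.rTensor (TPow V n') x) ∈
      jmSpace V (Sum.inl : Fin n → Fin n ⊕ Fin n') c := by
  refine mem_jmSpace.2 fun k => ?_
  have h : jm V id k ∘ₗ s = c k • s := LinearMap.ext fun y => mem_jmSpace.1 (hs y) k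
  rw [jm_inl_tmulEquiv, ← LinearMap.rTensor_comp_apply, h, LinearMap.rTensor_smul,
    LinearMap.smul_apply, map_smul]

/-- The action of the fused operator on the tensor product of a tensor power and of a subspace of
a joint eigenspace of the Jucys--Murphy elements. -/
def rowOp (c : Fin n → ℂ) (u : ℂ) (ρ : Fin N → Fin N → Module.End ℂ Y) :
    Module.End ℂ (TPow V n ⊗[ℂ] Y) :=
  ((List.finRange n).reverse.map fun i => 1 - (u + c i)⁻¹ • rowCasimir n b i ρ).prod

/-- Up to a scalar, the inverse of the action of the fused operator on the tensor product of a
subspace of a joint eigenspace of the Jucys--Murphy elements and of a tensor power. -/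
def colOp (c' : Fin n' → ℂ) (u : ℂ) (σ : Fin N → Fin N → Module.End ℂ X) :
    Module.End ℂ (X ⊗[ℂ] TPow V n') :=
  ((List.finRange n').reverse.map fun j => 1 - (c' j - u)⁻¹ • colCasimir n' b j σ).prod

theorem lTensor_comp_rowOp {Y' : Type*} [AddCommGroup Y'] [Module ℂ Y'] {s : Y →ₗ[ℂ] Y'}
    {ρ : Fin N → Fin N → Module.End ℂ Y} {ρ' : Fin N → Fin N → Module.End ℂ Y'}
    (h : ∀ p q, s ∘ₗ ρ p q = ρ' p q ∘ₗ s) (c : Fin n → ℂ) (u : ℂ) :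
    s.lTensor (TPow V n) ∘ₗ rowOp b c u ρ = rowOp b c u ρ' ∘ₗ s.lTensor (TPow V n) := by
  refine list_prod_intertwine fun i _ => ?_
  rw [LinearMap.comp_sub, LinearMap.sub_comp, LinearMap.comp_smul, LinearMap.smul_comp,
    lTensor_comp_rowCasimir b h]
  rfl

theorem rTensor_comp_colOp {X' : Type*} [AddCommGroup X'] [Module ℂ X'] {s : X →ₗ[ℂ] X'}
    {σ : Fin N → Fin N → Module.End ℂ X} {σ' : Fin N → Fin N → Module.End ℂ X'}
    (h : ∀ p q, s ∘ₗ σ p q = σ' p q ∘ₗ s) (c' : Fin n' → ℂ) (u : ℂ) :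
    s.rTensor (TPow V n') ∘ₗ colOp b c' u σ = colOp b c' u σ' ∘ₗ s.rTensor (TPow V n') := by
  refine list_prod_intertwine fun i _ => ?_
  rw [LinearMap.comp_sub, LinearMap.sub_comp, LinearMap.comp_smul, LinearMap.smul_comp,
    rTensor_comp_colCasimir b h]
  rfl

end Casimir

variable (V) in
theorem fused_eq_rows (c : Fin n → ℂ) (c' : Fin n' → ℂ) (u : ℂ) :
    fused V c c' u = (PiTensorProduct.tmulEquiv ℂ V).symm.conjAlgEquiv ℂ
      ((List.finRange n).reverse.map fun i => ((List.finRange n').map fun j =>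
        yang V (Sum.inl i : Fin n ⊕ Fin n') (Sum.inr j) (u + c i - c' j)).prod).prod := by
  rw [fused_eq, blockProd_eq_rows (local_yang V _)
    ((List.nodup_finRange n).map Sum.inl_injective)
    ((List.nodup_finRange n').map Sum.inr_injective) (by simp)]
  simp only [← List.map_reverse, List.map_map, Function.comp_def, Sum.elim_inl, Sum.elim_inr]

variable (V) in
theorem fused_eq_list (c : Fin n → ℂ) (c' : Fin n' → ℂ) (u : ℂ) :
    fused V c c' u = (PiTensorProduct.tmulEquiv ℂ V).symm.conjAlgEquiv ℂ
      ((List.finRange n').map fun j => ((List.finRange n).reverse.map fun i =>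
        yang V (Sum.inl i : Fin n ⊕ Fin n') (Sum.inr j) (u + c i - c' j)).prod).prod := rfl

variable (V) in
/-- The product of the factors of the fused operator at the opposite parameters, in the reverse
order. -/
def fusedInv (c : Fin n → ℂ) (c' : Fin n' → ℂ) (u : ℂ) :
    Module.End ℂ (TPow V n ⊗[ℂ] TPow V n') :=
  (PiTensorProduct.tmulEquiv ℂ V).symm.conjAlgEquiv ℂ
    ((List.finRange n').reverse.map fun j => ((List.finRange n).map fun i =>
      yang V (Sum.inl i : Fin n ⊕ Fin n') (Sum.inr j) ((c' j - u) - c i)).prod).prod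

/-- The scalar by which the product of the fused operators at opposite parameters acts. -/
def fusedScalar (c : Fin n → ℂ) (c' : Fin n' → ℂ) (u : ℂ) : ℂ :=
  ∏ j, ∏ i, (1 - ((u + c i - c' j) ^ 2)⁻¹)

theorem fused_mul_fusedInv (c : Fin n → ℂ) (c' : Fin n' → ℂ) (u : ℂ) :
    fused V c c' u * fusedInv V c c' u = fusedScalar c c' u • 1 := by
  have h := list_prod_reverse_mul (A := Module.End ℂ (⨂[ℂ] _ : Fin n ⊕ Fin n', V))
    (List.finRange n').reverse
    (fun j => ((List.finRange n).reverse.map fun i =>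
      yang V (Sum.inl i : Fin n ⊕ Fin n') (Sum.inr j) (u + c i - c' j)).prod)
    (fun j => ((List.finRange n).map fun i =>
      yang V (Sum.inl i : Fin n ⊕ Fin n') (Sum.inr j) ((c' j - u) - c i)).prod)
    (fun j => ((List.finRange n).map fun i => 1 - ((u + c i - c' j) ^ 2)⁻¹).prod)
    fun j _ => list_prod_reverse_mul _ _ _ _ fun i _ => by
      rw [← yang_mul_yang_neg, show -(u + c i - c' j) = c' j - u - c i by ring]
  rw [List.reverse_reverse, ((List.reverse_perm _).map _).prod_eq] at h
  simp only [← Fin.prod_univ_def] at h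
  rw [fused_eq_list, fusedInv, ← map_mul, h, map_smul, map_one, fusedScalar]

/-- Row `i` has its factors in ascending order of `j`, so `prod_yang_apply` collapses it to `1 - (u
+ c_i)⁻¹ ∑_j P_{i,j}`. The Casimir operator maps `V^{⊗n} ⊗ Y` to itself, which allows one row after
another to be collapsed. -/
theorem lTensor_comp_rowOp_eq_fused {Y : Type*} [AddCommGroup Y] [Module ℂ Y] {c : Fin n → ℂ}
    {c' : Fin n' → ℂ} {u : ℂ} (hu : ∀ i j, u + c i - c' j ≠ 0) (hu' : ∀ i, u + c i ≠ 0)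
    {s : Y →ₗ[ℂ] TPow V n'} {ρ : Fin N → Fin N → Module.End ℂ Y}
    (hρ : ∀ p q, s ∘ₗ ρ p q = tensorE b n' p q ∘ₗ s) (hs : ∀ y, s y ∈ jmSpace V id c') :
    s.lTensor (TPow V n) ∘ₗ rowOp b c u ρ = fused V c c' u ∘ₗ s.lTensor (TPow V n) := by
  have h : ((PiTensorProduct.tmulEquiv ℂ V).toLinearMap ∘ₗ s.lTensor (TPow V n)) ∘ₗ
      rowOp b c u ρ = ((List.finRange n).reverse.map fun i => ((List.finRange n').map fun j =>
        yang V (Sum.inl i : Fin n ⊕ Fin n') (Sum.inr j) (u + c i - c' j)).prod).prod ∘ₗ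
      ((PiTensorProduct.tmulEquiv ℂ V).toLinearMap ∘ₗ s.lTensor (TPow V n)) := by
    refine list_prod_intertwine fun i _ => LinearMap.ext fun x => ?_
    have e : s.lTensor (TPow V n) (rowCasimir n b i ρ x) =
        rowCasimir n b i (tensorE b n') (s.lTensor (TPow V n) x) :=
      LinearMap.congr_fun (lTensor_comp_rowCasimir b hρ i) x
    simp only [LinearMap.comp_apply, LinearEquiv.coe_coe]
    simp only [yang_comm V (Sum.inl i) (Sum.inr _)]
    rw [prod_yang_apply Sum.inr_injective (fun _ => Sum.inr_ne_inl) (lTensor_mem_jmSpace hs x)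
      (hu' i) (hu i), ← tmulEquiv_rowCasimir b, LinearMap.sub_apply, LinearMap.smul_apply, map_sub,
      map_sub, map_smul, map_smul, e]
    rfl
  rw [fused_eq_rows]
  refine LinearMap.ext fun x => (PiTensorProduct.tmulEquiv ℂ V).injective ?_
  refine (LinearMap.congr_fun h x).trans ?_
  exact ((PiTensorProduct.tmulEquiv ℂ V).apply_symm_apply _).symm

/-- The columns of the fused operator run over `i` in descending order, which is the wrong order for
the collapse. The inverse, with ascending columns and opposite parameters, has the right one. -/
theorem rTensor_comp_colOp_eq_fusedInv {X : Type*} [AddCommGroup X] [Module ℂ X] {c : Fin n → ℂ}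
    {c' : Fin n' → ℂ} {u : ℂ} (hu : ∀ i j, u + c i - c' j ≠ 0) (hu' : ∀ j, c' j - u ≠ 0)
    {s : X →ₗ[ℂ] TPow V n} {σ : Fin N → Fin N → Module.End ℂ X}
    (hσ : ∀ p q, s ∘ₗ σ p q = tensorE b n p q ∘ₗ s) (hs : ∀ y, s y ∈ jmSpace V id c) :
    s.rTensor (TPow V n') ∘ₗ colOp b c' u σ = fusedInv V c c' u ∘ₗ s.rTensor (TPow V n') := by
  have h : ((PiTensorProduct.tmulEquiv ℂ V).toLinearMap ∘ₗ s.rTensor (TPow V n')) ∘ₗ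
      colOp b c' u σ = ((List.finRange n').reverse.map fun j => ((List.finRange n).map fun i =>
        yang V (Sum.inl i : Fin n ⊕ Fin n') (Sum.inr j) ((c' j - u) - c i)).prod).prod ∘ₗ
      ((PiTensorProduct.tmulEquiv ℂ V).toLinearMap ∘ₗ s.rTensor (TPow V n')) := by
    refine list_prod_intertwine fun j _ => LinearMap.ext fun x => ?_
    have e : s.rTensor (TPow V n') (colCasimir n' b j σ x) =
        colCasimir n' b j (tensorE b n) (s.rTensor (TPow V n') x) :=
      LinearMap.congr_fun (rTensor_comp_colCasimir b hσ j) x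
    simp only [LinearMap.comp_apply, LinearEquiv.coe_coe]
    rw [prod_yang_apply Sum.inl_injective (fun _ => Sum.inl_ne_inr) (rTensor_mem_jmSpace hs x)
      (hu' j) (fun i h => hu i j (by linear_combination -h)), ← tmulEquiv_colCasimir b,
      LinearMap.sub_apply, LinearMap.smul_apply, map_sub,
      map_sub, map_smul, map_smul, e]
    rfl
  refine LinearMap.ext fun x => (PiTensorProduct.tmulEquiv ℂ V).injective ?_
  refine (LinearMap.congr_fun h x).trans ?_
  exact ((PiTensorProduct.tmulEquiv ℂ V).apply_symm_apply _).symm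

end FusedRestriction

/-! ### Compression of the fused operators to subrepresentations. -/

section Restriction

variable {V : Type*} [AddCommGroup V] [Module ℂ V] {n n' N : ℕ} (b : Module.Basis (Fin N) ℂ V)

/-- Serves to pass from generic spectral parameters, where the fused operator is invertible, to all
regular ones. -/
theorem eq_of_eventually_punctured {E : Type*} [AddCommGroup E] [Module ℂ E] {f g : ℂ → E} {u : ℂ}
    (hf : ∀ l : Module.Dual ℂ E, ContinuousAt (fun z => l (f z)) u)
    (hg : ∀ l : Module.Dual ℂ E, ContinuousAt (fun z => l (g z)) u)
    (h : ∀ᶠ z in 𝓝[≠] u, f z = g z) : f u = g u := by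
  rw [← sub_eq_zero, ← Module.forall_dual_apply_eq_zero_iff ℂ]
  intro l
  rw [map_sub, sub_eq_zero]
  refine tendsto_nhds_unique (f := fun z => l (f z)) (l := 𝓝[≠] u)
    ((hf l).tendsto.mono_left nhdsWithin_le_nhds) ?_
  refine ((hg l).tendsto.mono_left nhdsWithin_le_nhds).congr' ?_
  filter_upwards [h] with z hz
  rw [hz]

theorem weakContinuousAt_fused {c : Fin n → ℂ} {c' : Fin n' → ℂ} {u : ℂ}
    (hu : ∀ i j, u + c i - c' j ≠ 0) : WeakContinuousAt (fun z => fused V c c' z) u := by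
  have h : WeakContinuousAt (fun z => ((List.finRange n').map fun j =>
      ((List.finRange n).reverse.map fun i =>
        yang V (Sum.inl i : Fin n ⊕ Fin n') (Sum.inr j) (z + c i - c' j)).prod).prod) u := by
    refine (weakMultiplierAt_list_prod fun j _ => ?_).weakContinuousAt
    refine weakMultiplierAt_list_prod fun i _ => weakMultiplierAt_one_sub_smul ?_ _
    exact ContinuousAt.inv₀ (by fun_prop) (hu i j)
  intro l
  have h1 := h (l ∘ₗ
    ((PiTensorProduct.tmulEquiv ℂ V).symm.conjAlgEquiv ℂ).toAlgHom.toLinearMap)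
  simp only [fused_eq_list]
  exact h1

theorem eventually_fusedScalar_ne_zero (c : Fin n → ℂ) (c' : Fin n' → ℂ) (u : ℂ) :
    ∀ᶠ z in 𝓝[≠] u, fusedScalar c c' z ≠ 0 ∧ (∀ i j, z + c i - c' j ≠ 0) ∧
      ∀ j, c' j - z ≠ 0 := by
  filter_upwards [
    Filter.eventually_all.2 fun i => Filter.eventually_all.2 fun j =>
      eventually_ne_punctured u (c' j - c i),
    Filter.eventually_all.2 fun i => Filter.eventually_all.2 fun j =>
      eventually_ne_punctured u (1 + c' j - c i),
    Filter.eventually_all.2 fun i => Filter.eventually_all.2 fun j =>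
      eventually_ne_punctured u (-1 + c' j - c i),
    Filter.eventually_all.2 fun j => eventually_ne_punctured u (c' j)] with z h1 h2 h3 h4
  refine ⟨?_, fun i j h => h1 i j (by linear_combination h), fun j h => h4 j
    (by linear_combination -h)⟩
  refine Finset.prod_ne_zero_iff.2 fun j _ => Finset.prod_ne_zero_iff.2 fun i _ h => ?_
  rw [sub_eq_zero, eq_comm, inv_eq_one, sq_eq_one_iff] at h
  rcases h with h | h
  · exact h2 i j (by linear_combination h)
  · exact h3 i j (by linear_combination h)

variable {X Y : Type*} [AddCommGroup X] [Module ℂ X] [AddCommGroup Y] [Module ℂ Y]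

/-- `s` is the inclusion, with retraction `π`, of a representation of `gl(V)` in the joint
eigenspace of the Jucys--Murphy elements, the matrix units acting by `σ`. -/
structure IsJMSubrep (c : Fin n → ℂ) (s : X →ₗ[ℂ] TPow V n) (π : TPow V n →ₗ[ℂ] X)
    (σ : Fin N → Fin N → Module.End ℂ X) : Prop where
  retract : π ∘ₗ s = LinearMap.id
  comm : ∀ p q, s ∘ₗ σ p q = tensorE b n p q ∘ₗ s
  mem : ∀ x, s x ∈ jmSpace V id c

/-- The compression of the fused operator to a subspace of the first factor. -/
def leftRes (s : X →ₗ[ℂ] TPow V n) (π : TPow V n →ₗ[ℂ] X) (c : Fin n → ℂ) (c' : Fin n' → ℂ)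
    (u : ℂ) : Module.End ℂ (X ⊗[ℂ] TPow V n') :=
  π.rTensor _ ∘ₗ fused V c c' u ∘ₗ s.rTensor _

/-- The compression of the fused operator to subspaces of both factors. -/
def resOp (s : X →ₗ[ℂ] TPow V n) (π : TPow V n →ₗ[ℂ] X) (s' : Y →ₗ[ℂ] TPow V n')
    (π' : TPow V n' →ₗ[ℂ] Y) (c : Fin n → ℂ) (c' : Fin n' → ℂ) (u : ℂ) :
    Module.End ℂ (X ⊗[ℂ] Y) :=
  TensorProduct.map π π' ∘ₗ fused V c c' u ∘ₗ TensorProduct.map s s'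

theorem weakContinuousAt_leftRes {s : X →ₗ[ℂ] TPow V n} {π : TPow V n →ₗ[ℂ] X} {c : Fin n → ℂ}
    {c' : Fin n' → ℂ} {u : ℂ} (hu : ∀ i j, u + c i - c' j ≠ 0) {Z W : Type*} [AddCommGroup Z]
    [Module ℂ Z] [AddCommGroup W] [Module ℂ W] (f : X ⊗[ℂ] TPow V n' →ₗ[ℂ] Z)
    (g : W →ₗ[ℂ] X ⊗[ℂ] TPow V n') (l : Module.Dual ℂ (W →ₗ[ℂ] Z)) :
    ContinuousAt (fun z => l (f ∘ₗ leftRes s π c c' z ∘ₗ g)) u :=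
  weakContinuousAt_fused hu (l ∘ₗ LinearMap.lcomp ℂ _ g ∘ₗ LinearMap.llcomp ℂ _ _ _ f ∘ₗ
    LinearMap.lcomp ℂ _ (s.rTensor _) ∘ₗ LinearMap.llcomp ℂ _ _ _ (π.rTensor _))

variable {b} {c : Fin n → ℂ} {c' : Fin n' → ℂ} {u : ℂ} {s : X →ₗ[ℂ] TPow V n}
  {π : TPow V n →ₗ[ℂ] X} {σ : Fin N → Fin N → Module.End ℂ X} {s' : Y →ₗ[ℂ] TPow V n'}
  {π' : TPow V n' →ₗ[ℂ] Y} {ρ : Fin N → Fin N → Module.End ℂ Y}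

theorem IsJMSubrep.leftRes_mul_colOp (h : IsJMSubrep b c s π σ)
    (hu : ∀ i j, u + c i - c' j ≠ 0) (hu' : ∀ j, c' j - u ≠ 0) :
    leftRes s π c c' u * colOp b c' u σ = fusedScalar c c' u • 1 := by
  have h1 := rTensor_comp_colOp_eq_fusedInv b hu hu' h.comm h.mem
  have h2 : π.rTensor (TPow V n') ∘ₗ s.rTensor (TPow V n') = LinearMap.id := by
    rw [← LinearMap.rTensor_comp, h.retract, LinearMap.rTensor_id]
  calc _ = π.rTensor (TPow V n') ∘ₗ fused V c c' u ∘ₗ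
        (s.rTensor (TPow V n') ∘ₗ colOp b c' u σ) := rfl
    _ = π.rTensor (TPow V n') ∘ₗ (fused V c c' u * fusedInv V c c' u) ∘ₗ
        s.rTensor (TPow V n') := by rw [h1]; rfl
    _ = fusedScalar c c' u • (π.rTensor (TPow V n') ∘ₗ s.rTensor (TPow V n')) := by
        rw [fused_mul_fusedInv, LinearMap.smul_comp, LinearMap.comp_smul]; rfl
    _ = _ := by rw [h2]; rfl

/-- In finite dimension the one-sided inverse of `leftRes_mul_colOp` is two-sided as soon as the
scalar is non-zero. -/
theorem IsJMSubrep.colOp_mul_leftRes [FiniteDimensional ℂ (X ⊗[ℂ] TPow V n')]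
    (h : IsJMSubrep b c s π σ)
    (hu : ∀ i j, u + c i - c' j ≠ 0) (hu' : ∀ j, c' j - u ≠ 0) (hκ : fusedScalar c c' u ≠ 0) :
    colOp b c' u σ * leftRes s π c c' u = fusedScalar c c' u • 1 := by
  have h1 : ((fusedScalar c c' u)⁻¹ • leftRes s π c c' u) * colOp b c' u σ = 1 := by
    rw [smul_mul_assoc, h.leftRes_mul_colOp hu hu', inv_smul_smul₀ hκ]
  rw [mul_eq_one_comm, mul_smul_comm] at h1
  rw [← h1, smul_inv_smul₀ hκ]

/-- For generic parameters the inverse operator preserves `X ⊗ V^{⊗n'}` and is invertible on it, so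
the fused operator preserves it too. Continuity covers the remaining regular parameters. -/
theorem IsJMSubrep.rTensor_comp_leftRes [FiniteDimensional ℂ (X ⊗[ℂ] TPow V n')]
    (h : IsJMSubrep b c s π σ) (hu : ∀ i j, u + c i - c' j ≠ 0) :
    s.rTensor _ ∘ₗ leftRes s π c c' u = fused V c c' u ∘ₗ s.rTensor _ := by
  refine eq_of_eventually_punctured
    (f := fun z => s.rTensor (TPow V n') ∘ₗ leftRes s π c c' z)
    (g := fun z => fused V c c' z ∘ₗ s.rTensor (TPow V n'))
    (weakContinuousAt_leftRes hu _ LinearMap.id)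
    (fun l => weakContinuousAt_fused hu (l ∘ₗ LinearMap.lcomp ℂ _ (s.rTensor _))) ?_
  filter_upwards [eventually_fusedScalar_ne_zero c c' u] with z ⟨hκ, hz, hz'⟩
  have h1 := rTensor_comp_colOp_eq_fusedInv b hz hz' h.comm h.mem
  have h2 := h.colOp_mul_leftRes hz hz' hκ
  have h3 : fusedScalar c c' z • (fused V c c' z ∘ₗ s.rTensor (TPow V n')) =
      fusedScalar c c' z • (s.rTensor (TPow V n') ∘ₗ leftRes s π c c' z) := by
    calc _ = fused V c c' z ∘ₗ s.rTensor (TPow V n') ∘ₗ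
          (colOp b c' z σ * leftRes s π c c' z) := by
          rw [h2, LinearMap.comp_smul, LinearMap.comp_smul]; rfl
      _ = (fused V c c' z * fusedInv V c c' z) ∘ₗ s.rTensor _ ∘ₗ leftRes s π c c' z := by
          change fused V c c' z ∘ₗ (s.rTensor (TPow V n') ∘ₗ colOp b c' z σ) ∘ₗ
            leftRes s π c c' z = _
          rw [h1]
          rfl
      _ = _ := by rw [fused_mul_fusedInv, LinearMap.smul_comp]; rfl
  exact (smul_right_injective _ hκ h3).symm

/-- An intertwiner commutes with `colOp`, which depends only on the representation and on `c'`. Its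
inverse involves in addition the scalar, in which `c` matters only up to a permutation; this is the
role of `e`. -/
theorem IsJMSubrep.leftRes_natural [FiniteDimensional ℂ (X ⊗[ℂ] TPow V n')] {n₂ : ℕ} {X₂ : Type*}
    [AddCommGroup X₂] [Module ℂ X₂] {c₂ : Fin n₂ → ℂ} {s₂ : X₂ →ₗ[ℂ] TPow V n₂}
    {π₂ : TPow V n₂ →ₗ[ℂ] X₂} {σ₂ : Fin N → Fin N → Module.End ℂ X₂}
    (h : IsJMSubrep b c s π σ) (h₂ : IsJMSubrep b c₂ s₂ π₂ σ₂) (e : Fin n ≃ Fin n₂)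
    (he : ∀ i, c₂ (e i) = c i) {α : X →ₗ[ℂ] X₂} (hα : ∀ p q, α ∘ₗ σ p q = σ₂ p q ∘ₗ α)
    (hu : ∀ i j, u + c i - c' j ≠ 0) :
    α.rTensor _ ∘ₗ leftRes s π c c' u = leftRes s₂ π₂ c₂ c' u ∘ₗ α.rTensor _ := by
  have hreg : ∀ {z}, (∀ i j, z + c i - c' j ≠ 0) → ∀ i j, z + c₂ i - c' j ≠ 0 := by
    intro z hz i j
    rw [← e.apply_symm_apply i, he]
    exact hz _ _
  have hscal : ∀ z, fusedScalar c₂ c' z = fusedScalar c c' z := by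
    intro z
    refine Finset.prod_congr rfl fun j _ => ?_
    rw [← e.prod_comp]
    simp only [he]
  refine eq_of_eventually_punctured
    (f := fun z => α.rTensor (TPow V n') ∘ₗ leftRes s π c c' z)
    (g := fun z => leftRes s₂ π₂ c₂ c' z ∘ₗ α.rTensor (TPow V n'))
    (weakContinuousAt_leftRes hu _ LinearMap.id)
    (weakContinuousAt_leftRes (hreg hu) LinearMap.id _) ?_
  filter_upwards [eventually_fusedScalar_ne_zero c c' u] with z ⟨hκ, hz, hz'⟩
  have h1 := h₂.leftRes_mul_colOp (hreg hz) hz'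
  have h2 := h.colOp_mul_leftRes hz hz' hκ
  have h3 := rTensor_comp_colOp b hα c' z
  rw [hscal] at h1
  refine smul_right_injective _ hκ ?_
  change fusedScalar c c' z • (α.rTensor (TPow V n') ∘ₗ leftRes s π c c' z) =
    fusedScalar c c' z • (leftRes s₂ π₂ c₂ c' z ∘ₗ α.rTensor (TPow V n'))
  calc _ = (fusedScalar c c' z • (1 : Module.End ℂ (X₂ ⊗[ℂ] TPow V n'))) ∘ₗ
        α.rTensor (TPow V n') ∘ₗ leftRes s π c c' z := by rw [LinearMap.smul_comp]; rfl
    _ = leftRes s₂ π₂ c₂ c' z ∘ₗ (colOp b c' z σ₂ ∘ₗ α.rTensor (TPow V n')) ∘ₗ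
        leftRes s π c c' z := by rw [← h1]; rfl
    _ = leftRes s₂ π₂ c₂ c' z ∘ₗ α.rTensor (TPow V n') ∘ₗ
        (colOp b c' z σ * leftRes s π c c' z) := by rw [← h3]; rfl
    _ = _ := by rw [h2, LinearMap.comp_smul, LinearMap.comp_smul]; rfl

theorem IsJMSubrep.lTensor_comp_fused (h' : IsJMSubrep b c' s' π' ρ)
    (hu : ∀ i j, u + c i - c' j ≠ 0) (hu' : ∀ i, u + c i ≠ 0) :
    π'.lTensor _ ∘ₗ fused V c c' u ∘ₗ s'.lTensor _ = rowOp b c u ρ := by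
  rw [← lTensor_comp_rowOp_eq_fused b hu hu' h'.comm h'.mem, ← LinearMap.comp_assoc,
    ← LinearMap.lTensor_comp, h'.retract, LinearMap.lTensor_id, LinearMap.id_comp]

theorem resOp_eq_left : resOp s π s' π' c c' u =
    π'.lTensor _ ∘ₗ leftRes s π c c' u ∘ₗ s'.lTensor _ := by
  rw [resOp, leftRes, ← LinearMap.lTensor_comp_rTensor, ← LinearMap.rTensor_comp_lTensor]
  rfl

theorem IsJMSubrep.resOp_eq_right (h' : IsJMSubrep b c' s' π' ρ)
    (hu : ∀ i j, u + c i - c' j ≠ 0) (hu' : ∀ i, u + c i ≠ 0) :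
    resOp s π s' π' c c' u = π.rTensor _ ∘ₗ rowOp b c u ρ ∘ₗ s.rTensor _ := by
  rw [← h'.lTensor_comp_fused hu hu', resOp, ← LinearMap.rTensor_comp_lTensor,
    ← LinearMap.lTensor_comp_rTensor]
  rfl

theorem IsJMSubrep.map_comp_resOp [FiniteDimensional ℂ (X ⊗[ℂ] TPow V n')]
    (h : IsJMSubrep b c s π σ) (h' : IsJMSubrep b c' s' π' ρ)
    (hu : ∀ i j, u + c i - c' j ≠ 0) (hu' : ∀ i, u + c i ≠ 0) :
    TensorProduct.map s s' ∘ₗ resOp s π s' π' c c' u =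
      fused V c c' u ∘ₗ TensorProduct.map s s' := by
  have h1 := h.rTensor_comp_leftRes hu
  have h2 := lTensor_comp_rowOp_eq_fused b hu hu' h'.comm h'.mem
  rw [← h'.lTensor_comp_fused hu hu'] at h2
  refine LinearMap.ext fun x => ?_
  set F := fused V c c' u (TensorProduct.map s s' x) with hF
  -- `F` lies in both `X ⊗ V^{⊗n'}` and `V^{⊗n} ⊗ Y`, so neither retraction changes it.
  have h3 : s.rTensor _ (π.rTensor _ F) = F := by
    have := LinearMap.congr_fun h1 (s'.lTensor _ x)
    rw [hF, ← LinearMap.rTensor_comp_lTensor]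
    exact this
  have h4 : s'.lTensor _ (π'.lTensor _ F) = F := by
    have := LinearMap.congr_fun h2 (s.rTensor _ x)
    rw [hF, ← LinearMap.lTensor_comp_rTensor]
    exact this
  change TensorProduct.map s s' (TensorProduct.map π π' F) = F
  rw [← LinearMap.comp_apply, ← TensorProduct.map_comp, ← LinearMap.rTensor_comp_lTensor,
    LinearMap.comp_apply, LinearMap.lTensor_comp, LinearMap.comp_apply, h4, LinearMap.rTensor_comp,
    LinearMap.comp_apply, h3]

theorem IsJMSubrep.resOp_natural_left [FiniteDimensional ℂ (X ⊗[ℂ] TPow V n')] {n₂ : ℕ}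
    {X₂ : Type*} [AddCommGroup X₂] [Module ℂ X₂] {c₂ : Fin n₂ → ℂ} {s₂ : X₂ →ₗ[ℂ] TPow V n₂}
    {π₂ : TPow V n₂ →ₗ[ℂ] X₂} {σ₂ : Fin N → Fin N → Module.End ℂ X₂}
    (h : IsJMSubrep b c s π σ) (h₂ : IsJMSubrep b c₂ s₂ π₂ σ₂) (e : Fin n ≃ Fin n₂)
    (he : ∀ i, c₂ (e i) = c i) {α : X →ₗ[ℂ] X₂} (hα : ∀ p q, α ∘ₗ σ p q = σ₂ p q ∘ₗ α)
    (hu : ∀ i j, u + c i - c' j ≠ 0) :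
    α.rTensor Y ∘ₗ resOp s π s' π' c c' u = resOp s₂ π₂ s' π' c₂ c' u ∘ₗ α.rTensor Y := by
  have h1 := h.leftRes_natural h₂ e he hα hu
  rw [resOp_eq_left, resOp_eq_left, ← LinearMap.comp_assoc, LinearMap.rTensor_comp_lTensor,
    ← LinearMap.lTensor_comp_rTensor, LinearMap.comp_assoc, ← LinearMap.comp_assoc _ _
    (LinearMap.rTensor _ α), h1, LinearMap.comp_assoc, LinearMap.comp_assoc, LinearMap.comp_assoc,
    LinearMap.rTensor_comp_lTensor, LinearMap.lTensor_comp_rTensor]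

/-- On this side no inversion is needed: `rowOp` itself depends only on `u`, on `c` and on the
representation. -/
theorem IsJMSubrep.resOp_natural_right {n₂ : ℕ} {Y₂ : Type*} [AddCommGroup Y₂] [Module ℂ Y₂]
    {c₂ : Fin n₂ → ℂ} {s₂ : Y₂ →ₗ[ℂ] TPow V n₂} {π₂ : TPow V n₂ →ₗ[ℂ] Y₂}
    {ρ₂ : Fin N → Fin N → Module.End ℂ Y₂} (h' : IsJMSubrep b c' s' π' ρ)
    (h₂ : IsJMSubrep b c₂ s₂ π₂ ρ₂) {β : Y →ₗ[ℂ] Y₂} (hβ : ∀ p q, β ∘ₗ ρ p q = ρ₂ p q ∘ₗ β)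
    (hu : ∀ i j, u + c i - c' j ≠ 0) (hu₂ : ∀ i j, u + c i - c₂ j ≠ 0)
    (hu' : ∀ i, u + c i ≠ 0) :
    β.lTensor X ∘ₗ resOp s π s' π' c c' u = resOp s π s₂ π₂ c c₂ u ∘ₗ β.lTensor X := by
  have h1 := lTensor_comp_rowOp b hβ c u
  rw [h'.resOp_eq_right hu hu', h₂.resOp_eq_right hu₂ hu', ← LinearMap.comp_assoc,
    LinearMap.lTensor_comp_rTensor, ← LinearMap.rTensor_comp_lTensor, LinearMap.comp_assoc,
    ← LinearMap.comp_assoc _ _ (LinearMap.lTensor _ β), h1, LinearMap.comp_assoc,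
    LinearMap.comp_assoc, LinearMap.comp_assoc, LinearMap.rTensor_comp_lTensor,
    LinearMap.lTensor_comp_rTensor]

end Restriction

/-! ### The restrictions attached to tableaux. -/

section TableauRestriction

variable {V : Type*} [AddCommGroup V] [Module ℂ V] {N : ℕ} (b : Module.Basis (Fin N) ℂ V)

include b in
theorem glAction_mem_tableauSpace (T : Tableaux N) (g : Module.End ℂ V) :
    ∀ f ∈ tableauSpace V T.1, glAction T.1.size g f ∈ tableauSpace V T.1 := by
  obtain ⟨φ, hφ⟩ := exists_irrModule_equiv_tableauSpace T b
  intro f hf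
  have := hφ g (φ.symm ⟨f, hf⟩)
  rw [φ.apply_symm_apply] at this
  rw [← this]
  exact Subtype.mem _

/-- The action of the matrix units on the space attached to a tableau. -/
def tableauRep (T : Tableaux N) (p q : Fin N) : Module.End ℂ (tableauSpace V T.1) :=
  (tensorE b T.1.size p q).restrict (glAction_mem_tableauSpace b T _)

variable (V) in
theorem exists_retraction (T : StandardTableau) :
    ∃ π : TPow V T.size →ₗ[ℂ] tableauSpace V T,
      π ∘ₗ (tableauSpace V T).subtype = LinearMap.id :=
  LinearMap.exists_leftInverse_of_injective _ (Submodule.ker_subtype _)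

variable (V) in
/-- A linear retraction on the space attached to a tableau. -/
def tableauRetraction (T : StandardTableau) : TPow V T.size →ₗ[ℂ] tableauSpace V T :=
  (exists_retraction V T).choose

variable (V) in
theorem tableauRetraction_comp (T : StandardTableau) :
    tableauRetraction V T ∘ₗ (tableauSpace V T).subtype = LinearMap.id :=
  (exists_retraction V T).choose_spec

theorem isJMSubrep_tableauSpace (T : Tableaux N) :
    IsJMSubrep b T.1.content (tableauSpace V T.1).subtype (tableauRetraction V T.1)
      (tableauRep b T) where
  retract := tableauRetraction_comp V T.1
  comm _ _ := rfl
  mem x := by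
    rw [← tableauSpace_eq_jmSpace T b]
    exact x.2

variable (V) in
/-- The compression of the fused operator to the spaces attached to two tableaux. -/
def tableauRes (T T' : StandardTableau) (u : ℂ) :
    Module.End ℂ (tableauSpace V T ⊗[ℂ] tableauSpace V T') :=
  resOp (tableauSpace V T).subtype (tableauRetraction V T) (tableauSpace V T').subtype
    (tableauRetraction V T') T.content T'.content u

theorem add_content_ne_zero {T T' : Tableaux N} {u : ℂ} (hu : u ∈ regular T.1 T'.1) (i) :
    u + T.1.content i ≠ 0 := by
  have := hu i ⟨0, T'.1.size_pos⟩
  rwa [T'.content_zero, sub_zero] at this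

include b in
theorem incl_comp_tableauRes {T T' : Tableaux N} {u : ℂ} (hu : u ∈ regular T.1 T'.1) :
    incl V T.1 T'.1 ∘ₗ tableauRes V T.1 T'.1 u =
      fused V T.1.content T'.1.content u ∘ₗ incl V T.1 T'.1 := by
  have : FiniteDimensional ℂ V := b.finiteDimensional_of_finite
  exact (isJMSubrep_tableauSpace b T).map_comp_resOp (isJMSubrep_tableauSpace b T') hu
    (add_content_ne_zero hu)

include b in
theorem incl_comp_fusedRes {T T' : Tableaux N} {u : ℂ} (hu : u ∈ regular T.1 T'.1) :
    incl V T.1 T'.1 ∘ₗ fusedRes V T.1 T'.1 u =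
      fused V T.1.content T'.1.content u ∘ₗ incl V T.1 T'.1 := by
  have h : ∃ A : Module.End ℂ (tableauSpace V T.1 ⊗[ℂ] tableauSpace V T'.1),
      incl V T.1 T'.1 ∘ₗ A = fused V T.1.content T'.1.content u ∘ₗ incl V T.1 T'.1 :=
    ⟨_, incl_comp_tableauRes b hu⟩
  rw [fusedRes, dif_pos h]
  exact h.choose_spec

include b in
theorem fusedRes_eq_tableauRes {T T' : Tableaux N} {u : ℂ} (hu : u ∈ regular T.1 T'.1) :
    fusedRes V T.1 T'.1 u = tableauRes V T.1 T'.1 u := by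
  have h : TensorProduct.map (tableauRetraction V T.1) (tableauRetraction V T'.1) ∘ₗ
      incl V T.1 T'.1 = LinearMap.id := by
    rw [incl, ← TensorProduct.map_comp, tableauRetraction_comp, tableauRetraction_comp,
      TensorProduct.map_id]
  rw [tableauRes, resOp, ← incl, ← incl_comp_fusedRes b hu, ← LinearMap.comp_assoc, h,
    LinearMap.id_comp]

include b in
theorem isYangBaxterFamily_fusedRes :
    IsYangBaxterFamily (fun T : Tableaux N => tableauSpace V T.1)
      (fun T T' => regular T.1 T'.1) (fun T T' => fusedRes V T.1 T'.1) := by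
  intro T T' T'' u v hu huv hv
  set s := TensorProduct.map (TensorProduct.map (tableauSpace V T.1).subtype
    (tableauSpace V T'.1).subtype) (tableauSpace V T''.1).subtype with hs
  set π := TensorProduct.map (TensorProduct.map (tableauRetraction V T.1)
    (tableauRetraction V T'.1)) (tableauRetraction V T''.1) with hπ
  have hr : π ∘ₗ s = LinearMap.id := by
    rw [hs, hπ, ← TensorProduct.map_comp, ← TensorProduct.map_comp, tableauRetraction_comp,
      tableauRetraction_comp, tableauRetraction_comp, TensorProduct.map_id, TensorProduct.map_id]
  have h12 := map_leg12 (tableauSpace V T.1).subtype (tableauSpace V T'.1).subtype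
    (tableauSpace V T''.1).subtype (incl_comp_fusedRes b hu)
  have h13 := map_leg13 (tableauSpace V T.1).subtype (tableauSpace V T'.1).subtype
    (tableauSpace V T''.1).subtype (incl_comp_fusedRes b huv)
  have h23 := map_leg23 (tableauSpace V T.1).subtype (tableauSpace V T'.1).subtype
    (tableauSpace V T''.1).subtype (incl_comp_fusedRes b hv)
  rw [← hs] at h12 h13 h23
  have h := fused_yangBaxter V hu hv huv
  -- Since `s` has the retraction `π`, a product of restrictions is recovered from the product on
  -- the full tensor powers.
  have key : ∀ {A B C : Module.End ℂ ((tableauSpace V T.1 ⊗[ℂ] tableauSpace V T'.1) ⊗[ℂ]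
      tableauSpace V T''.1)} {A' B' C' : Module.End ℂ ((TPow V T.1.size ⊗[ℂ] TPow V T'.1.size)
        ⊗[ℂ] TPow V T''.1.size)}, s ∘ₗ A = A' ∘ₗ s → s ∘ₗ B = B' ∘ₗ s → s ∘ₗ C = C' ∘ₗ s →
      A * B * C = π ∘ₗ (A' * B' * C') ∘ₗ s := by
    intro A B C A' B' C' hA hB hC
    have : s ∘ₗ (A * B * C) = (A' * B' * C') ∘ₗ s := by
      calc _ = (s ∘ₗ A) ∘ₗ B ∘ₗ C := rfl
        _ = A' ∘ₗ (s ∘ₗ B) ∘ₗ C := by rw [hA]; rfl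
        _ = A' ∘ₗ B' ∘ₗ (s ∘ₗ C) := by rw [hB]; rfl
        _ = _ := by rw [hC]; rfl
    rw [← this, ← LinearMap.comp_assoc, hr, LinearMap.id_comp]
  exact (key h12 h13 h23).trans ((congrArg (fun F => π ∘ₗ F ∘ₗ s) h).trans
    (key h23 h13 h12).symm)

theorem exists_equiv_content {T S : StandardTableau} (h : T.shape = S.shape) :
    ∃ e : Fin T.size ≃ Fin S.size, ∀ i, S.content (e i) = T.content i := by
  obtain ⟨n, _, μ, e, _⟩ := T
  obtain ⟨n', _, μ', e', _⟩ := S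
  obtain rfl : μ = μ' := h
  refine ⟨e.symm.trans e', fun i => ?_⟩
  simp only [StandardTableau.content, Equiv.trans_apply, Equiv.symm_apply_apply]

theorem regular_eq {T S T' S' : StandardTableau} (h : T.shape = S.shape)
    (h' : T'.shape = S'.shape) : regular T T' = regular S S' := by
  obtain ⟨e, he⟩ := exists_equiv_content h
  obtain ⟨e', he'⟩ := exists_equiv_content h'
  ext u
  refine ⟨fun hu i j => ?_, fun hu i j => ?_⟩
  · rw [← e.apply_symm_apply i, he, ← e'.apply_symm_apply j, he']
    exact hu _ _
  · rw [← he, ← he']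
    exact hu _ _

/-- Both spaces are isomorphic to the irreducible module of the common shape, and the isomorphism
does not involve `u`. -/
theorem exists_tableauSpace_equiv {T S : Tableaux N} (h : T.1.shape = S.1.shape) :
    ∃ α : tableauSpace V T.1 ≃ₗ[ℂ] tableauSpace V S.1,
      ∀ p q, α.toLinearMap ∘ₗ tableauRep b T p q = tableauRep b S p q ∘ₗ α.toLinearMap := by
  have hT := exists_irrModule_equiv_tableauSpace T b
  rw [h] at hT
  obtain ⟨φ, hφ⟩ := hT
  obtain ⟨ψ, hψ⟩ := exists_irrModule_equiv_tableauSpace S b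
  refine ⟨φ.symm ≪≫ₗ ψ, fun p q => LinearMap.ext fun x => ?_⟩
  obtain ⟨m, rfl⟩ := φ.surjective x
  have h1 : tableauRep b T p q (φ m) =
      φ (UniversalEnvelopingAlgebra.ι ℂ (elemGl b p q) • m) := Subtype.ext (hφ _ m).symm
  have h2 : tableauRep b S p q (ψ m) =
      ψ (UniversalEnvelopingAlgebra.ι ℂ (elemGl b p q) • m) := Subtype.ext (hψ _ m).symm
  simp only [LinearMap.comp_apply, LinearEquiv.coe_coe, LinearEquiv.trans_apply, h1,
    LinearEquiv.symm_apply_apply, h2]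

theorem map_comp_tableauRes {T S T' S' : Tableaux N} (h : T.1.shape = S.1.shape)
    (h' : T'.1.shape = S'.1.shape) {α : tableauSpace V T.1 →ₗ[ℂ] tableauSpace V S.1}
    {β : tableauSpace V T'.1 →ₗ[ℂ] tableauSpace V S'.1}
    (hα : ∀ p q, α ∘ₗ tableauRep b T p q = tableauRep b S p q ∘ₗ α)
    (hβ : ∀ p q, β ∘ₗ tableauRep b T' p q = tableauRep b S' p q ∘ₗ β) {u : ℂ}
    (hu : u ∈ regular T.1 T'.1) :
    TensorProduct.map α β ∘ₗ tableauRes V T.1 T'.1 u =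
      tableauRes V S.1 S'.1 u ∘ₗ TensorProduct.map α β := by
  have : FiniteDimensional ℂ V := b.finiteDimensional_of_finite
  obtain ⟨e, he⟩ := exists_equiv_content h
  -- One tableau is changed at a time; the intermediate pair is regular at the same `u` because
  -- regularity depends only on the shapes.
  have hu₁ : u ∈ regular S.1 T'.1 := regular_eq h rfl ▸ hu
  have hu₂ : u ∈ regular S.1 S'.1 := regular_eq h h' ▸ hu
  have h1 : α.rTensor _ ∘ₗ tableauRes V T.1 T'.1 u = tableauRes V S.1 T'.1 u ∘ₗ α.rTensor _ :=
    (isJMSubrep_tableauSpace b T).resOp_natural_left (isJMSubrep_tableauSpace b S) e he hα hu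
  have h2 : β.lTensor _ ∘ₗ tableauRes V S.1 T'.1 u = tableauRes V S.1 S'.1 u ∘ₗ β.lTensor _ :=
    (isJMSubrep_tableauSpace b T').resOp_natural_right (isJMSubrep_tableauSpace b S') hβ hu₁ hu₂
      (add_content_ne_zero hu₁)
  rw [← LinearMap.lTensor_comp_rTensor, LinearMap.comp_assoc, h1, ← LinearMap.comp_assoc, h2,
    LinearMap.comp_assoc]

end TableauRestriction

end YangFusion

end

theorem corollary5p4 {N : ℕ} {V : Type*} [AddCommGroup V] [Module ℂ V]
    (b : Module.Basis (Fin N) ℂ V) :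
    -- the operators `F(T)` and the restrictions are well defined
    (∀ T : YangFusion.Tableaux N,
      YangFusion.IsConsecutiveValue (fun c => YangFusion.fusionFun V c) T.1.content
        (YangFusion.tableauOp V T.1)) ∧
    (∀ (T T' : YangFusion.Tableaux N), ∀ u ∈ YangFusion.regular T.1 T'.1,
      YangFusion.incl V T.1 T'.1 ∘ₗ YangFusion.fusedRes V T.1 T'.1 u =
        YangFusion.fused V T.1.content T'.1.content u ∘ₗ YangFusion.incl V T.1 T'.1) ∧
    -- `W_T` is stable under `gl(V)` and isomorphic to the irreducible module given by the shape
    (∀ T : YangFusion.Tableaux N,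
      ∃ φ : YangFusion.IrrModule b (YangFusion.shapeWeight N T.1.shape) ≃ₗ[ℂ]
          YangFusion.tableauSpace V T.1,
        ∀ (g : Module.End ℂ V) (m : YangFusion.IrrModule b (YangFusion.shapeWeight N T.1.shape)),
          (φ (UniversalEnvelopingAlgebra.ι ℂ g • m) : YangFusion.TPow V T.1.size) =
            YangFusion.glAction T.1.size g (φ m)) ∧
    -- the Yang--Baxter equation
    YangFusion.IsYangBaxterFamily
      (fun T : YangFusion.Tableaux N => YangFusion.tableauSpace V T.1)
      (fun T T' => YangFusion.regular T.1 T'.1)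
      (fun T T' => YangFusion.fusedRes V T.1 T'.1) ∧
    -- tableaux of the same shapes: the same operators up to a change of bases independent of `u`
    (∀ T S T' S' : YangFusion.Tableaux N, T.1.shape = S.1.shape → T'.1.shape = S'.1.shape →
      YangFusion.regular T.1 T'.1 = YangFusion.regular S.1 S'.1 ∧
      ∃ (α : YangFusion.tableauSpace V T.1 ≃ₗ[ℂ] YangFusion.tableauSpace V S.1)
        (β : YangFusion.tableauSpace V T'.1 ≃ₗ[ℂ] YangFusion.tableauSpace V S'.1),
        ∀ u ∈ YangFusion.regular T.1 T'.1,
          (TensorProduct.congr α β).conj (YangFusion.fusedRes V T.1 T'.1 u) =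
            YangFusion.fusedRes V S.1 S'.1 u) := by
  refine ⟨fun T => YangFusion.isConsecutiveValue_tableauOp T b,
    fun T T' u hu => YangFusion.incl_comp_fusedRes b hu,
    fun T => YangFusion.exists_irrModule_equiv_tableauSpace T b,
    YangFusion.isYangBaxterFamily_fusedRes b, fun T S T' S' h h' => ?_⟩
  obtain ⟨α, hα⟩ := YangFusion.exists_tableauSpace_equiv b h
  obtain ⟨β, hβ⟩ := YangFusion.exists_tableauSpace_equiv b h'
  refine ⟨YangFusion.regular_eq h h', α, β, fun u hu => ?_⟩
  have hu' : u ∈ YangFusion.regular S.1 S'.1 := YangFusion.regular_eq h h' ▸ hu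
  have key := YangFusion.map_comp_tableauRes b h h' hα hβ hu
  rw [YangFusion.fusedRes_eq_tableauRes b hu, YangFusion.fusedRes_eq_tableauRes b hu']
  refine LinearMap.ext fun x => ?_
  rw [LinearEquiv.conj_apply_apply]
  refine (LinearMap.congr_fun key _).trans (congrArg (YangFusion.tableauRes V S.1 S'.1 u) ?_)
  exact (TensorProduct.congr α β).apply_symm_apply x
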